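/- **Setting.** Let $M\in\mathbb C^{m\times n}$, $1\le \ell\le m$, $1\le q\le n$, $q\le \ell$. For $W\in\mathbb C^{r\times k}$ put $E_k(W)=W^*W-I_k$. For a matrix $A$ let $\|A\|_1=\max_i\sum_j|A_{ij}|$ and $\|A\|=\max(\|A\|_1,\|A^*\|_1)$. Consider triplets $(U,V,\Sigma)$ with $U\in\mathbb C^{m\times\ell}$, $V\in\mathbb C^{n\times q}$ and $\Sigma\in\mathbb R^{\ell\times q}$ diagonal with diagonal $(\sigma_1,\dots,\sigma_q)$ (the rows after the $q$-th are zero). The SVD system is $E_\ell(U)=0$, $E_q(V)=0$, $U^*MV-\Sigma=0$. Call $\Sigma$ regular if $\sigma_i\ne0$ for all $i$ and $\sigma_i\pm\sigma_j\neq0$ for $i\ne j$, and put $$\kappa(\Sigma)=\max\Bigl(1,\max_i\tfrac1{|\sigma_i|},\max_{i\ne j}\bigl(\tfrac1{|\sigma_i-\sigma_j|}+\tfrac1{|\sigma_i+\sigma_j|}\bigr)\Bigr),\qquad K(\Sigma)=\max\bigl(1,\max_i|\sigma_i|\bigr)$$ (for $q=1$ the maximum over $i\neq j$ is omitted). **The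 map $H_p$** ($p\ge1$). Let $s_p$, $c_p$ be the truncations at degree $p$ of the power series at $0$ of $-1+(1+u)^{-1/2}$ and of $(1+u^2)^{1/2}+u-1$. For regular $\Sigma$ and $D=(\delta_{ij})\in\mathbb C^{\ell\times q}$ the equation $D-S-X\Sigma+\Sigma Y=0$ has the following solution with $S$ real diagonal and $X\in\mathbb C^{\ell\times \ell}$, $Y\in\mathbb C^{q\times q}$ skew Hermitian: $S_{ii}=\operatorname{Re}\delta_{ii}$ and $x_{ii}=-y_{ii}=\mathrm i\operatorname{Im}\delta_{ii}/(2\sigma_i)$ for $i\le q$; $$x_{ij}=\tfrac12\Bigl(\tfrac{\delta_{ij}+\overline{\delta_{ji}}}{\sigma_j-\sigma_i}+\tfrac{\delta_{ij}-\overline{\delta_{ji}}}{\sigma_j+\sigma_i}\Bigr),\qquad y_{ij}=\tfrac12\Bigl(\tfrac{\delta_{ij}+\overline{\delta_{ji}}}{\sigma_j-\sigma_i}-\tfrac{\delta_{ij}-\overline{\delta_{ji}}}{\sigma_j+\sigma_i}\Bigr)$$ for $i\ne j$, $i,j\le q$; $x_{ij}=\delta_{ij}/\sigma_j=-\overline{x_{ji}}$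 for $j\le q<i$; $x_{ij}=0$ for $i,j>q$. Put $\Delta=U^*MV-\Sigma$, $\Omega=s_p(E_\ell(U))$, $\Lambda=s_p(E_q(V))$ and $\Delta_1=(I+\Omega)(\Delta+\Sigma)(I+\Lambda)-\Sigma$. For $k=1,\dots,p$ let $(S_k,X_k,Y_k)$ be the above solution for $D=\Delta_k$, where for $k\ge2$ $$\Delta_k=(I+\Theta_{k-1}^*)(\Delta_1+\Sigma)(I+\Psi_{k-1})-\Sigma-\sum_{j<k}S_j,\qquad \Theta_k=c_p(X_1+\dots+X_k),\quad \Psi_k=c_p(Y_1+\dots+Y_k).$$ Then $H_p(U,V,\Sigma)=\bigl(U(I+\Omega)(I+\Theta_p),\;V(I+\Lambda)(I+\Psi_p),\;\Sigma+S_1+\dots+S_p\bigr)$. **Constants.** $(a,u_0,\gamma_1)=(2,\,0.0289,\,6.1)$ if $p=1$, $(4/3,\,0.046,\,9.41)$ if $p=2$, $(4/3,\,0.0297,\,10.2)$ if $p\ge3$; and $\sigma=1.67$ if $p=1$ and $q\ge2$, $\sigma=2.1$ if $p=q=1$ or $p=2$, $\sigma=2.62$ if $p\ge3$. **Theorem.**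 Let $p\ge1$, let $\Sigma_0$ be regular, $(U_{i+1},V_{i+1},\Sigma_{i+1})=H_p(U_i,V_i,\Sigma_i)$ for $i\ge0$, $\kappa=\kappa(\Sigma_0)$, $K=K(\Sigma_0)$ and $\Delta_0=U_0^*MV_0-\Sigma_0$. Suppose $$\max\bigl((\kappa K)^a\|E_\ell(U_0)\|,\ (\kappa K)^a\|E_q(V_0)\|,\ \kappa^aK^{a-1}\|\Delta_0\|\bigr)\le\varepsilon\le u_0 .$$ Then every $\Sigma_i$ is regular (so the sequence is well defined), and $(U_i,V_i,\Sigma_i)$ converges with order $p+1$ to a solution $(U_\infty,V_\infty,\Sigma_\infty)$ of the SVD system, i.e. for some $c>0$ the distance (the maximum of the norms of the three differences) is at most $c\,2^{-(p+1)^i+1}$ for all $i\geq 0$. If $\Sigma_0$ has nonnegative diagonal, so has $\Sigma_\infty$. For all $i\ge0$, $$\|U_i-U_\infty\|\le\gamma_1\sqrt m\,2^{-(p+1)^i+1}\varepsilon,\qquad \|U_i-U_\infty\|_1\le\gamma_1\sqrt \ell\,2^{-(p+1)^i+1}\varepsilon,$$ $$\|V_i-V_\infty\|\le\gamma_1\sqrt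 n\,2^{-(p+1)^i+1}\varepsilon,\qquad \|V_i-V_\infty\|_1\le\gamma_1\sqrt q\,2^{-(p+1)^i+1}\varepsilon,$$ $$\|\Sigma_i-\Sigma_\infty\|\le\sigma\,2^{-(p+1)^i+1}\varepsilon .$$ -/

import Mathlib

open scoped Matrix NNReal

noncomputable section

namespace HighOrderSVD

/-- The matrix norm `‖A‖₁`: the largest sum of moduli along a row. -/
def rowNorm {r c : ℕ} (A : Matrix (Fin r) (Fin c) ℂ) : ℝ :=
  ((Finset.univ.sup fun i : Fin r => ∑ j : Fin c, ‖A i j‖₊ : ℝ≥0) : ℝ)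

/-- The matrix norm `‖A‖ = max (‖A‖₁, ‖A^*‖₁)`. -/
def matNorm {r c : ℕ} (A : Matrix (Fin r) (Fin c) ℂ) : ℝ :=
  max (rowNorm A) (rowNorm Aᴴ)

/-- `E_k(W) = W^* W - I_k`. -/
def stiefelDefect {r k : ℕ} (W : Matrix (Fin r) (Fin k) ℂ) : Matrix (Fin k) (Fin k) ℂ :=
  Wᴴ * W - 1

/-- The `ℓ × q` matrix (with `q ≤ ℓ`) whose upper block is `diag (σ_1, …, σ_q)` and whose other
rows are zero. -/
def rectDiag (ℓ : ℕ) {q : ℕ} (σ : Fin q → ℝ) : Matrix (Fin ℓ) (Fin q) ℂ :=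
  Matrix.of fun i j => if (i : ℕ) = (j : ℕ) then ((σ j : ℝ) : ℂ) else 0

/-- A triplet `(U, V, Σ)`; the diagonal matrix `Σ` is stored through its real diagonal `σ`. -/
@[ext]
structure Triplet (m n ℓ q : ℕ) where
  U : Matrix (Fin m) (Fin ℓ) ℂ
  V : Matrix (Fin n) (Fin q) ℂ
  σ : Fin q → ℝ

/-- `Δ = U^* M V - Σ`. -/
def residual {m n ℓ q : ℕ} (M : Matrix (Fin m) (Fin n) ℂ) (T : Triplet m n ℓ q) :
    Matrix (Fin ℓ) (Fin q) ℂ :=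
  T.Uᴴ * M * T.V - rectDiag ℓ T.σ

/-- The SVD system `E_ℓ(U) = 0`, `E_q(V) = 0`, `U^* M V - Σ = 0`. -/
def IsSVDSolution {m n ℓ q : ℕ} (M : Matrix (Fin m) (Fin n) ℂ) (T : Triplet m n ℓ q) : Prop :=
  stiefelDefect T.U = 0 ∧ stiefelDefect T.V = 0 ∧ residual M T = 0

/-- The regular case: `σ_i ≠ 0` and `σ_i ± σ_j ≠ 0` for `i ≠ j`, so that no denominator in
`kappa σ`, `solX` and `solY` vanishes. -/
def IsRegular {q : ℕ} (σ : Fin q → ℝ) : Prop :=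
  (∀ i, σ i ≠ 0) ∧ ∀ i j, i ≠ j → σ i - σ j ≠ 0 ∧ σ i + σ j ≠ 0

/-- `κ(Σ) = max (1, max_i 1/|σ_i|, max_{i ≠ j} (1/|σ_i - σ_j| + 1/|σ_i + σ_j|))`; a maximum over
no index (here: over the pairs `i ≠ j`, when `q = 1`) counts as `0`. -/
def kappa {q : ℕ} (σ : Fin q → ℝ) : ℝ :=
  max 1 (max (⨆ i : Fin q, 1 / |σ i|)
    (⨆ x : {x : Fin q × Fin q // x.1 ≠ x.2},
      (1 / |σ x.1.1 - σ x.1.2| + 1 / |σ x.1.1 + σ x.1.2|)))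

/-- `K(Σ) = max (1, max_i |σ_i|)`. -/
def bigK {q : ℕ} (σ : Fin q → ℝ) : ℝ :=
  max 1 (⨆ i : Fin q, |σ i|)

/-- `s_p(A)`, where `s_p(u) = ∑_{k=1}^p (-1)^k 4^{-k} (2k choose k) u^k` is the truncation at
degree `p` of the expansion of `-1 + (1 + u)^{-1/2}`. -/
def sPoly (p : ℕ) {k : ℕ} (A : Matrix (Fin k) (Fin k) ℂ) : Matrix (Fin k) (Fin k) ℂ :=
  ∑ j ∈ Finset.Icc 1 p, ((-1 : ℂ) ^ j * (Nat.centralBinom j : ℂ) / 4 ^ j) • A ^ j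

/-- `c_p(A)` for `p ≥ 1`, where
`c_p(u) = u + ∑_{1 ≤ j, 2j ≤ p} (-1)^{j+1} 4^{-j} (2j choose j) (2j-1)^{-1} u^{2j}` is the
truncation at degree `p` of the expansion of `(1 + u^2)^{1/2} + u - 1`. -/
def cPoly (p : ℕ) {k : ℕ} (A : Matrix (Fin k) (Fin k) ℂ) : Matrix (Fin k) (Fin k) ℂ :=
  A + ∑ j ∈ Finset.Icc 1 (p / 2),
    ((-1 : ℂ) ^ (j + 1) * (Nat.centralBinom j : ℂ) / (4 ^ j * (2 * (j : ℂ) - 1))) • A ^ (2 * j)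

/-- The diagonal `S` in the explicit solution of `D - S - X Σ + Σ Y = 0`: `S_ii = Re D_ii`. -/
def solS {ℓ q : ℕ} (h : q ≤ ℓ) (D : Matrix (Fin ℓ) (Fin q) ℂ) : Fin q → ℝ :=
  fun i => (D (Fin.castLE h i) i).re

/-- The skew Hermitian `ℓ × ℓ` matrix `X` in the explicit solution of `D - S - X Σ + Σ Y = 0`. -/
def solX {ℓ q : ℕ} (σ : Fin q → ℝ) (D : Matrix (Fin ℓ) (Fin q) ℂ) :
    Matrix (Fin ℓ) (Fin ℓ) ℂ :=
  Matrix.of fun i j =>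
    if hi : (i : ℕ) < q then
      if hj : (j : ℕ) < q then
        if i = j then
          (((D i ⟨i, hi⟩).im / (2 * σ ⟨i, hi⟩) : ℝ) : ℂ) * Complex.I
        else
          (1 / 2 : ℂ) *
            ((D i ⟨j, hj⟩ + star (D j ⟨i, hi⟩)) / ((σ ⟨j, hj⟩ : ℂ) - (σ ⟨i, hi⟩ : ℂ))
              + (D i ⟨j, hj⟩ - star (D j ⟨i, hi⟩)) / ((σ ⟨j, hj⟩ : ℂ) + (σ ⟨i, hi⟩ : ℂ)))
      else -(star (D j ⟨i, hi⟩) / (σ ⟨i, hi⟩ : ℂ))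
    else
      if hj : (j : ℕ) < q then D i ⟨j, hj⟩ / (σ ⟨j, hj⟩ : ℂ) else 0

/-- The skew Hermitian `q × q` matrix `Y` in the explicit solution of `D - S - X Σ + Σ Y = 0`. -/
def solY {ℓ q : ℕ} (h : q ≤ ℓ) (σ : Fin q → ℝ) (D : Matrix (Fin ℓ) (Fin q) ℂ) :
    Matrix (Fin q) (Fin q) ℂ :=
  Matrix.of fun i j =>
    if i = j then
      -((((D (Fin.castLE h i) i).im / (2 * σ i) : ℝ) : ℂ) * Complex.I)
    else
      (1 / 2 : ℂ) *
        ((D (Fin.castLE h i) j + star (D (Fin.castLE h j) i)) / ((σ j : ℂ) - (σ i : ℂ))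
          - (D (Fin.castLE h i) j - star (D (Fin.castLE h j) i)) / ((σ j : ℂ) + (σ i : ℂ)))

/-- The partial sums `S_1 + ⋯ + S_k`, `X_1 + ⋯ + X_k`, `Y_1 + ⋯ + Y_k`. -/
structure Correction (ℓ q : ℕ) where
  S : Fin q → ℝ
  X : Matrix (Fin ℓ) (Fin ℓ) ℂ
  Y : Matrix (Fin q) (Fin q) ℂ

/-- `(I + c_p(X)^*) (Δ_1 + Σ) (I + c_p(Y)) - Σ - S` for the partial sums `S`, `X`, `Y`. Here `W`
is `Δ_1 + Σ`. For the `k`-th partial sums this is `Δ_{k+1}`; for `k = 0` it is `Δ_1`, because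
`c_p(0) = 0`. -/
def innerResidual (p : ℕ) {ℓ q : ℕ} (σ : Fin q → ℝ) (W : Matrix (Fin ℓ) (Fin q) ℂ)
    (c : Correction ℓ q) : Matrix (Fin ℓ) (Fin q) ℂ :=
  (1 + (cPoly p c.X)ᴴ) * W * (1 + cPoly p c.Y) - rectDiag ℓ σ - rectDiag ℓ c.S

/-- The `k`-th partial sums, obtained by solving `Δ_j - S_j - X_j Σ + Σ Y_j = 0` for
`j = 1, …, k` one after the other. -/
def correction (p : ℕ) {ℓ q : ℕ} (h : q ≤ ℓ) (σ : Fin q → ℝ) (W : Matrix (Fin ℓ) (Fin q) ℂ) :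
    ℕ → Correction ℓ q
  | 0 => ⟨0, 0, 0⟩
  | k + 1 =>
    let c := correction p h σ W k
    let D := innerResidual p σ W c
    ⟨c.S + solS h D, c.X + solX σ D, c.Y + solY h σ D⟩

/-- The map `H_p`: `(U, V, Σ) ↦ (U (I + Ω) (I + Θ), V (I + Λ) (I + Ψ), Σ + S)` with
`Ω = s_p(E_ℓ(U))`, `Λ = s_p(E_q(V))`, `Θ = c_p(X_1 + ⋯ + X_p)`, `Ψ = c_p(Y_1 + ⋯ + Y_p)` and
`S = S_1 + ⋯ + S_p`, where `Δ_1 + Σ = (I + Ω) (Δ + Σ) (I + Λ)`. -/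
def mapH (p : ℕ) {m n ℓ q : ℕ} (h : q ≤ ℓ) (M : Matrix (Fin m) (Fin n) ℂ)
    (T : Triplet m n ℓ q) : Triplet m n ℓ q :=
  let Ω := sPoly p (stiefelDefect T.U)
  let Λ := sPoly p (stiefelDefect T.V)
  let W := (1 + Ω) * (residual M T + rectDiag ℓ T.σ) * (1 + Λ)
  let c := correction p h T.σ W p
  ⟨T.U * (1 + Ω) * (1 + cPoly p c.X), T.V * (1 + Λ) * (1 + cPoly p c.Y), T.σ + c.S⟩

/-- The distance of two triplets: the largest of the norms of the three differences. -/
def tripletDist {m n ℓ q : ℕ} (S T : Triplet m n ℓ q) : ℝ :=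
  max (max (matNorm (S.U - T.U)) (matNorm (S.V - T.V)))
    (matNorm (rectDiag ℓ S.σ - rectDiag ℓ T.σ))

/-- `T_i` converges to `T_∞` with order `r`: for some `c > 0`,
`‖T_i - T_∞‖ ≤ c 2^{-r^i + 1}` for all `i`. -/
def ConvergesWithOrder {m n ℓ q : ℕ} (r : ℕ) (T : ℕ → Triplet m n ℓ q)
    (Tlim : Triplet m n ℓ q) : Prop :=
  ∃ c : ℝ, 0 < c ∧ ∀ i : ℕ, tripletDist (T i) Tlim ≤ c * (2 : ℝ) ^ (-((r : ℤ) ^ i) + 1)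

/-- The exponent `a`. -/
def aConst (p : ℕ) : ℝ := if p = 1 then 2 else 4 / 3

/-- The threshold `u_0`. -/
def u0Const (p : ℕ) : ℝ := if p = 1 then 0.0289 else if p = 2 then 0.046 else 0.0297

/-- The constant `γ_1`. -/
def gammaConst (p : ℕ) : ℝ := if p = 1 then 6.1 else if p = 2 then 9.41 else 10.2

/-- The constant `σ`. -/
def sigmaConst (p q : ℕ) : ℝ :=
  if p = 1 then (if q = 1 then 2.1 else 1.67) else if p = 2 then 2.1 else 2.62

end HighOrderSVD

end

/-!
The map `H_p` is a Newton-like step of order `p + 1` for the SVD system, and the theorem is a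
quantitative version of this: one step turns relative defects of size `w ≤ u₀` into relative
defects of size at most `w (w / (2 u₀)) ^ p` (`isGoodStep`), where "relative" refers to the
condition number of the current `Σ`, which the step also changes (`IsApprox`). Starting from `w =
ε ≤ u₀`, induction gives `w = 2 ^ (-(p + 1) ^ i + 1) ε` for the `i`-th iterate.

A step first multiplies `U` and `V` by the truncation `1 + s_p(E)` of `(1 + E)^{-1/2}`. The
truncation error `(1 + u) (1 + s_p(u)) ^ 2 - 1` has order `p + 1` with coefficients of modulus at
most `1`, by the differential equation of `(1 + u)^{-1/2}` (`one_add_X_mul_invSqrtPoly_sq`). Then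
`U` and `V` are multiplied by `1 + c_p(X)` and `1 + c_p(Y)` with `X`, `Y` skew Hermitian, which is
unitary up to an error of order greater than `p`, as `c_p(u)` is a truncation of `(1 + u ^
2)^{1/2} + u - 1` (`matNorm_cPoly_unitary_error_le`). The matrices `X`, `Y` are sums of solutions
of the linearized equation, whose norms are controlled by `κ` (`matNorm_solX_le`,
`matNorm_solY_le`), and each of the `p` inner corrections reduces the residual by a factor
proportional to `w`. For `p ≥ 2` this works with `a = 4 / 3`, since `(1 - X + X ^ 2 / 2) W (1 + Y
+ Y ^ 2 / 2)` equals `W - (X W - W Y)` up to products of `X W - W Y`, which is small although `W`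
may be large, and a term of degree four (`quadratic_sandwich_eq`, `scaledDelta_succ_le`). For `p =
1` the term `X W Y` remains, and `a = 2` is needed (`scaledDelta_one_le_of_p_eq_one`).

The step multiplies `U` and `V` on the right by some `1 + Γ` with `‖Γ‖ ≤ g w`, and nearly
isometric matrices have spectral norm close to `1`. So the `U_i`, `V_i` converge, by a geometric
series, with the claimed bounds (`exists_limit_of_factors`). Summing up the changes of `Σ` is too
crude for the constant `σ`. Instead `U_∞ = U_i P` and `V_∞ = V_i N` with `P`, `N` close to
isometries, hence `Σ_∞ = P^* (Σ_i + Δ_i) N`, and a perturbation bound of Weyl type compares the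
moduli of the two diagonals (`abs_abs_sub_abs_le`). It applies entry by entry because the steps
preserve the order of the `|σ_j|` and, as is also needed, the signs of the `σ_j`
(`sign_and_order_of_limit`).
-/

namespace HighOrderSVD

/-! ### The norms `‖·‖₁` and `‖·‖` -/

section Norms

variable {r c k : ℕ}

lemma rowNorm_le_iff {A : Matrix (Fin r) (Fin c) ℂ} {b : ℝ} (hb : 0 ≤ b) :
    rowNorm A ≤ b ↔ ∀ i, ∑ j, ‖A i j‖ ≤ b := by
  lift b to ℝ≥0 using hb
  rw [rowNorm, NNReal.coe_le_coe, Finset.sup_le_iff]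
  simp only [Finset.mem_univ, true_implies, ← NNReal.coe_le_coe, NNReal.coe_sum, coe_nnnorm]

lemma rowNorm_nonneg (A : Matrix (Fin r) (Fin c) ℂ) : 0 ≤ rowNorm A := NNReal.coe_nonneg _

lemma row_sum_le (A : Matrix (Fin r) (Fin c) ℂ) (i : Fin r) : ∑ j, ‖A i j‖ ≤ rowNorm A :=
  (rowNorm_le_iff (rowNorm_nonneg A)).1 le_rfl i

lemma rowNorm_add_le (A B : Matrix (Fin r) (Fin c) ℂ) :
    rowNorm (A + B) ≤ rowNorm A + rowNorm B := by
  refine (rowNorm_le_iff (add_nonneg (rowNorm_nonneg _) (rowNorm_nonneg _))).2 fun i => ?_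
  calc ∑ j, ‖(A + B) i j‖ ≤ ∑ j, (‖A i j‖ + ‖B i j‖) :=
        Finset.sum_le_sum fun j _ => norm_add_le _ _
    _ = ∑ j, ‖A i j‖ + ∑ j, ‖B i j‖ := Finset.sum_add_distrib
    _ ≤ _ := add_le_add (row_sum_le A i) (row_sum_le B i)

lemma rowNorm_mul_le (A : Matrix (Fin r) (Fin c) ℂ) (B : Matrix (Fin c) (Fin k) ℂ) :
    rowNorm (A * B) ≤ rowNorm A * rowNorm B := by
  refine (rowNorm_le_iff (mul_nonneg (rowNorm_nonneg _) (rowNorm_nonneg _))).2 fun i => ?_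
  calc ∑ j, ‖(A * B) i j‖ ≤ ∑ j, ∑ l, ‖A i l‖ * ‖B l j‖ := by
        refine Finset.sum_le_sum fun j _ => ?_
        rw [Matrix.mul_apply]
        exact (norm_sum_le _ _).trans (Finset.sum_le_sum fun l _ => (norm_mul _ _).le)
    _ = ∑ l, ‖A i l‖ * ∑ j, ‖B l j‖ := by
        rw [Finset.sum_comm]; simp only [Finset.mul_sum]
    _ ≤ ∑ l, ‖A i l‖ * rowNorm B := by
        gcongr with l; exact row_sum_le B l
    _ = (∑ l, ‖A i l‖) * rowNorm B := by rw [Finset.sum_mul]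
    _ ≤ _ := mul_le_mul_of_nonneg_right (row_sum_le A i) (rowNorm_nonneg B)

lemma rowNorm_smul (z : ℂ) (A : Matrix (Fin r) (Fin c) ℂ) :
    rowNorm (z • A) ≤ ‖z‖ * rowNorm A := by
  refine (rowNorm_le_iff (mul_nonneg (norm_nonneg _) (rowNorm_nonneg _))).2 fun i => ?_
  simp only [Matrix.smul_apply, norm_smul, ← Finset.mul_sum]
  exact mul_le_mul_of_nonneg_left (row_sum_le A i) (norm_nonneg z)

lemma rowNorm_neg (A : Matrix (Fin r) (Fin c) ℂ) : rowNorm (-A) = rowNorm A := by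
  simp [rowNorm]

lemma rowNorm_one_le : rowNorm (1 : Matrix (Fin r) (Fin r) ℂ) ≤ 1 := by
  refine (rowNorm_le_iff zero_le_one).2 fun i => ?_
  simp [Matrix.one_apply, apply_ite]

lemma matNorm_nonneg (A : Matrix (Fin r) (Fin c) ℂ) : 0 ≤ matNorm A :=
  (rowNorm_nonneg A).trans (le_max_left _ _)

lemma rowNorm_le_matNorm (A : Matrix (Fin r) (Fin c) ℂ) : rowNorm A ≤ matNorm A :=
  le_max_left _ _

lemma matNorm_conjTranspose (A : Matrix (Fin r) (Fin c) ℂ) : matNorm Aᴴ = matNorm A := by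
  rw [matNorm, matNorm, Matrix.conjTranspose_conjTranspose, max_comm]

lemma row_sum_le_matNorm (A : Matrix (Fin r) (Fin c) ℂ) (i : Fin r) :
    ∑ j, ‖A i j‖ ≤ matNorm A := (row_sum_le A i).trans (le_max_left _ _)

lemma col_sum_le_matNorm (A : Matrix (Fin r) (Fin c) ℂ) (j : Fin c) :
    ∑ i, ‖A i j‖ ≤ matNorm A := by
  have := row_sum_le_matNorm Aᴴ j
  simpa [matNorm_conjTranspose] using this

lemma matNorm_le {A : Matrix (Fin r) (Fin c) ℂ} {b : ℝ} (hb : 0 ≤ b)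
    (h₁ : ∀ i, ∑ j, ‖A i j‖ ≤ b) (h₂ : ∀ j, ∑ i, ‖A i j‖ ≤ b) : matNorm A ≤ b := by
  refine max_le ((rowNorm_le_iff hb).2 h₁) ((rowNorm_le_iff hb).2 fun j => ?_)
  simpa using h₂ j

lemma norm_apply_le_matNorm (A : Matrix (Fin r) (Fin c) ℂ) (i : Fin r) (j : Fin c) :
    ‖A i j‖ ≤ matNorm A :=
  (Finset.single_le_sum (f := fun j => ‖A i j‖) (fun _ _ => norm_nonneg _)
    (Finset.mem_univ j)).trans (row_sum_le_matNorm A i)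

lemma matNorm_neg (A : Matrix (Fin r) (Fin c) ℂ) : matNorm (-A) = matNorm A := by
  rw [matNorm, matNorm, Matrix.conjTranspose_neg, rowNorm_neg, rowNorm_neg]

lemma matNorm_zero : matNorm (0 : Matrix (Fin r) (Fin c) ℂ) = 0 :=
  le_antisymm (matNorm_le le_rfl (by simp) (by simp)) (matNorm_nonneg _)

lemma matNorm_one_le : matNorm (1 : Matrix (Fin r) (Fin r) ℂ) ≤ 1 :=
  max_le rowNorm_one_le (by rw [Matrix.conjTranspose_one]; exact rowNorm_one_le)

lemma matNorm_add_le {A B : Matrix (Fin r) (Fin c) ℂ} {a b : ℝ} (hA : matNorm A ≤ a)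
    (hB : matNorm B ≤ b) : matNorm (A + B) ≤ a + b := by
  refine max_le ?_ ?_
  · exact (rowNorm_add_le A B).trans
      (add_le_add ((le_max_left _ _).trans hA) ((le_max_left _ _).trans hB))
  · rw [Matrix.conjTranspose_add]
    exact (rowNorm_add_le _ _).trans
      (add_le_add ((le_max_right _ _).trans hA) ((le_max_right _ _).trans hB))

lemma matNorm_sub_le {A B : Matrix (Fin r) (Fin c) ℂ} {a b : ℝ} (hA : matNorm A ≤ a)
    (hB : matNorm B ≤ b) : matNorm (A - B) ≤ a + b := by
  rw [sub_eq_add_neg]; exact matNorm_add_le hA (by rwa [matNorm_neg])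

lemma matNorm_mul_le {A : Matrix (Fin r) (Fin c) ℂ} {B : Matrix (Fin c) (Fin k) ℂ} {a b : ℝ}
    (hA : matNorm A ≤ a) (hB : matNorm B ≤ b) : matNorm (A * B) ≤ a * b := by
  have ha : 0 ≤ a := (matNorm_nonneg A).trans hA
  refine max_le ?_ ?_
  · exact (rowNorm_mul_le A B).trans (mul_le_mul ((le_max_left _ _).trans hA)
      ((le_max_left _ _).trans hB) (rowNorm_nonneg _) ha)
  · rw [Matrix.conjTranspose_mul, mul_comm a]
    exact (rowNorm_mul_le _ _).trans (mul_le_mul ((le_max_right _ _).trans hB)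
      ((le_max_right _ _).trans hA) (rowNorm_nonneg _) ((matNorm_nonneg B).trans hB))

lemma matNorm_smul_le {z : ℂ} {A : Matrix (Fin r) (Fin c) ℂ} {t a : ℝ} (hz : ‖z‖ ≤ t)
    (hA : matNorm A ≤ a) : matNorm (z • A) ≤ t * a := by
  have ht : 0 ≤ t := (norm_nonneg z).trans hz
  refine max_le ?_ ?_
  · exact (rowNorm_smul z A).trans (mul_le_mul hz ((le_max_left _ _).trans hA)
      (rowNorm_nonneg _) ht)
  · rw [Matrix.conjTranspose_smul]
    exact (rowNorm_smul _ _).trans (mul_le_mul (by rwa [norm_star])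
      ((le_max_right _ _).trans hA) (rowNorm_nonneg _) ht)

lemma matNorm_pow_le {A : Matrix (Fin r) (Fin r) ℂ} {a : ℝ} (hA : matNorm A ≤ a) (n : ℕ) :
    matNorm (A ^ n) ≤ a ^ n := by
  induction n with
  | zero => simpa using matNorm_one_le
  | succ n ih => rw [pow_succ, pow_succ]; exact matNorm_mul_le ih hA

lemma matNorm_sum_le {ι : Type*} (s : Finset ι) {f : ι → Matrix (Fin r) (Fin c) ℂ} {b : ι → ℝ}
    (h : ∀ i ∈ s, matNorm (f i) ≤ b i) : matNorm (∑ i ∈ s, f i) ≤ ∑ i ∈ s, b i := by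
  classical
  induction s using Finset.induction_on with
  | empty => simp [matNorm_zero]
  | insert i s hi ih =>
    rw [Finset.sum_insert hi, Finset.sum_insert hi]
    exact matNorm_add_le (h i (Finset.mem_insert_self i s))
      (ih fun j hj => h j (Finset.mem_insert_of_mem hj))

lemma matNorm_pow_sub_pow_le {A B : Matrix (Fin r) (Fin r) ℂ} {ρ z : ℝ} (hA : matNorm A ≤ ρ)
    (hB : matNorm B ≤ ρ) (hz : matNorm (A - B) ≤ z) (n : ℕ) :
    matNorm (A ^ n - B ^ n) ≤ n * ρ ^ (n - 1) * z := by
  induction n with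
  | zero => simp [matNorm_zero]
  | succ n ih =>
    have : A ^ (n + 1) - B ^ (n + 1) = A ^ n * (A - B) + (A ^ n - B ^ n) * B := by
      rw [pow_succ, pow_succ]; noncomm_ring
    rw [this]
    refine (matNorm_add_le (matNorm_mul_le (matNorm_pow_le hA n) hz)
      (matNorm_mul_le ih hB)).trans (le_of_eq ?_)
    rcases n with - | n
    · simp
    · simp only [Nat.add_sub_cancel]; push_cast; ring

lemma rectDiag_add (ℓ : ℕ) {q : ℕ} (σ τ : Fin q → ℝ) :
    rectDiag ℓ (σ + τ) = rectDiag ℓ σ + rectDiag ℓ τ := by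
  ext i j; simp only [rectDiag, Matrix.of_apply, Matrix.add_apply, Pi.add_apply]
  split_ifs <;> simp

lemma rectDiag_zero (ℓ : ℕ) {q : ℕ} : rectDiag ℓ (0 : Fin q → ℝ) = 0 := by
  ext i j; simp [rectDiag]

lemma rectDiag_sub (ℓ : ℕ) {q : ℕ} (σ τ : Fin q → ℝ) :
    rectDiag ℓ (σ - τ) = rectDiag ℓ σ - rectDiag ℓ τ := by
  ext i j; simp only [rectDiag, Matrix.of_apply, Matrix.sub_apply, Pi.sub_apply]
  split_ifs <;> simp

lemma matNorm_rectDiag_le {ℓ q : ℕ} {σ : Fin q → ℝ} {b : ℝ} (hb : 0 ≤ b)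
    (h : ∀ j, |σ j| ≤ b) : matNorm (rectDiag ℓ σ) ≤ b := by
  have key : ∀ i j, ‖rectDiag ℓ σ i j‖ = if (i : ℕ) = (j : ℕ) then |σ j| else 0 := by
    intro i j; simp only [rectDiag, Matrix.of_apply]; split_ifs <;> simp
  refine matNorm_le hb (fun i => ?_) (fun j => ?_)
  · simp only [key]
    by_cases hi : (i : ℕ) < q
    · rw [Finset.sum_eq_single ⟨i, hi⟩]
      · simpa using h _
      · intro j _ hj
        rw [if_neg]; intro hij; exact hj (Fin.ext hij.symm)
      · simp
    · rw [Finset.sum_eq_zero]; · exact hb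
      intro j _
      rw [if_neg]; intro hij; exact hi (hij ▸ j.2)
  · simp only [key]
    by_cases hj : (j : ℕ) < ℓ
    · rw [Finset.sum_eq_single ⟨j, hj⟩]
      · simpa using h _
      · intro i _ hi
        rw [if_neg]; intro hij; exact hi (Fin.ext hij)
      · simp
    · rw [Finset.sum_eq_zero]; · exact hb
      intro i _
      rw [if_neg]; intro hij; exact hj (hij ▸ i.2)

end Norms

/-! ### The truncated series `s_p` and `c_p` -/

section Series

open Polynomial

/-- The coefficient `(-1)^j 4^{-j} (2j choose j)` of `u^j` in `(1 + u)^{-1/2}`. -/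
noncomputable def invSqrtCoeff (j : ℕ) : ℂ := (-1 : ℂ) ^ j * (Nat.centralBinom j : ℂ) / 4 ^ j

lemma invSqrtCoeff_zero : invSqrtCoeff 0 = 1 := by simp [invSqrtCoeff]

lemma invSqrtCoeff_succ (j : ℕ) :
    2 * ((j : ℂ) + 1) * invSqrtCoeff (j + 1) = -((2 * j + 1) * invSqrtCoeff j) := by
  have h : ((j : ℂ) + 1) * (Nat.centralBinom (j + 1) : ℂ)
      = 2 * (2 * j + 1) * (Nat.centralBinom j : ℂ) := by
    exact_mod_cast Nat.succ_mul_centralBinom_succ j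
  rw [invSqrtCoeff, invSqrtCoeff, pow_succ (-1 : ℂ), pow_succ (4 : ℂ)]
  have h4 : (4 : ℂ) ^ j ≠ 0 := pow_ne_zero _ (by norm_num)
  field_simp
  linear_combination (-2) * h

lemma norm_invSqrtCoeff (j : ℕ) : ‖invSqrtCoeff j‖ = (Nat.centralBinom j : ℝ) / 4 ^ j := by
  simp [invSqrtCoeff]

lemma norm_invSqrtCoeff_succ (j : ℕ) :
    2 * ((j : ℝ) + 1) * ‖invSqrtCoeff (j + 1)‖ = (2 * j + 1) * ‖invSqrtCoeff j‖ := by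
  have h : ((j : ℝ) + 1) * (Nat.centralBinom (j + 1) : ℝ)
      = 2 * (2 * j + 1) * (Nat.centralBinom j : ℝ) := by
    exact_mod_cast Nat.succ_mul_centralBinom_succ j
  rw [norm_invSqrtCoeff, norm_invSqrtCoeff, pow_succ (4 : ℝ)]
  field_simp
  linear_combination 2 * h

lemma norm_invSqrtCoeff_succ_le (j : ℕ) : ‖invSqrtCoeff (j + 1)‖ ≤ ‖invSqrtCoeff j‖ := by
  have h := norm_invSqrtCoeff_succ j
  have h0 := norm_nonneg (invSqrtCoeff (j + 1))
  have h1 := norm_nonneg (invSqrtCoeff j)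
  have hj : (0 : ℝ) ≤ j := j.cast_nonneg
  nlinarith

lemma norm_invSqrtCoeff_antitone : Antitone fun j => ‖invSqrtCoeff j‖ :=
  antitone_nat_of_succ_le norm_invSqrtCoeff_succ_le

lemma norm_invSqrtCoeff_le_one (j : ℕ) : ‖invSqrtCoeff j‖ ≤ 1 :=
  (norm_invSqrtCoeff_antitone (Nat.zero_le j)).trans (by simp [invSqrtCoeff_zero])

lemma norm_invSqrtCoeff_le_half {j : ℕ} (hj : 1 ≤ j) : ‖invSqrtCoeff j‖ ≤ 1 / 2 := by
  refine (norm_invSqrtCoeff_antitone hj).trans ?_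
  have := norm_invSqrtCoeff_succ 0
  simp only [invSqrtCoeff_zero, norm_one, Nat.cast_zero, zero_add] at this
  simp only
  linarith

lemma norm_invSqrtCoeff_le_three_eighths {j : ℕ} (hj : 2 ≤ j) : ‖invSqrtCoeff j‖ ≤ 3 / 8 := by
  refine (norm_invSqrtCoeff_antitone hj).trans ?_
  have := norm_invSqrtCoeff_succ 1
  have h1 := norm_invSqrtCoeff_le_half le_rfl
  norm_num at this ⊢
  linarith

/-- The truncation of `(1 + u)^{-1/2}` at degree `p`. -/
noncomputable def invSqrtPoly (p : ℕ) : ℂ[X] :=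
  ∑ j ∈ Finset.range (p + 1), C (invSqrtCoeff j) * X ^ j

lemma invSqrtPoly_succ (p : ℕ) :
    invSqrtPoly (p + 1) = invSqrtPoly p + C (invSqrtCoeff (p + 1)) * X ^ (p + 1) := by
  rw [invSqrtPoly, Finset.sum_range_succ, ← invSqrtPoly]

/-- The series `y = (1 + u)^{-1/2}` satisfies `2 (1 + u) y' + y = 0`; its truncation does so up to
one monomial. -/
lemma invSqrtPoly_ode (p : ℕ) :
    2 * (1 + X) * derivative (invSqrtPoly p) + invSqrtPoly p
      = C ((2 * p + 1) * invSqrtCoeff p) * X ^ p := by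
  induction p with
  | zero => simp [invSqrtPoly]
  | succ p ih =>
    have h := congrArg (C : ℂ → ℂ[X]) (invSqrtCoeff_succ p)
    rw [invSqrtPoly_succ, derivative_add, derivative_C_mul_X_pow]
    simp only [map_mul, map_add, map_neg, map_one, Nat.cast_add, Nat.cast_one, map_natCast,
      map_ofNat, Nat.add_sub_cancel] at h ih ⊢
    linear_combination ih + X ^ p * h

lemma eq_of_derivative_eq {P Q : ℂ[X]} (h : derivative P = derivative Q)
    (h0 : P.eval 0 = Q.eval 0) : P = Q := by
  have hd : (P - Q).natDegree = 0 :=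
    derivative_eq_zero.1 (by rw [derivative_sub, h, sub_self])
  have hC := eq_C_of_natDegree_eq_zero hd
  have : (P - Q).eval 0 = 0 := by rw [eval_sub, h0, sub_self]
  rw [hC, eval_C] at this
  rw [this, C_0] at hC
  exact sub_eq_zero.1 hC

/-- The coefficient of `u^{p+j+1}` in `(1 + u) t_p(u)^2`, where `t_p` is the truncation of
`(1 + u)^{-1/2}`. -/
noncomputable def invSqrtErr (p j : ℕ) : ℂ :=
  (2 * p + 1) * invSqrtCoeff p * invSqrtCoeff j / (p + j + 1)

/-- By `invSqrtPoly_ode` the derivative of `(1 + u) t_p^2` is a monomial times `t_p`, so that all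
coefficients of `(1 + u) t_p^2 - 1` are explicit. -/
lemma one_add_X_mul_invSqrtPoly_sq (p : ℕ) :
    (1 + X) * invSqrtPoly p ^ 2
      = 1 + ∑ j ∈ Finset.range (p + 1), C (invSqrtErr p j) * X ^ (p + j + 1) := by
  apply eq_of_derivative_eq
  · have h1 : derivative ((1 + X) * invSqrtPoly p ^ 2)
        = invSqrtPoly p * (C ((2 * p + 1) * invSqrtCoeff p) * X ^ p) := by
      rw [← invSqrtPoly_ode, derivative_mul, sq, derivative_mul]
      simp only [derivative_add, derivative_one, derivative_X, zero_add]
      ring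
    rw [h1, derivative_add, derivative_one, zero_add, derivative_sum, invSqrtPoly,
      Finset.sum_mul]
    refine Finset.sum_congr rfl fun j _ => ?_
    rw [derivative_C_mul_X_pow, Nat.add_sub_cancel]
    have : invSqrtErr p j * ((p + j + 1 : ℕ) : ℂ)
        = (2 * p + 1) * invSqrtCoeff p * invSqrtCoeff j := by
      rw [invSqrtErr]; push_cast
      have : (p : ℂ) + j + 1 ≠ 0 := by exact_mod_cast (p + j).succ_ne_zero
      field_simp
    rw [this, C_mul (a := (2 * (p : ℂ) + 1) * invSqrtCoeff p), pow_add]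
    ring
  · have : (invSqrtPoly p).eval 0 = 1 := by
      rw [invSqrtPoly, eval_finsetSum, Finset.sum_eq_single 0]
      · simp [invSqrtCoeff_zero]
      · intro j _ hj; simp [hj]
      · simp
    simp [this, eval_finsetSum]

lemma norm_invSqrtErr_le {p j : ℕ} (hp : 1 ≤ p) : ‖invSqrtErr p j‖ ≤ 1 := by
  have h1 : ‖(2 * (p : ℂ) + 1)‖ = 2 * p + 1 := by
    have : (2 * (p : ℂ) + 1) = ((2 * p + 1 : ℕ) : ℂ) := by push_cast; ring
    rw [this, Complex.norm_natCast]; push_cast; ring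
  have h2 : ‖((p : ℂ) + j + 1)‖ = p + j + 1 := by
    have : ((p : ℂ) + j + 1) = ((p + j + 1 : ℕ) : ℂ) := by push_cast; ring
    rw [this, Complex.norm_natCast]; push_cast; ring
  rw [invSqrtErr, norm_div, norm_mul, norm_mul, h1, h2, div_le_one (by positivity)]
  have hp' := norm_invSqrtCoeff_le_half hp
  have hj' := norm_invSqrtCoeff_le_one j
  have hj0 : (0 : ℝ) ≤ j := j.cast_nonneg
  have := mul_le_mul hp' hj' (norm_nonneg _) (by norm_num)
  nlinarith [norm_nonneg (invSqrtCoeff p)]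

variable {k : ℕ}

lemma aeval_invSqrtPoly (p : ℕ) (A : Matrix (Fin k) (Fin k) ℂ) :
    aeval A (invSqrtPoly p) = 1 + sPoly p A := by
  rw [invSqrtPoly, map_sum, sPoly, Finset.range_eq_Ico, Finset.sum_eq_sum_Ico_succ_bot (by omega)]
  congr 1
  · simp [invSqrtCoeff_zero]
  · refine Finset.sum_congr ?_ fun j _ => ?_
    · ext j; simp
    · rw [map_mul, aeval_C, map_pow, aeval_X, ← Algebra.smul_def, invSqrtCoeff]

/-- `t_p(A)^2 (1 + A) - 1` written out. -/
lemma one_add_mul_sPoly_sq (p : ℕ) (A : Matrix (Fin k) (Fin k) ℂ) :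
    (1 + sPoly p A) * (1 + A) * (1 + sPoly p A)
      = 1 + ∑ j ∈ Finset.range (p + 1), invSqrtErr p j • A ^ (p + j + 1) := by
  have h := congrArg (aeval A) (one_add_X_mul_invSqrtPoly_sq p)
  have hc : invSqrtPoly p * (1 + X) * invSqrtPoly p = (1 + X) * invSqrtPoly p ^ 2 := by ring
  rw [← hc] at h
  simp only [map_mul, map_add, map_one, aeval_X, aeval_invSqrtPoly, map_sum] at h
  rw [h]
  congr 1
  refine Finset.sum_congr rfl fun j _ => ?_
  rw [aeval_C, map_pow, aeval_X, ← Algebra.smul_def]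

lemma geom_sum_pow_le {e : ℝ} (h0 : 0 ≤ e) (h1 : e < 1) (n m : ℕ) :
    ∑ j ∈ Finset.range n, e ^ (m + j) ≤ e ^ m / (1 - e) := by
  simp only [pow_add, ← Finset.mul_sum]
  rw [div_eq_mul_inv]
  refine mul_le_mul_of_nonneg_left ?_ (by positivity)
  have hs := summable_geometric_of_lt_one h0 h1
  rw [← tsum_geometric_of_lt_one h0 h1]
  exact hs.sum_le_tsum _ fun j _ => by positivity

lemma matNorm_sPoly_le (p : ℕ) {A : Matrix (Fin k) (Fin k) ℂ} {e : ℝ} (hA : matNorm A ≤ e)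
    (h1 : e < 1) : matNorm (sPoly p A) ≤ 1 / 2 * (e / (1 - e)) := by
  have h0 := (matNorm_nonneg A).trans hA
  have hI : Finset.Icc 1 p = (Finset.range p).image (1 + ·) := by
    ext j; simp only [Finset.mem_Icc, Finset.mem_image, Finset.mem_range]
    constructor
    · rintro ⟨h, h'⟩; exact ⟨j - 1, by omega, by omega⟩
    · rintro ⟨i, h, rfl⟩; omega
  have : matNorm (sPoly p A) ≤ ∑ j ∈ Finset.Icc 1 p, 1 / 2 * e ^ j := by
    refine matNorm_sum_le _ fun j hj => matNorm_smul_le ?_ (matNorm_pow_le hA j)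
    exact norm_invSqrtCoeff_le_half (Finset.mem_Icc.1 hj).1
  refine this.trans ?_
  rw [← Finset.mul_sum, hI, Finset.sum_image (by intro a _ b _ h; simpa using h)]
  have := geom_sum_pow_le h0 h1 p 1
  rw [pow_one] at this
  linarith

/-- Multiplying `U` by `1 + s_p(E)` makes the defect `E` of `U` of order `p + 1`. -/
lemma matNorm_invSqrt_error_le {p : ℕ} (hp : 1 ≤ p) {A : Matrix (Fin k) (Fin k) ℂ} {e : ℝ}
    (hA : matNorm A ≤ e) (h1 : e < 1) :
    matNorm ((1 + sPoly p A) * (1 + A) * (1 + sPoly p A) - 1) ≤ e ^ (p + 1) / (1 - e) := by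
  have h0 := (matNorm_nonneg A).trans hA
  rw [one_add_mul_sPoly_sq, add_sub_cancel_left]
  refine (matNorm_sum_le _ (b := fun j => 1 * e ^ (p + j + 1)) fun j _ =>
    matNorm_smul_le (norm_invSqrtErr_le hp) (matNorm_pow_le hA _)).trans ?_
  have := geom_sum_pow_le h0 h1 (p + 1) (p + 1)
  refine le_trans (le_of_eq ?_) this
  refine Finset.sum_congr rfl fun j _ => ?_
  rw [one_mul]; congr 1; ring

lemma sPoly_conjTranspose (p : ℕ) {A : Matrix (Fin k) (Fin k) ℂ} (hA : Aᴴ = A) :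
    (sPoly p A)ᴴ = sPoly p A := by
  rw [sPoly, Matrix.conjTranspose_sum]
  refine Finset.sum_congr rfl fun j _ => ?_
  rw [Matrix.conjTranspose_smul, Matrix.conjTranspose_pow, hA]
  simp

/-- The coefficient of `u^{2j}`, for `j ≥ 1`, in `(1 + u^2)^{1/2}`. -/
noncomputable def sqrtCoeff (j : ℕ) : ℂ :=
  (-1 : ℂ) ^ (j + 1) * (Nat.centralBinom j : ℂ) / (4 ^ j * (2 * (j : ℂ) - 1))

lemma two_mul_sub_one_ne_zero {j : ℕ} : 2 * (j : ℂ) - 1 ≠ 0 := by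
  intro h
  have : (2 * (j : ℤ) - 1 : ℤ) = 0 := by exact_mod_cast h
  omega

/-- `(1 + v)^{1/2} = (1 + v) (1 + v)^{-1/2}` on the level of coefficients. -/
lemma sqrtCoeff_succ (j : ℕ) : sqrtCoeff (j + 1) = invSqrtCoeff (j + 1) + invSqrtCoeff j := by
  have h := invSqrtCoeff_succ j
  have h1 : sqrtCoeff (j + 1) * (2 * ((j + 1 : ℕ) : ℂ) - 1) = - invSqrtCoeff (j + 1) := by
    rw [sqrtCoeff, invSqrtCoeff, pow_succ (-1 : ℂ) (j + 1)]
    have := two_mul_sub_one_ne_zero (j := j + 1)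
    have h4 : (4 : ℂ) ^ (j + 1) ≠ 0 := pow_ne_zero _ (by norm_num)
    field_simp
  have h2 := two_mul_sub_one_ne_zero (j := j + 1)
  push_cast at h1 h2
  apply mul_right_cancel₀ h2
  rw [h1]
  linear_combination -h

lemma norm_sqrtCoeff (j : ℕ) (hj : 1 ≤ j) :
    ‖sqrtCoeff j‖ * (2 * j - 1) = ‖invSqrtCoeff j‖ := by
  have h1 : ‖(2 * (j : ℂ) - 1)‖ = 2 * j - 1 := by
    have : (2 * (j : ℂ) - 1) = ((2 * j - 1 : ℕ) : ℂ) := by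
      rw [Nat.cast_sub (by omega)]; push_cast; ring
    rw [this, Complex.norm_natCast, Nat.cast_sub (by omega)]; push_cast; ring
  have h2 : sqrtCoeff j * (2 * (j : ℂ) - 1) = - invSqrtCoeff j := by
    rw [sqrtCoeff, invSqrtCoeff, pow_succ (-1 : ℂ)]
    have := two_mul_sub_one_ne_zero (j := j)
    have h4 : (4 : ℂ) ^ j ≠ 0 := pow_ne_zero _ (by norm_num)
    field_simp
  rw [← h1, ← norm_mul, h2, norm_neg]

lemma norm_sqrtCoeff_mul_le {j : ℕ} (hj : 2 ≤ j) : ‖sqrtCoeff j‖ * (2 * j) ≤ 1 / 2 := by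
  have h1 := norm_sqrtCoeff j (by omega)
  have h2 := norm_invSqrtCoeff_le_three_eighths hj
  have h3 : (2 : ℝ) ≤ j := by exact_mod_cast hj
  nlinarith [norm_nonneg (sqrtCoeff j)]

/-- The part of degree at least `4` of `c_p(u) = u + u^2 / 2 + ⋯`. -/
noncomputable def cTail (p : ℕ) (A : Matrix (Fin k) (Fin k) ℂ) : Matrix (Fin k) (Fin k) ℂ :=
  ∑ j ∈ Finset.Icc 2 (p / 2), sqrtCoeff j • A ^ (2 * j)

lemma cPoly_eq {p : ℕ} (hp : 2 ≤ p) (A : Matrix (Fin k) (Fin k) ℂ) :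
    cPoly p A = A + (1 / 2 : ℂ) • A ^ 2 + cTail p A := by
  rw [cPoly, cTail, add_assoc]
  congr 1
  have h1 : 1 ≤ p / 2 := by omega
  rw [← Finset.add_sum_Ioc_eq_sum_Icc h1]
  congr 1
  norm_num [Nat.centralBinom, Nat.choose]

lemma cPoly_one (A : Matrix (Fin k) (Fin k) ℂ) : cPoly 1 A = A := by
  simp [cPoly]

lemma cPoly_zero (p : ℕ) : cPoly p (0 : Matrix (Fin k) (Fin k) ℂ) = 0 := by
  rw [cPoly, zero_add]
  refine Finset.sum_eq_zero fun j hj => ?_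
  have := (Finset.mem_Icc.1 hj).1
  rw [zero_pow (by omega), smul_zero]

lemma star_sqrtCoeff (j : ℕ) : star (sqrtCoeff j) = sqrtCoeff j := by
  simp [sqrtCoeff]

/-- For a skew Hermitian matrix the adjoint changes only the sign of the linear term of `c_p`. -/
lemma cPoly_conjTranspose (p : ℕ) {A : Matrix (Fin k) (Fin k) ℂ} (hA : Aᴴ = -A) :
    (cPoly p A)ᴴ = cPoly p A - (2 : ℂ) • A := by
  have : (∑ j ∈ Finset.Icc 1 (p / 2), sqrtCoeff j • A ^ (2 * j))ᴴ
      = ∑ j ∈ Finset.Icc 1 (p / 2), sqrtCoeff j • A ^ (2 * j) := by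
    rw [Matrix.conjTranspose_sum]
    refine Finset.sum_congr rfl fun j _ => ?_
    rw [Matrix.conjTranspose_smul, Matrix.conjTranspose_pow, hA, star_sqrtCoeff,
      (even_two_mul j).neg_pow]
  simp only [sqrtCoeff] at this
  rw [cPoly, Matrix.conjTranspose_add, this, hA]
  module

lemma matNorm_cTail_sub_le (p : ℕ) {A B : Matrix (Fin k) (Fin k) ℂ} {ρ z : ℝ} (h1 : ρ < 1)
    (hA : matNorm A ≤ ρ) (hB : matNorm B ≤ ρ) (hz : matNorm (A - B) ≤ z) :
    matNorm (cTail p A - cTail p B) ≤ 1 / 2 * (ρ ^ 3 / (1 - ρ)) * z := by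
  have h0 := (matNorm_nonneg A).trans hA
  have hz0 := (matNorm_nonneg _).trans hz
  rw [cTail, cTail, ← Finset.sum_sub_distrib]
  have h2 : matNorm (∑ j ∈ Finset.Icc 2 (p / 2), (sqrtCoeff j • A ^ (2 * j)
      - sqrtCoeff j • B ^ (2 * j))) ≤ ∑ j ∈ Finset.Icc 2 (p / 2), 1 / 2 * ρ ^ (2 * j - 1) * z := by
    refine matNorm_sum_le _ fun j hj => ?_
    rw [← smul_sub]
    refine (matNorm_smul_le le_rfl (matNorm_pow_sub_pow_le hA hB hz _)).trans ?_
    have := norm_sqrtCoeff_mul_le (Finset.mem_Icc.1 hj).1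
    push_cast
    calc ‖sqrtCoeff j‖ * (2 * j * ρ ^ (2 * j - 1) * z)
        = (‖sqrtCoeff j‖ * (2 * j)) * (ρ ^ (2 * j - 1) * z) := by ring
      _ ≤ 1 / 2 * (ρ ^ (2 * j - 1) * z) := by gcongr
      _ = _ := by ring
  refine h2.trans ?_
  rw [← Finset.sum_mul, ← Finset.mul_sum]
  refine mul_le_mul_of_nonneg_right (mul_le_mul_of_nonneg_left ?_ (by norm_num)) hz0
  refine le_trans ?_ (geom_sum_pow_le h0 h1 p 3)
  have hinj : Set.InjOn (fun j => 2 * j - 4) (Finset.Icc 2 (p / 2) : Set ℕ) := by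
    intro a ha b hb h
    simp only [Finset.coe_Icc, Set.mem_Icc] at ha hb h
    omega
  calc ∑ j ∈ Finset.Icc 2 (p / 2), ρ ^ (2 * j - 1)
      = ∑ j ∈ Finset.Icc 2 (p / 2), ρ ^ (3 + (2 * j - 4)) := by
        refine Finset.sum_congr rfl fun j hj => ?_
        have := (Finset.mem_Icc.1 hj).1
        congr 1; omega
    _ = ∑ i ∈ (Finset.Icc 2 (p / 2)).image (fun j => 2 * j - 4), ρ ^ (3 + i) := by
        rw [Finset.sum_image hinj]
    _ ≤ _ := by
        refine Finset.sum_le_sum_of_subset_of_nonneg ?_ fun i _ _ => by positivity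
        intro i hi
        obtain ⟨j, hj, rfl⟩ := Finset.mem_image.1 hi
        have := Finset.mem_Icc.1 hj
        simp only [Finset.mem_range]; omega

lemma cTail_zero (p : ℕ) : cTail p (0 : Matrix (Fin k) (Fin k) ℂ) = 0 := by
  refine Finset.sum_eq_zero fun j hj => ?_
  have := (Finset.mem_Icc.1 hj).1
  rw [zero_pow (by omega), smul_zero]

lemma matNorm_cTail_le (p : ℕ) {A : Matrix (Fin k) (Fin k) ℂ} {ρ : ℝ} (h1 : ρ < 1)
    (hA : matNorm A ≤ ρ) : matNorm (cTail p A) ≤ 1 / 2 * (ρ ^ 3 / (1 - ρ)) * ρ := by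
  have h0 := (matNorm_nonneg A).trans hA
  have := matNorm_cTail_sub_le p h1 hA (B := 0) (z := ρ) (by rw [matNorm_zero]; exact h0)
    (by rw [sub_zero]; exact hA)
  rwa [cTail_zero, sub_zero] at this

lemma matNorm_cPoly_le {p : ℕ} (hp : 1 ≤ p) {A : Matrix (Fin k) (Fin k) ℂ} {x : ℝ}
    (h1 : x ≤ 1 / 2) (hA : matNorm A ≤ x) : matNorm (cPoly p A) ≤ x + x ^ 2 := by
  have h0 := (matNorm_nonneg A).trans hA
  rcases hp.eq_or_lt with rfl | hp
  · rw [cPoly_one]; nlinarith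
  · rw [cPoly_eq hp]
    refine (matNorm_add_le (matNorm_add_le hA (matNorm_smul_le le_rfl (matNorm_pow_le hA 2)))
      (matNorm_cTail_le p (by linarith) hA)).trans ?_
    have h2 : x ^ 3 / (1 - x) ≤ x := by
      rw [div_le_iff₀ (by linarith)]; nlinarith [mul_nonneg h0 h0]
    norm_num
    nlinarith

/-- The truncation of `(1 + v)^{1/2}` at degree `P`, in terms of that of `(1 + v)^{-1/2}`. -/
lemma one_add_sum_sqrtCoeff (P : ℕ) (V : Matrix (Fin k) (Fin k) ℂ) :
    1 + ∑ j ∈ Finset.Icc 1 P, sqrtCoeff j • V ^ j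
      = (1 + V) * (1 + sPoly P V) - invSqrtCoeff P • V ^ (P + 1) := by
  induction P with
  | zero => simp [sPoly, invSqrtCoeff_zero]
  | succ P ih =>
    have hs : sPoly (P + 1) V = sPoly P V + invSqrtCoeff (P + 1) • V ^ (P + 1) := by
      rw [sPoly, Finset.sum_Icc_succ_top (by omega)]; rfl
    rw [Finset.sum_Icc_succ_top (by omega), ← add_assoc, ih, hs, sqrtCoeff_succ,
      pow_succ' V (P + 1)]
    simp only [add_mul, mul_add, one_mul, mul_one, mul_smul_comm]
    module

/-- `(1 + c_p(A)^*) (1 + c_p(A)) - 1` for skew Hermitian `A`, as a function of `v = A^2`. -/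
lemma cPoly_unitary_error (p : ℕ) {A : Matrix (Fin k) (Fin k) ℂ} (hA : Aᴴ = -A) :
    (1 + (cPoly p A)ᴴ) * (1 + cPoly p A) - 1
      = (1 + ∑ j ∈ Finset.Icc 1 (p / 2), sqrtCoeff j • (A ^ 2) ^ j) ^ 2 - (1 + A ^ 2) := by
  have hc : cPoly p A = A + ∑ j ∈ Finset.Icc 1 (p / 2), sqrtCoeff j • (A ^ 2) ^ j := by
    simp only [← pow_mul]; rfl
  rw [cPoly_conjTranspose p hA, hc]
  set F := ∑ j ∈ Finset.Icc 1 (p / 2), sqrtCoeff j • (A ^ 2) ^ j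
  have hcomm : A * F = F * A := by
    have : Commute A F := Commute.sum_right _ _ _ fun j _ =>
      (((Commute.refl A).pow_right 2).pow_right j).smul_right _
    exact this
  have : (1 + (A + F - (2 : ℂ) • A)) = 1 + F - A := by module
  rw [this]
  have h2 : (1 + F - A) * (1 + (A + F)) - 1 - ((1 + F) ^ 2 - (1 + A ^ 2)) = F * A - A * F := by
    noncomm_ring
  rw [hcomm, sub_self] at h2
  exact sub_eq_zero.1 h2

lemma matNorm_cPoly_unitary_error_le {p : ℕ} (hp : 2 ≤ p) {A : Matrix (Fin k) (Fin k) ℂ}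
    (hA : Aᴴ = -A) {x : ℝ} (hx : x ≤ 3 / 10) (hAx : matNorm A ≤ x) :
    matNorm ((1 + (cPoly p A)ᴴ) * (1 + cPoly p A) - 1) ≤ 3 * (x ^ 2) ^ (p / 2 + 1) := by
  have h0 := (matNorm_nonneg A).trans hAx
  have hP : 1 ≤ p / 2 := by omega
  set P := p / 2
  set V := A ^ 2 with hV
  set ν := x ^ 2 with hν
  have hVν : matNorm V ≤ ν := matNorm_pow_le hAx 2
  have hν0 : 0 ≤ ν := by positivity
  have hν1 : ν ≤ 9 / 100 := by nlinarith
  rw [cPoly_unitary_error p hA, one_add_sum_sqrtCoeff]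
  set s := 1 + sPoly P V with hs
  set α := invSqrtCoeff P
  have hcV : Commute V s :=
    (Commute.one_right V).add_right (Commute.sum_right _ _ _ fun j _ =>
      ((Commute.refl V).pow_right j).smul_right _)
  have hc1 : Commute (1 + V) s := (Commute.one_left s).add_left hcV
  have hcP : Commute (V ^ (P + 1)) ((1 + V) * s) :=
    (((Commute.one_right V).add_right (Commute.refl V)).mul_right hcV).pow_left _
  have key : ((1 + V) * s - α • V ^ (P + 1)) ^ 2 - (1 + V)
      = (1 + V) * (s * (1 + V) * s - 1) - (2 * α) • (V ^ (P + 1) * ((1 + V) * s))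
        + (α * α) • (V ^ (P + 1) * V ^ (P + 1)) := by
    rw [sq, sub_mul, mul_sub, mul_sub, smul_mul_smul_comm, mul_smul_comm, smul_mul_assoc,
      hcP.eq]
    have : (1 + V) * s * ((1 + V) * s) = (1 + V) * (s * (1 + V) * s) := by
      simp only [mul_assoc]
    rw [this, mul_sub (1 + V), mul_one]
    module
  rw [key]
  have hα : ‖α‖ ≤ 1 / 2 := norm_invSqrtCoeff_le_half hP
  have hsn : matNorm s ≤ 1 + 1 / 2 * (ν / (1 - ν)) :=
    matNorm_add_le matNorm_one_le (matNorm_sPoly_le P hVν (by linarith))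
  have h1V : matNorm (1 + V) ≤ 1 + ν := matNorm_add_le matNorm_one_le hVν
  have h2α : ‖2 * α‖ ≤ 1 := by rw [norm_mul]; norm_num; linarith
  have hαα : ‖α * α‖ ≤ 1 / 4 := by
    rw [norm_mul]; nlinarith [norm_nonneg α]
  have hVP := matNorm_pow_le hVν (P + 1)
  refine (matNorm_add_le (matNorm_sub_le
    (matNorm_mul_le h1V (matNorm_invSqrt_error_le hP hVν (by linarith)))
    (matNorm_smul_le h2α (matNorm_mul_le hVP (matNorm_mul_le h1V hsn))))
    (matNorm_smul_le hαα (matNorm_mul_le hVP hVP))).trans ?_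
  have hd : ν / (1 - ν) ≤ 1 / 10 := by rw [div_le_iff₀ (by linarith)]; linarith
  have hq0 : 0 ≤ ν ^ (P + 1) := by positivity
  have hq1 : ν ^ (P + 1) ≤ 1 := pow_le_one₀ hν0 (by linarith)
  have hn0 : 0 ≤ ν / (1 - ν) := div_nonneg hν0 (by linarith)
  have hi0 : 0 ≤ ν ^ (P + 1) / (1 - ν) := div_nonneg hq0 (by linarith)
  have hi : ν ^ (P + 1) / (1 - ν) ≤ 11 / 10 * ν ^ (P + 1) := by
    rw [div_le_iff₀ (by linarith)]; nlinarith
  set Q := ν ^ (P + 1)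
  have h3 : (1 + ν) * (Q / (1 - ν)) ≤ 12 / 10 * Q := by
    calc (1 + ν) * (Q / (1 - ν)) ≤ (1 + 9 / 100) * (11 / 10 * Q) := by gcongr
      _ ≤ _ := by linarith
  have h4 : (1 + ν) * (1 + 1 / 2 * (ν / (1 - ν))) ≤ (1 + 9 / 100) * (1 + 1 / 2 * (1 / 10)) := by
    gcongr
  nlinarith

end Series

/-! ### The condition number `κ(Σ)` and its behaviour under perturbation -/

section Kappa

variable {q : ℕ}

lemma one_le_kappa (σ : Fin q → ℝ) : 1 ≤ kappa σ := le_max_left _ _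

lemma one_le_bigK (σ : Fin q → ℝ) : 1 ≤ bigK σ := le_max_left _ _

lemma abs_le_bigK (σ : Fin q → ℝ) (i : Fin q) : |σ i| ≤ bigK σ :=
  (le_ciSup (f := fun i => |σ i|) (Set.finite_range _).bddAbove i).trans (le_max_right _ _)

lemma inv_abs_le_kappa (σ : Fin q → ℝ) (i : Fin q) : 1 / |σ i| ≤ kappa σ :=
  (le_ciSup (f := fun i => 1 / |σ i|) (Set.finite_range _).bddAbove i).trans
    ((le_max_left _ _).trans (le_max_right _ _))

lemma pair_le_kappa (σ : Fin q → ℝ) {i j : Fin q} (h : i ≠ j) :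
    1 / |σ i - σ j| + 1 / |σ i + σ j| ≤ kappa σ :=
  (le_ciSup (f := fun x : {x : Fin q × Fin q // x.1 ≠ x.2} =>
      (1 / |σ x.1.1 - σ x.1.2| + 1 / |σ x.1.1 + σ x.1.2|))
    (Set.finite_range _).bddAbove ⟨(i, j), h⟩).trans
    ((le_max_right _ _).trans (le_max_right _ _))

lemma inv_abs_sub_le_kappa (σ : Fin q → ℝ) {i j : Fin q} (h : i ≠ j) :
    1 / |σ i - σ j| ≤ kappa σ :=
  (le_add_of_nonneg_right (by positivity)).trans (pair_le_kappa σ h)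

lemma inv_abs_add_le_kappa (σ : Fin q → ℝ) {i j : Fin q} (h : i ≠ j) :
    1 / |σ i + σ j| ≤ kappa σ :=
  (le_add_of_nonneg_left (by positivity)).trans (pair_le_kappa σ h)

lemma kappa_le {σ : Fin q → ℝ} {b : ℝ} (hb : 1 ≤ b) (h₁ : ∀ i, 1 / |σ i| ≤ b)
    (h₂ : ∀ i j, i ≠ j → 1 / |σ i - σ j| + 1 / |σ i + σ j| ≤ b) : kappa σ ≤ b :=
  max_le hb (max_le (Real.iSup_le h₁ (by linarith))
    (Real.iSup_le (fun x => h₂ _ _ x.2) (by linarith)))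

lemma bigK_le {σ : Fin q → ℝ} {b : ℝ} (hb : 1 ≤ b) (h : ∀ i, |σ i| ≤ b) : bigK σ ≤ b :=
  max_le hb (Real.iSup_le h (by linarith))

lemma two_le_kappa_mul_bigK {σ : Fin q → ℝ} (hσ : IsRegular σ) (hq : 2 ≤ q) :
    2 ≤ kappa σ * bigK σ := by
  have hne : (⟨0, by omega⟩ : Fin q) ≠ ⟨1, by omega⟩ := by simp
  set i : Fin q := ⟨0, by omega⟩
  set j : Fin q := ⟨1, by omega⟩
  obtain ⟨h1, h2⟩ := hσ.2 i j hne
  have hK := one_le_bigK σ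
  have ha : |σ i - σ j| ≤ 2 * bigK σ :=
    (abs_sub _ _).trans (by linarith [abs_le_bigK σ i, abs_le_bigK σ j])
  have hb : |σ i + σ j| ≤ 2 * bigK σ :=
    (abs_add_le _ _).trans (by linarith [abs_le_bigK σ i, abs_le_bigK σ j])
  have hp := pair_le_kappa σ hne
  have hsum : |σ i - σ j| + |σ i + σ j| ≤ 2 * bigK σ := by
    have hi := abs_le.1 (abs_le_bigK σ i)
    have hj := abs_le.1 (abs_le_bigK σ j)
    rcases abs_cases (σ i - σ j) with h | h <;> rcases abs_cases (σ i + σ j) with h' | h' <;>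
      linarith
  have hx : 0 < |σ i - σ j| := abs_pos.2 h1
  have hy : 0 < |σ i + σ j| := abs_pos.2 h2
  set x := |σ i - σ j|
  set y := |σ i + σ j|
  have h4 : 4 ≤ (1 / x + 1 / y) * (x + y) := by
    rw [div_add_div _ _ hx.ne' hy.ne', div_mul_eq_mul_div, le_div_iff₀ (by positivity)]
    nlinarith [sq_nonneg (x - y)]
  have h5 : (1 / x + 1 / y) * (x + y) ≤ kappa σ * (2 * bigK σ) :=
    mul_le_mul hp hsum (by positivity) (by linarith [one_le_kappa σ])
  linarith

lemma one_le_kappa_mul_abs {x κ : ℝ} (hx : x ≠ 0) (h : 1 / |x| ≤ κ) : 1 ≤ κ * |x| := by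
  rwa [div_le_iff₀ (abs_pos.2 hx)] at h

lemma inv_abs_perturb {x x' D κ m : ℝ} (hx : x ≠ 0) (hκ : 1 / |x| ≤ κ) (hD : |x' - x| ≤ D)
    (hm : κ * D ≤ m) (hm1 : m < 1) : x' ≠ 0 ∧ 1 / |x'| ≤ 1 / |x| / (1 - m) := by
  have h1 := one_le_kappa_mul_abs hx hκ
  have hx0 := abs_pos.2 hx
  have hD0 : 0 ≤ D := (abs_nonneg _).trans hD
  have h2 : |x| * (1 - m) ≤ |x'| := by
    have h3 : |x| - |x'| ≤ D := by
      rw [abs_sub_comm] at hD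
      exact (abs_sub_abs_le_abs_sub x x').trans hD
    nlinarith [mul_le_mul_of_nonneg_left h1 hD0, mul_le_mul_of_nonneg_left hm hx0.le]
  have h4 : 0 < |x| * (1 - m) := mul_pos hx0 (by linarith)
  refine ⟨abs_pos.1 (h4.trans_le h2), ?_⟩
  rw [div_div]
  exact one_div_le_one_div_of_le h4 h2

/-- A change of the `σ_i` by at most `S`, where `κ S ≤ m`, makes `κ` grow at most by the factor
`1 / (1 - c m)`. The constant `c = 2` comes from the differences `σ_i ± σ_j`; it can be replaced
by `1` when `q = 1`. -/
lemma kappa_perturb {σ σ' : Fin q → ℝ} (hσ : IsRegular σ) {c m S : ℝ} (hc1 : 1 ≤ c)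
    (hc : q = 1 ∨ 2 ≤ c) (hS : ∀ i, |σ' i - σ i| ≤ S) (hm0 : 0 ≤ m) (hm : kappa σ * S ≤ m)
    (hcm : c * m < 1) :
    IsRegular σ' ∧ kappa σ' ≤ kappa σ / (1 - c * m) ∧ bigK σ' ≤ bigK σ * (1 + m) := by
  have hκ1 := one_le_kappa σ
  have hK1 := one_le_bigK σ
  have hκm : kappa σ ≤ kappa σ / (1 - c * m) := by
    rw [le_div_iff₀ (by linarith)]; nlinarith [mul_nonneg (by linarith : 0 ≤ c) hm0]
  have hsingle : ∀ i, σ' i ≠ 0 ∧ 1 / |σ' i| ≤ kappa σ / (1 - c * m) := by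
    intro i
    have hm' : m ≤ c * m := by nlinarith
    obtain ⟨h1, h2⟩ := inv_abs_perturb (hσ.1 i) (inv_abs_le_kappa σ i) (hS i) (hm.trans hm') hcm
    refine ⟨h1, h2.trans ?_⟩
    exact div_le_div_of_nonneg_right (inv_abs_le_kappa σ i) (by linarith)
  have hpair : ∀ i j, i ≠ j → (σ' i - σ' j ≠ 0 ∧ σ' i + σ' j ≠ 0) ∧
      1 / |σ' i - σ' j| + 1 / |σ' i + σ' j| ≤ kappa σ / (1 - c * m) := by
    intro i j hij
    have hc2 : 2 ≤ c := by
      rcases hc with rfl | h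
      · exact absurd (Subsingleton.elim i j) hij
      · exact h
    have hm2 : kappa σ * (2 * S) ≤ c * m := by nlinarith
    obtain ⟨h1, h2⟩ := hσ.2 i j hij
    have d1 : |σ' i - σ' j - (σ i - σ j)| ≤ 2 * S := by
      have := abs_sub (σ' i - σ i) (σ' j - σ j)
      rw [show σ' i - σ' j - (σ i - σ j) = (σ' i - σ i) - (σ' j - σ j) by ring]
      linarith [hS i, hS j]
    have d2 : |σ' i + σ' j - (σ i + σ j)| ≤ 2 * S := by
      have := abs_add_le (σ' i - σ i) (σ' j - σ j)
      rw [show σ' i + σ' j - (σ i + σ j) = (σ' i - σ i) + (σ' j - σ j) by ring]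
      linarith [hS i, hS j]
    obtain ⟨a1, a2⟩ := inv_abs_perturb h1 (inv_abs_sub_le_kappa σ hij) d1 hm2 hcm
    obtain ⟨b1, b2⟩ := inv_abs_perturb h2 (inv_abs_add_le_kappa σ hij) d2 hm2 hcm
    refine ⟨⟨a1, b1⟩, (add_le_add a2 b2).trans ?_⟩
    rw [← add_div]
    exact div_le_div_of_nonneg_right (pair_le_kappa σ hij) (by linarith)
  refine ⟨⟨fun i => (hsingle i).1, fun i j h => (hpair i j h).1⟩,
    kappa_le (hκ1.trans hκm) (fun i => (hsingle i).2) fun i j h => (hpair i j h).2,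
    bigK_le (by nlinarith) fun i => ?_⟩
  have h1 : |σ' i| ≤ |σ i| + S := by
    have := abs_add_le (σ i) (σ' i - σ i)
    rw [add_sub_cancel] at this
    linarith [hS i]
  have hS0 : 0 ≤ S := (abs_nonneg _).trans (hS i)
  nlinarith [abs_le_bigK σ i]

end Kappa

/-! ### The linear equation `D - S - X Σ + Σ Y = 0` -/

section Sylvester

variable {ℓ q : ℕ}

lemma matNorm_mono {r c : ℕ} {A B : Matrix (Fin r) (Fin c) ℂ} (h : ∀ i j, ‖A i j‖ ≤ ‖B i j‖) :
    matNorm A ≤ matNorm B :=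
  matNorm_le (matNorm_nonneg B)
    (fun i => (Finset.sum_le_sum fun j _ => h i j).trans (row_sum_le_matNorm B i))
    (fun j => (Finset.sum_le_sum fun i _ => h i j).trans (col_sum_le_matNorm B j))

lemma sum_dite_lt (h : q ≤ ℓ) (f : Fin q → ℝ) :
    ∑ j : Fin ℓ, (if hj : (j : ℕ) < q then f ⟨j, hj⟩ else 0) = ∑ j, f j := by
  have : ∀ j : Fin ℓ, (if hj : (j : ℕ) < q then f ⟨j, hj⟩ else 0)
      = ∑ k : Fin q, if Fin.castLE h k = j then f k else 0 := by
    intro j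
    split_ifs with hj
    · rw [Finset.sum_eq_single ⟨j, hj⟩]
      · simp
      · intro k _ hk
        rw [if_neg]; rintro rfl; exact hk (Fin.ext rfl)
      · simp
    · rw [Finset.sum_eq_zero]
      intro k _
      rw [if_neg]; rintro rfl; exact hj k.2
  simp only [this]
  rw [Finset.sum_comm]
  simp

lemma mul_rectDiag_apply (h : q ≤ ℓ) (X : Matrix (Fin ℓ) (Fin ℓ) ℂ) (σ : Fin q → ℝ) (i : Fin ℓ)
    (j : Fin q) : (X * rectDiag ℓ σ) i j = X i (Fin.castLE h j) * σ j := by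
  rw [Matrix.mul_apply, Finset.sum_eq_single (Fin.castLE h j)]
  · simp [rectDiag]
  · intro k _ hk
    have : (k : ℕ) ≠ j := fun e => hk (Fin.ext e)
    simp [rectDiag, this]
  · simp

lemma rectDiag_mul_apply (σ : Fin q → ℝ) (Y : Matrix (Fin q) (Fin q) ℂ) (i : Fin ℓ)
    (j : Fin q) :
    (rectDiag ℓ σ * Y) i j = if hi : (i : ℕ) < q then (σ ⟨i, hi⟩ : ℂ) * Y ⟨i, hi⟩ j else 0 := by
  rw [Matrix.mul_apply]
  split_ifs with hi
  · rw [Finset.sum_eq_single ⟨i, hi⟩]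
    · simp [rectDiag]
    · intro k _ hk
      have : (i : ℕ) ≠ k := fun e => hk (Fin.ext e.symm)
      simp [rectDiag, this]
    · simp
  · refine Finset.sum_eq_zero fun k _ => ?_
    have : (i : ℕ) ≠ k := fun e => hi (e ▸ k.2)
    simp [rectDiag, this]

lemma solX_conjTranspose (σ : Fin q → ℝ) (D : Matrix (Fin ℓ) (Fin q) ℂ) :
    (solX σ D)ᴴ = -solX σ D := by
  ext i j
  simp only [Matrix.conjTranspose_apply, Matrix.neg_apply, solX, Matrix.of_apply]
  by_cases hi : (i : ℕ) < q <;> by_cases hj : (j : ℕ) < q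
  · by_cases hij : i = j
    · subst hij
      simp [hi]
    · simp only [hi, hj, hij, Ne.symm hij, dite_true, if_false, star_mul', star_add, star_sub,
        star_div₀, Complex.star_def, Complex.conj_ofReal, Complex.conj_conj, map_one, map_ofNat]
      rw [← neg_sub (σ ⟨j, hj⟩ : ℂ) (σ ⟨i, hi⟩ : ℂ), add_comm (σ ⟨i, hi⟩ : ℂ)]
      rw [div_neg]
      ring
  · simp [hi, hj]
  · simp [hi, hj]
  · simp [hi, hj]

lemma solY_conjTranspose (h : q ≤ ℓ) (σ : Fin q → ℝ) (D : Matrix (Fin ℓ) (Fin q) ℂ) :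
    (solY h σ D)ᴴ = -solY h σ D := by
  ext i j
  simp only [Matrix.conjTranspose_apply, Matrix.neg_apply, solY, Matrix.of_apply]
  by_cases hij : i = j
  · subst hij
    simp
  · simp only [hij, Ne.symm hij, if_false, star_mul', star_add, star_sub,
      star_div₀, Complex.star_def, Complex.conj_ofReal, Complex.conj_conj, map_one, map_ofNat]
    rw [← neg_sub (σ j : ℂ) (σ i : ℂ), add_comm (σ i : ℂ)]
    rw [div_neg]
    ring

/-- The explicit formulas solve `D - S - X Σ + Σ Y = 0`. -/
lemma solX_mul_sub_mul_solY (h : q ≤ ℓ) {σ : Fin q → ℝ} (hσ : IsRegular σ)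
    (D : Matrix (Fin ℓ) (Fin q) ℂ) :
    solX σ D * rectDiag ℓ σ - rectDiag ℓ σ * solY h σ D = D - rectDiag ℓ (solS h D) := by
  ext i j
  have hσj : (σ j : ℂ) ≠ 0 := by exact_mod_cast hσ.1 j
  rw [Matrix.sub_apply, Matrix.sub_apply, mul_rectDiag_apply h, rectDiag_mul_apply]
  by_cases hi : (i : ℕ) < q
  · obtain ⟨i, rfl⟩ : ∃ i' : Fin q, i = Fin.castLE h i' := ⟨⟨i, hi⟩, rfl⟩
    have hR : (if hi : ((Fin.castLE h i : Fin ℓ) : ℕ) < q then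
        (σ ⟨((Fin.castLE h i : Fin ℓ) : ℕ), hi⟩ : ℂ) *
          solY h σ D ⟨((Fin.castLE h i : Fin ℓ) : ℕ), hi⟩ j else 0) = (σ i : ℂ) * solY h σ D i j :=
      dif_pos hi
    rw [hR]
    by_cases hij : i = j
    · subst hij
      have hX : solX σ D (Fin.castLE h i) (Fin.castLE h i)
          = (((D (Fin.castLE h i) i).im / (2 * σ i) : ℝ) : ℂ) * Complex.I := by
        simp [solX]
      have hY : solY h σ D i i
          = -((((D (Fin.castLE h i) i).im / (2 * σ i) : ℝ) : ℂ) * Complex.I) := by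
        simp [solY]
      have hS : rectDiag ℓ (solS h D) (Fin.castLE h i) i = (D (Fin.castLE h i) i).re := by
        simp [rectDiag, solS]
      have := Complex.re_add_im (D (Fin.castLE h i) i)
      rw [hX, hY, hS]
      generalize D (Fin.castLE h i) i = d at this ⊢
      push_cast
      field_simp
      linear_combination (2 : ℂ) * this
    · have hij' : (Fin.castLE h i) ≠ Fin.castLE h j := fun e => hij (Fin.castLE_injective h e)
      have hv : (i : ℕ) ≠ j := fun e => hij (Fin.ext e)
      obtain ⟨h1, h2⟩ := hσ.2 j i (Ne.symm hij)
      have h1' : (σ j : ℂ) - σ i ≠ 0 := by exact_mod_cast h1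
      have h2' : (σ j : ℂ) + σ i ≠ 0 := by exact_mod_cast h2
      have hX : solX σ D (Fin.castLE h i) (Fin.castLE h j) = (1 / 2 : ℂ) *
          ((D (Fin.castLE h i) j + star (D (Fin.castLE h j) i)) / ((σ j : ℂ) - (σ i : ℂ))
          + (D (Fin.castLE h i) j - star (D (Fin.castLE h j) i)) / ((σ j : ℂ) + (σ i : ℂ))) := by
        simp [solX, hij]
      have hY : solY h σ D i j = (1 / 2 : ℂ) *
          ((D (Fin.castLE h i) j + star (D (Fin.castLE h j) i)) / ((σ j : ℂ) - (σ i : ℂ))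
          - (D (Fin.castLE h i) j - star (D (Fin.castLE h j) i)) / ((σ j : ℂ) + (σ i : ℂ))) := by
        simp [solY, hij]
      have hS : rectDiag ℓ (solS h D) (Fin.castLE h i) j = 0 := by
        simp [rectDiag, hv]
      rw [hX, hY, hS]
      generalize D (Fin.castLE h i) j = d
      generalize star (D (Fin.castLE h j) i) = d'
      field_simp
      ring
  · have hv : (i : ℕ) ≠ j := fun e => hi (e ▸ j.2)
    have hX : solX σ D i (Fin.castLE h j) = D i j / (σ j : ℂ) := by
      simp [solX, hi]
    have hS : rectDiag ℓ (solS h D) i j = 0 := by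
      simp [rectDiag, hv]
    rw [dif_neg hi, hX, hS]
    field_simp

lemma matNorm_sub_solS_le (h : q ≤ ℓ) (D : Matrix (Fin ℓ) (Fin q) ℂ) :
    matNorm (D - rectDiag ℓ (solS h D)) ≤ matNorm D := by
  refine matNorm_mono fun i j => ?_
  simp only [Matrix.sub_apply, rectDiag, Matrix.of_apply]
  split_ifs with hij
  · have : i = Fin.castLE h j := Fin.ext hij
    subst this
    have h1 : D (Fin.castLE h j) j - (solS h D j : ℂ)
        = ((D (Fin.castLE h j) j).im : ℂ) * Complex.I := by
      have := Complex.re_add_im (D (Fin.castLE h j) j)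
      simp only [solS]
      linear_combination (-1 : ℂ) * this
    rw [h1, norm_mul, Complex.norm_I, mul_one, Complex.norm_real]
    exact Complex.abs_im_le_norm _
  · rw [sub_zero]

lemma abs_solS_le (h : q ≤ ℓ) (D : Matrix (Fin ℓ) (Fin q) ℂ) (i : Fin q) :
    |solS h D i| ≤ matNorm D :=
  (Complex.abs_re_le_norm _).trans (norm_apply_le_matNorm D _ _)

lemma norm_half_pair_le {σ : Fin q → ℝ} {i j : Fin q} (hij : i ≠ j)
    (a b : ℂ) (ε : ℂ) (hε : ‖ε‖ = 1) :
    ‖(1 / 2 : ℂ) * ((a + star b) / ((σ j : ℂ) - (σ i : ℂ))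
      + ε * ((a - star b) / ((σ j : ℂ) + (σ i : ℂ))))‖ ≤ kappa σ / 2 * (‖a‖ + ‖b‖) := by
  have h1 : ‖(σ j : ℂ) - (σ i : ℂ)‖ = |σ j - σ i| := by
    rw [← Complex.ofReal_sub, Complex.norm_real, Real.norm_eq_abs]
  have h2 : ‖(σ j : ℂ) + (σ i : ℂ)‖ = |σ j + σ i| := by
    rw [← Complex.ofReal_add, Complex.norm_real, Real.norm_eq_abs]
  have hp := pair_le_kappa σ (Ne.symm hij)
  have n1 : ‖a + star b‖ ≤ ‖a‖ + ‖b‖ := (norm_add_le _ _).trans (by rw [norm_star])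
  have n2 : ‖a - star b‖ ≤ ‖a‖ + ‖b‖ := (norm_sub_le _ _).trans (by rw [norm_star])
  calc _ ≤ 1 / 2 * ((‖a‖ + ‖b‖) / |σ j - σ i| + (‖a‖ + ‖b‖) / |σ j + σ i|) := by
        rw [norm_mul]
        have : ‖(1 / 2 : ℂ)‖ = 1 / 2 := by norm_num
        rw [this]
        refine mul_le_mul_of_nonneg_left ((norm_add_le _ _).trans ?_) (by norm_num)
        rw [norm_mul, hε, one_mul, norm_div, norm_div, h1, h2]
        gcongr
    _ = (‖a‖ + ‖b‖) / 2 * (1 / |σ j - σ i| + 1 / |σ j + σ i|) := by ring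
    _ ≤ (‖a‖ + ‖b‖) / 2 * kappa σ := by gcongr
    _ = _ := by ring

lemma norm_diag_le {σ : Fin q → ℝ} (i : Fin q) (d : ℂ) :
    ‖((d.im / (2 * σ i) : ℝ) : ℂ) * Complex.I‖ ≤ kappa σ / 2 * ‖d‖ := by
  rw [norm_mul, Complex.norm_I, mul_one, Complex.norm_real, Real.norm_eq_abs, abs_div, abs_mul,
    abs_two]
  calc |d.im| / (2 * |σ i|) = |d.im| / 2 * (1 / |σ i|) := by ring
    _ ≤ ‖d‖ / 2 * kappa σ := by
        gcongr
        · exact Complex.abs_im_le_norm d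
        · exact inv_abs_le_kappa σ i
    _ = _ := by ring

lemma norm_div_sigma_le {σ : Fin q → ℝ} (i : Fin q) (d : ℂ) :
    ‖d / (σ i : ℂ)‖ ≤ kappa σ * ‖d‖ := by
  rw [norm_div, Complex.norm_real, Real.norm_eq_abs]
  calc ‖d‖ / |σ i| = 1 / |σ i| * ‖d‖ := by ring
    _ ≤ _ := by gcongr; exact inv_abs_le_kappa σ i

/-- For `q ≥ 2` the bound `κ ‖D‖` may fail: a row of `X` meets the corresponding row of `D` with
weight `κ / 2` and the whole of the corresponding column with weight up to `κ`. -/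
lemma matNorm_solX_le (h : q ≤ ℓ) {σ : Fin q → ℝ} {ξ : ℝ} (hξ1 : 1 ≤ ξ)
    (hξ : q = 1 ∨ 3 / 2 ≤ ξ) (D : Matrix (Fin ℓ) (Fin q) ℂ) :
    matNorm (solX σ D) ≤ ξ * (kappa σ * matNorm D) := by
  have hκ := one_le_kappa σ
  have hN := matNorm_nonneg D
  have hb : 0 ≤ ξ * (kappa σ * matNorm D) := by positivity
  have hκN : 0 ≤ kappa σ * matNorm D := by positivity
  have hrow : rowNorm (solX σ D) ≤ ξ * (kappa σ * matNorm D) := by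
    refine (rowNorm_le_iff hb).2 fun i => ?_
    by_cases hi : (i : ℕ) < q
    · have hcol := col_sum_le_matNorm D ⟨i, hi⟩
      rcases hξ with hq | hξ
      · have hent : ∀ j, ‖solX σ D i j‖ ≤ kappa σ * ‖D j ⟨i, hi⟩‖ := by
          intro j
          simp only [solX, Matrix.of_apply, hi, dite_true]
          split_ifs with hj hij
          · subst hij
            refine (norm_diag_le _ _).trans ?_
            nlinarith [norm_nonneg (D i ⟨i, hi⟩)]
          · exact absurd (Fin.ext (by omega)) hij
          · rw [norm_neg]
            refine (norm_div_sigma_le _ _).trans ?_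
            rw [norm_star]
        refine (Finset.sum_le_sum fun j _ => hent j).trans ?_
        rw [← Finset.mul_sum]
        nlinarith
      · have hent : ∀ j : Fin ℓ, ‖solX σ D i j‖ ≤ kappa σ / 2 *
            (if hj : (j : ℕ) < q then ‖D i ⟨j, hj⟩‖ else 0) + kappa σ * ‖D j ⟨i, hi⟩‖ := by
          intro j
          simp only [solX, Matrix.of_apply, hi, dite_true]
          split_ifs with hj hij
          · subst hij
            refine (norm_diag_le _ _).trans ?_
            nlinarith [norm_nonneg (D i ⟨i, hi⟩)]
          · have := norm_half_pair_le (σ := σ) (i := ⟨i, hi⟩) (j := ⟨j, hj⟩)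
              (fun e => hij (Fin.ext (by simpa using e))) (D i ⟨j, hj⟩) (D j ⟨i, hi⟩) 1 (by simp)
            rw [one_mul] at this
            refine this.trans ?_
            nlinarith [norm_nonneg (D j ⟨i, hi⟩)]
          · rw [norm_neg, mul_zero, zero_add]
            refine (norm_div_sigma_le _ _).trans ?_
            rw [norm_star]
        refine (Finset.sum_le_sum fun j _ => hent j).trans ?_
        rw [Finset.sum_add_distrib, ← Finset.mul_sum, ← Finset.mul_sum,
          sum_dite_lt h fun j => ‖D i j‖]
        have hr := row_sum_le_matNorm D i
        nlinarith [mul_le_mul_of_nonneg_left hr (by linarith : 0 ≤ kappa σ),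
          mul_le_mul_of_nonneg_left hcol (by linarith : 0 ≤ kappa σ)]
    · have hent : ∀ j : Fin ℓ, ‖solX σ D i j‖ ≤ kappa σ *
          (if hj : (j : ℕ) < q then ‖D i ⟨j, hj⟩‖ else 0) := by
        intro j
        simp only [solX, Matrix.of_apply, hi, dite_false]
        split_ifs with hj
        · exact norm_div_sigma_le _ _
        · simp
      refine (Finset.sum_le_sum fun j _ => hent j).trans ?_
      rw [← Finset.mul_sum, sum_dite_lt h fun j => ‖D i j‖]
      have hr := row_sum_le_matNorm D i
      nlinarith [mul_le_mul_of_nonneg_left hr (by linarith : 0 ≤ kappa σ)]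
  refine max_le hrow ?_
  rwa [solX_conjTranspose, rowNorm_neg]

lemma matNorm_solY_le (h : q ≤ ℓ) {σ : Fin q → ℝ} (D : Matrix (Fin ℓ) (Fin q) ℂ) :
    matNorm (solY h σ D) ≤ kappa σ * matNorm D := by
  have hκ := one_le_kappa σ
  have hN := matNorm_nonneg D
  have hb : 0 ≤ kappa σ * matNorm D := by positivity
  have hrow : rowNorm (solY h σ D) ≤ kappa σ * matNorm D := by
    refine (rowNorm_le_iff hb).2 fun i => ?_
    have hent : ∀ j, ‖solY h σ D i j‖
        ≤ kappa σ / 2 * (‖D (Fin.castLE h i) j‖ + ‖D (Fin.castLE h j) i‖) := by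
      intro j
      simp only [solY, Matrix.of_apply]
      split_ifs with hij
      · subst hij
        rw [norm_neg]
        refine (norm_diag_le _ _).trans ?_
        nlinarith [norm_nonneg (D (Fin.castLE h i) i)]
      · have := norm_half_pair_le (σ := σ) hij (D (Fin.castLE h i) j) (D (Fin.castLE h j) i)
          (-1) (by simp)
        rwa [neg_one_mul, ← sub_eq_add_neg] at this
    refine (Finset.sum_le_sum fun j _ => hent j).trans ?_
    rw [← Finset.mul_sum, Finset.sum_add_distrib]
    have hr := row_sum_le_matNorm D (Fin.castLE h i)
    have hc : ∑ j : Fin q, ‖D (Fin.castLE h j) i‖ ≤ matNorm D := by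
      refine le_trans ?_ (col_sum_le_matNorm D i)
      have := Finset.sum_map Finset.univ ⟨Fin.castLE h, Fin.castLE_injective h⟩
        fun k => ‖D k i‖
      simp only [Function.Embedding.coeFn_mk] at this
      rw [← this]
      exact Finset.sum_le_univ_sum_of_nonneg fun _ => norm_nonneg _
    nlinarith
  refine max_le hrow ?_
  rwa [solY_conjTranspose, rowNorm_neg]

end Sylvester

/-! ### One inner correction for `p ≥ 2` -/

section InnerStep

variable {ℓ q : ℕ}

/-- Only `X W - W Y` and a term of degree four occur. This is the cancellation which, for `p ≥ 2`,
keeps the size of `W` out of the terms of lower degree. -/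
lemma quadratic_sandwich_eq (X : Matrix (Fin ℓ) (Fin ℓ) ℂ) (Y : Matrix (Fin q) (Fin q) ℂ)
    (W : Matrix (Fin ℓ) (Fin q) ℂ) :
    (1 - X + (1 / 2 : ℂ) • X ^ 2) * W * (1 + Y + (1 / 2 : ℂ) • Y ^ 2)
      = W - (X * W - W * Y) + (1 / 2 : ℂ) • (X * (X * W - W * Y) - (X * W - W * Y) * Y)
        + (1 / 2 : ℂ) • (X * (X * W - W * Y) * Y) + (1 / 4 : ℂ) • (X ^ 2 * W * Y ^ 2) := by
  simp only [pow_two, Matrix.add_mul, Matrix.sub_mul, Matrix.mul_add, Matrix.mul_sub,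
    Matrix.smul_mul, Matrix.mul_smul, Matrix.one_mul, Matrix.mul_one, Matrix.mul_assoc]
  module

lemma quadratic_sandwich_sub_eq (A Z : Matrix (Fin ℓ) (Fin ℓ) ℂ) (B T : Matrix (Fin q) (Fin q) ℂ)
    (R Δ : Matrix (Fin ℓ) (Fin q) ℂ) :
    (1 - (A + Z) + (1 / 2 : ℂ) • (A + Z) ^ 2) * (R + Δ) * (1 + (B + T) + (1 / 2 : ℂ) • (B + T) ^ 2)
      - (1 - A + (1 / 2 : ℂ) • A ^ 2) * (R + Δ) * (1 + B + (1 / 2 : ℂ) • B ^ 2)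
      + (Z * R - R * T)
    = (1 / 2 : ℂ) • ((((2 : ℂ) • Δ - ((A + Z) * R - R * (B + T))) * T
          - Z * ((2 : ℂ) • Δ - ((A + Z) * R - R * (B + T))))
        + (Z * ((A + Z) * Δ - Δ * (B + T)) - ((A + Z) * Δ - Δ * (B + T)) * T)
        + (A * (Z * (R + Δ) - (R + Δ) * T) - (Z * (R + Δ) - (R + Δ) * T) * B)
        + (Z * ((A + Z) * (R + Δ) - (R + Δ) * (B + T)) * (B + T)
          + A * (Z * (R + Δ) - (R + Δ) * T) * (B + T)
          + A * (A * (R + Δ) - (R + Δ) * B) * T))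
      + (1 / 4 : ℂ) • (((A + Z) * Z + Z * A) * (R + Δ) * (B + T) ^ 2
          + A ^ 2 * (R + Δ) * ((B + T) * T + T * B)) := by
  rw [quadratic_sandwich_eq, quadratic_sandwich_eq]
  simp only [pow_two, Matrix.add_mul, Matrix.sub_mul, Matrix.mul_add, Matrix.mul_sub,
    Matrix.smul_mul, Matrix.mul_smul, Matrix.mul_assoc]
  module

/-- The factor by which one inner correction reduces the residual, without the terms of degree at
least four in `c_p`. Here `ξ` bounds the ratio of `X` to `κ D`, `k` bounds `κ ‖W‖`, and `m₀`, `m₁`,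
`m` bound `κ` times the first residual, the sum of the residuals before the current one, and the
sum including it. -/
noncomputable def stepFactor (ξ k m₀ m₁ m : ℝ) : ℝ :=
  (ξ + 1) / 2 * (m₀ + m) + (ξ + 1) ^ 2 / 2 * (m * m₀) + (ξ + 1) / 2 * (m₁ * (1 + (ξ + 1) * m₀))
    + ξ / 2 * (m * (1 + (ξ + 1) * m₀) * m + m₁ * (1 + (ξ + 1) * m₀) * m
      + m₁ * (m * (1 + (ξ + 1) * m₀)))
    + k * m ^ 3 * (ξ ^ 2 + 7 / 5 * (ξ + 1) * ξ ^ 3)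

lemma norm_half : ‖(1 / 2 : ℂ)‖ ≤ 1 / 2 := by norm_num

lemma norm_quarter : ‖(1 / 4 : ℂ)‖ ≤ 1 / 4 := by norm_num

variable {A Z : Matrix (Fin ℓ) (Fin ℓ) ℂ} {B T : Matrix (Fin q) (Fin q) ℂ}
  {R Δ : Matrix (Fin ℓ) (Fin q) ℂ} {κ ξ k μ m₀ m₁ m : ℝ}

lemma matNorm_quadratic_sandwich_sub_le (hκ : 0 < κ) (hξ : 1 ≤ ξ) (hm₁ : m₁ ≤ m)
    (hA : matNorm A ≤ ξ * m₁) (hB : matNorm B ≤ m₁)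
    (hZ : matNorm Z ≤ ξ * μ) (hT : matNorm T ≤ μ)
    (hX : matNorm (A + Z) ≤ ξ * m) (hY : matNorm (B + T) ≤ m)
    (hΔ : matNorm Δ ≤ m₀ / κ) (hW : matNorm (R + Δ) ≤ k / κ)
    (hC : matNorm (Z * R - R * T) ≤ μ / κ)
    (hold : matNorm (A * R - R * B) ≤ m / κ)
    (hnew : matNorm ((A + Z) * R - R * (B + T)) ≤ m / κ)
    (h2 : matNorm ((2 : ℂ) • Δ - ((A + Z) * R - R * (B + T))) ≤ (m₀ + m) / κ) :
    matNorm ((1 - (A + Z) + (1 / 2 : ℂ) • (A + Z) ^ 2) * (R + Δ) *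
        (1 + (B + T) + (1 / 2 : ℂ) • (B + T) ^ 2)
      - (1 - A + (1 / 2 : ℂ) • A ^ 2) * (R + Δ) * (1 + B + (1 / 2 : ℂ) • B ^ 2)
      + (Z * R - R * T))
      ≤ μ / κ * (stepFactor ξ k m₀ m₁ m - k * m ^ 3 * (7 / 5 * (ξ + 1) * ξ ^ 3)) := by
  have hμ : 0 ≤ μ := (matNorm_nonneg _).trans hT
  have hm₁0 : 0 ≤ m₁ := (matNorm_nonneg _).trans hB
  have hm0 : 0 ≤ m := (matNorm_nonneg _).trans hY
  have hm₀0 : 0 ≤ m₀ := by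
    have := (matNorm_nonneg _).trans hΔ
    rwa [le_div_iff₀ hκ, zero_mul] at this
  have hk : 0 ≤ k := by
    have := (matNorm_nonneg _).trans hW
    rwa [le_div_iff₀ hκ, zero_mul] at this
  have hN : matNorm (Z * (R + Δ) - (R + Δ) * T) ≤ μ * (1 + (ξ + 1) * m₀) / κ := by
    have : Z * (R + Δ) - (R + Δ) * T = (Z * R - R * T) + (Z * Δ - Δ * T) := by
      rw [Matrix.mul_add, Matrix.add_mul]; abel
    rw [this]
    refine (matNorm_add_le hC (matNorm_sub_le (matNorm_mul_le hZ hΔ)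
      (matNorm_mul_le hΔ hT))).trans (le_of_eq ?_)
    ring
  have hXΔ : matNorm ((A + Z) * Δ - Δ * (B + T)) ≤ (ξ + 1) * (m * m₀) / κ := by
    refine (matNorm_sub_le (matNorm_mul_le hX hΔ) (matNorm_mul_le hΔ hY)).trans (le_of_eq ?_)
    ring
  have hBW' : matNorm ((A + Z) * (R + Δ) - (R + Δ) * (B + T))
      ≤ m * (1 + (ξ + 1) * m₀) / κ := by
    have : (A + Z) * (R + Δ) - (R + Δ) * (B + T)
        = ((A + Z) * R - R * (B + T)) + ((A + Z) * Δ - Δ * (B + T)) := by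
      rw [Matrix.mul_add, Matrix.add_mul R]; abel
    rw [this]
    refine (matNorm_add_le hnew hXΔ).trans (le_of_eq ?_)
    ring
  have hBW : matNorm (A * (R + Δ) - (R + Δ) * B) ≤ m * (1 + (ξ + 1) * m₀) / κ := by
    have : A * (R + Δ) - (R + Δ) * B = (A * R - R * B) + (A * Δ - Δ * B) := by
      rw [Matrix.mul_add, Matrix.add_mul R]; abel
    rw [this]
    refine (matNorm_add_le hold (matNorm_sub_le (matNorm_mul_le hA hΔ)
      (matNorm_mul_le hΔ hB))).trans ?_
    have : ξ * m₁ * (m₀ / κ) + m₀ / κ * m₁ ≤ ξ * m * (m₀ / κ) + m₀ / κ * m := by gcongr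
    refine (add_le_add_right this _).trans (le_of_eq ?_)
    ring
  rw [quadratic_sandwich_sub_eq]
  refine (matNorm_add_le
    (matNorm_smul_le norm_half (matNorm_add_le (matNorm_add_le (matNorm_add_le
      (matNorm_sub_le (matNorm_mul_le h2 hT) (matNorm_mul_le hZ h2))
      (matNorm_sub_le (matNorm_mul_le hZ hXΔ) (matNorm_mul_le hXΔ hT)))
      (matNorm_sub_le (matNorm_mul_le hA hN) (matNorm_mul_le hN hB)))
      (matNorm_add_le (matNorm_add_le
        (matNorm_mul_le (matNorm_mul_le hZ hBW') hY)
        (matNorm_mul_le (matNorm_mul_le hA hN) hY))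
        (matNorm_mul_le (matNorm_mul_le hA hBW) hT))))
    (matNorm_smul_le norm_quarter (matNorm_add_le
      (matNorm_mul_le (matNorm_mul_le (matNorm_add_le (matNorm_mul_le hX hZ)
        (matNorm_mul_le hZ hA)) hW) (matNorm_pow_le hY 2))
      (matNorm_mul_le (matNorm_mul_le (matNorm_pow_le hA 2) hW)
        (matNorm_add_le (matNorm_mul_le hY hT) (matNorm_mul_le hT hB)))))).trans ?_
  have h4 : (ξ * m * (ξ * μ) + ξ * μ * (ξ * m₁)) * (k / κ) * m ^ 2
      + (ξ * m₁) ^ 2 * (k / κ) * (m * μ + μ * m₁)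
      ≤ (ξ * m * (ξ * μ) + ξ * μ * (ξ * m)) * (k / κ) * m ^ 2
      + (ξ * m) ^ 2 * (k / κ) * (m * μ + μ * m) := by
    gcongr
  refine (add_le_add_right (mul_le_mul_of_nonneg_left h4 (by norm_num)) _).trans (le_of_eq ?_)
  rw [stepFactor]
  ring

section SmallMatrices

variable {k : ℕ} {X X' : Matrix (Fin k) (Fin k) ℂ} {r z : ℝ}

lemma matNorm_quadratic_le (hr : r ≤ 1 / 6) (hX : matNorm X ≤ r) :
    matNorm (1 + X + (1 / 2 : ℂ) • X ^ 2) ≤ 3 / 2 := by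
  have h0 := (matNorm_nonneg X).trans hX
  refine (matNorm_add_le (matNorm_add_le matNorm_one_le hX)
    (matNorm_smul_le norm_half (matNorm_pow_le hX 2))).trans ?_
  nlinarith

lemma matNorm_quadratic_sub_le (hr : r ≤ 1 / 6) (hX : matNorm X ≤ r) (hX' : matNorm X' ≤ r)
    (hz : matNorm (X' - X) ≤ z) :
    matNorm ((1 + X' + (1 / 2 : ℂ) • X' ^ 2) - (1 + X + (1 / 2 : ℂ) • X ^ 2)) ≤ 7 / 6 * z := by
  have hz0 := (matNorm_nonneg _).trans hz
  have e : (1 + X' + (1 / 2 : ℂ) • X' ^ 2) - (1 + X + (1 / 2 : ℂ) • X ^ 2)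
      = (X' - X) + (1 / 2 : ℂ) • (X' ^ 2 - X ^ 2) := by module
  rw [e]
  refine (matNorm_add_le hz (matNorm_smul_le norm_half
    (matNorm_pow_sub_pow_le hX' hX hz 2))).trans ?_
  have := mul_le_mul_of_nonneg_right hr hz0
  push_cast
  simp only [pow_one]
  linarith

lemma matNorm_cTail_le_of_le (p : ℕ) (hr : r ≤ 1 / 6) (hX : matNorm X ≤ r) :
    matNorm (cTail p X) ≤ 1 / 10 * r ^ 3 := by
  have h0 := (matNorm_nonneg X).trans hX
  refine (matNorm_cTail_le p (by linarith) hX).trans ?_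
  have : r ^ 3 / (1 - r) ≤ 6 / 5 * r ^ 3 := by
    rw [div_le_iff₀ (by linarith)]; nlinarith [pow_nonneg h0 3]
  have h3 := pow_nonneg h0 3
  nlinarith

lemma matNorm_cTail_sub_le_of_le (p : ℕ) (hr : r ≤ 1 / 6) (hX : matNorm X ≤ r)
    (hX' : matNorm X' ≤ r) (hz : matNorm (X' - X) ≤ z) :
    matNorm (cTail p X' - cTail p X) ≤ 3 / 5 * r ^ 3 * z := by
  have h0 := (matNorm_nonneg X).trans hX
  have hz0 := (matNorm_nonneg _).trans hz
  refine (matNorm_cTail_sub_le p (by linarith) hX' hX hz).trans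
    (mul_le_mul_of_nonneg_right ?_ hz0)
  have : r ^ 3 / (1 - r) ≤ 6 / 5 * r ^ 3 := by
    rw [div_le_iff₀ (by linarith)]; nlinarith [pow_nonneg h0 3]
  linarith

end SmallMatrices

/-- The effect on `(1 + c_p(X)^*) W (1 + c_p(Y))` of replacing `(X, Y) = (A, B)` by
`(A + Z, B + T)`, up to the first order term `-(Z Σ - Σ T)`. -/
lemma matNorm_sandwich_sub_le {p : ℕ} (hp : 2 ≤ p) (hAs : Aᴴ = -A) (hXs : (A + Z)ᴴ = -(A + Z))
    (hκ : 0 < κ) (hξ : 1 ≤ ξ) (hm₁ : m₁ ≤ m) (hm6 : ξ * m ≤ 1 / 6)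
    (hA : matNorm A ≤ ξ * m₁) (hB : matNorm B ≤ m₁)
    (hZ : matNorm Z ≤ ξ * μ) (hT : matNorm T ≤ μ)
    (hX : matNorm (A + Z) ≤ ξ * m) (hY : matNorm (B + T) ≤ m)
    (hΔ : matNorm Δ ≤ m₀ / κ) (hW : matNorm (R + Δ) ≤ k / κ)
    (hC : matNorm (Z * R - R * T) ≤ μ / κ)
    (hold : matNorm (A * R - R * B) ≤ m / κ)
    (hnew : matNorm ((A + Z) * R - R * (B + T)) ≤ m / κ)
    (h2 : matNorm ((2 : ℂ) • Δ - ((A + Z) * R - R * (B + T))) ≤ (m₀ + m) / κ) :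
    matNorm ((1 + (cPoly p (A + Z))ᴴ) * (R + Δ) * (1 + cPoly p (B + T))
      - (1 + (cPoly p A)ᴴ) * (R + Δ) * (1 + cPoly p B) + (Z * R - R * T))
      ≤ μ / κ * stepFactor ξ k m₀ m₁ m := by
  have hμ : 0 ≤ μ := (matNorm_nonneg _).trans hT
  have hm0 : 0 ≤ m := (matNorm_nonneg _).trans hY
  have hmξ : m ≤ ξ * m := by nlinarith
  have hr0 : 0 ≤ ξ * m := by positivity
  have hω : 0 ≤ k / κ := (matNorm_nonneg _).trans hW
  have hA' : matNorm A ≤ ξ * m := hA.trans (by gcongr)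
  have hB' : matNorm B ≤ ξ * m := (hB.trans hm₁).trans hmξ
  have hY' := hY.trans hmξ
  have hq := matNorm_quadratic_sandwich_sub_le hκ hξ hm₁ hA hB hZ hT hX hY hΔ hW hC hold hnew h2
  have hZ' : matNorm (A + Z - A) ≤ ξ * μ := by rwa [add_sub_cancel_left]
  have hT' : matNorm (B + T - B) ≤ μ := by rwa [add_sub_cancel_left]
  have hr3 : (ξ * m) ^ 3 ≤ 1 / 6 ^ 3 := by
    calc (ξ * m) ^ 3 ≤ (1 / 6) ^ 3 := by gcongr
      _ = _ := by norm_num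
  have hL : (1 + (cPoly p A)ᴴ) = (1 + -A + (1 / 2 : ℂ) • (-A) ^ 2) + cTail p A := by
    rw [cPoly_conjTranspose p hAs, cPoly_eq hp, neg_sq]; module
  have hL' : (1 + (cPoly p (A + Z))ᴴ)
      = (1 + -(A + Z) + (1 / 2 : ℂ) • (-(A + Z)) ^ 2) + cTail p (A + Z) := by
    rw [cPoly_conjTranspose p hXs, cPoly_eq hp, neg_sq]; module
  have hR : 1 + cPoly p B = (1 + B + (1 / 2 : ℂ) • B ^ 2) + cTail p B := by
    rw [cPoly_eq hp]; module
  have hR' : 1 + cPoly p (B + T)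
      = (1 + (B + T) + (1 / 2 : ℂ) • (B + T) ^ 2) + cTail p (B + T) := by
    rw [cPoly_eq hp]; module
  have hH := matNorm_cTail_le_of_le p hm6 hA'
  have hG' := matNorm_cTail_le_of_le p hm6 hY'
  have hHd := matNorm_cTail_sub_le_of_le p hm6 hA' hX hZ'
  have hGd := matNorm_cTail_sub_le_of_le p hm6 hB' hY' hT'
  have nR' : matNorm ((1 + (B + T) + (1 / 2 : ℂ) • (B + T) ^ 2) + cTail p (B + T)) ≤ 2 :=
    (matNorm_add_le (matNorm_quadratic_le hm6 hY') hG').trans (by linarith)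
  have nA' : matNorm (-A) ≤ ξ * m := by rwa [matNorm_neg]
  have nL : matNorm (1 + -A + (1 / 2 : ℂ) • (-A) ^ 2) ≤ 2 :=
    (matNorm_quadratic_le hm6 nA').trans (by norm_num)
  have nRd : matNorm (((1 + (B + T) + (1 / 2 : ℂ) • (B + T) ^ 2) + cTail p (B + T))
      - ((1 + B + (1 / 2 : ℂ) • B ^ 2) + cTail p B)) ≤ 2 * μ := by
    rw [add_sub_add_comm]
    refine (matNorm_add_le (matNorm_quadratic_sub_le hm6 hB' hY' hT') hGd).trans ?_
    have := mul_le_mul_of_nonneg_right hr3 hμ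
    linarith
  have nLd : matNorm ((1 + -(A + Z) + (1 / 2 : ℂ) • (-(A + Z)) ^ 2)
      - (1 + -A + (1 / 2 : ℂ) • (-A) ^ 2)) ≤ 2 * (ξ * μ) := by
    refine (matNorm_quadratic_sub_le hm6 nA' (by rwa [matNorm_neg]) (z := ξ * μ) ?_).trans ?_
    · rw [show -(A + Z) - -A = -Z by abel, matNorm_neg]; exact hZ
    · have : 0 ≤ ξ * μ := by positivity
      linarith
  rw [hL, hL', hR, hR']
  have eq1 : 1 - A + (1 / 2 : ℂ) • A ^ 2 = 1 + -A + (1 / 2 : ℂ) • (-A) ^ 2 := by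
    rw [neg_sq, sub_eq_add_neg]
  have eq2 : 1 - (A + Z) + (1 / 2 : ℂ) • (A + Z) ^ 2
      = 1 + -(A + Z) + (1 / 2 : ℂ) • (-(A + Z)) ^ 2 := by
    rw [neg_sq, sub_eq_add_neg]
  rw [eq1, eq2] at hq
  generalize 1 + -A + (1 / 2 : ℂ) • (-A) ^ 2 = L at *
  generalize 1 + -(A + Z) + (1 / 2 : ℂ) • (-(A + Z)) ^ 2 = L' at *
  generalize 1 + B + (1 / 2 : ℂ) • B ^ 2 = Q at *
  generalize 1 + (B + T) + (1 / 2 : ℂ) • (B + T) ^ 2 = Q' at *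
  generalize cTail p A = H at *
  generalize cTail p (A + Z) = H' at *
  generalize cTail p B = G at *
  generalize cTail p (B + T) = G' at *
  clear hL hL' hR hR'
  generalize R + Δ = W at *
  have e : (L' + H') * W * (Q' + G') - (L + H) * W * (Q + G) + (Z * R - R * T)
      = (L' * W * Q' - L * W * Q + (Z * R - R * T))
        + ((H' - H) * W * (Q' + G') + H * W * ((Q' + G') - (Q + G)) + (L' - L) * W * G'
          + L * W * (G' - G)) := by
    simp only [Matrix.add_mul, Matrix.sub_mul, Matrix.mul_add, Matrix.mul_sub]
    abel
  rw [e]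
  refine (matNorm_add_le hq (matNorm_add_le (matNorm_add_le (matNorm_add_le
    (matNorm_mul_le (matNorm_mul_le hHd hW) nR')
    (matNorm_mul_le (matNorm_mul_le hH hW) nRd))
    (matNorm_mul_le (matNorm_mul_le nLd hW) hG'))
    (matNorm_mul_le (matNorm_mul_le nL hW) hGd))).trans (le_of_eq ?_)
  ring

end InnerStep

/-! ### The sequence of inner corrections -/

section Chain

variable {ℓ q : ℕ} {p : ℕ} {h : q ≤ ℓ} {σ : Fin q → ℝ} {W : Matrix (Fin ℓ) (Fin q) ℂ}

/-- The residual `Δ_{k+1}` of the inner iteration. -/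
noncomputable def innerDelta (p : ℕ) (h : q ≤ ℓ) (σ : Fin q → ℝ) (W : Matrix (Fin ℓ) (Fin q) ℂ)
    (k : ℕ) : Matrix (Fin ℓ) (Fin q) ℂ :=
  innerResidual p σ W (correction p h σ W k)

/-- `κ ‖Δ_{k+1}‖`. -/
noncomputable def scaledDelta (p : ℕ) (h : q ≤ ℓ) (σ : Fin q → ℝ) (W : Matrix (Fin ℓ) (Fin q) ℂ)
    (k : ℕ) : ℝ :=
  kappa σ * matNorm (innerDelta p h σ W k)

lemma kappa_pos (σ : Fin q → ℝ) : 0 < kappa σ := zero_lt_one.trans_le (one_le_kappa σ)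

lemma scaledDelta_nonneg (k : ℕ) : 0 ≤ scaledDelta p h σ W k :=
  mul_nonneg (kappa_pos σ).le (matNorm_nonneg _)

lemma matNorm_innerDelta (k : ℕ) :
    matNorm (innerDelta p h σ W k) = scaledDelta p h σ W k / kappa σ := by
  rw [scaledDelta, mul_div_cancel_left₀ _ (kappa_pos σ).ne']

lemma innerDelta_zero : innerDelta p h σ W 0 = W - rectDiag ℓ σ := by
  simp [innerDelta, innerResidual, correction, cPoly_zero, rectDiag_zero]

lemma correction_succ_S (k : ℕ) : (correction p h σ W (k + 1)).S
    = (correction p h σ W k).S + solS h (innerDelta p h σ W k) := rfl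

lemma correction_succ_X (k : ℕ) : (correction p h σ W (k + 1)).X
    = (correction p h σ W k).X + solX σ (innerDelta p h σ W k) := rfl

lemma correction_succ_Y (k : ℕ) : (correction p h σ W (k + 1)).Y
    = (correction p h σ W k).Y + solY h σ (innerDelta p h σ W k) := rfl

lemma correction_X_skew (k : ℕ) : (correction p h σ W k).Xᴴ = -(correction p h σ W k).X := by
  induction k with
  | zero => simp [correction]
  | succ k ih => rw [correction_succ_X, Matrix.conjTranspose_add, ih, solX_conjTranspose, neg_add]

lemma correction_Y_skew (k : ℕ) : (correction p h σ W k).Yᴴ = -(correction p h σ W k).Y := by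
  induction k with
  | zero => simp [correction]
  | succ k ih => rw [correction_succ_Y, Matrix.conjTranspose_add, ih, solY_conjTranspose, neg_add]

lemma matNorm_correction_X_le {ξ : ℝ} (hξ1 : 1 ≤ ξ) (hξ : q = 1 ∨ 3 / 2 ≤ ξ) (k : ℕ) :
    matNorm (correction p h σ W k).X ≤ ξ * ∑ j ∈ Finset.range k, scaledDelta p h σ W j := by
  induction k with
  | zero => simp [correction, matNorm_zero]
  | succ k ih =>
    rw [correction_succ_X, Finset.sum_range_succ, mul_add]
    exact matNorm_add_le ih (matNorm_solX_le h hξ1 hξ _)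

lemma matNorm_correction_Y_le (k : ℕ) :
    matNorm (correction p h σ W k).Y ≤ ∑ j ∈ Finset.range k, scaledDelta p h σ W j := by
  induction k with
  | zero => simp [correction, matNorm_zero]
  | succ k ih =>
    rw [correction_succ_Y, Finset.sum_range_succ]
    exact matNorm_add_le ih (matNorm_solY_le h _)

lemma kappa_mul_abs_correction_S_le (k : ℕ) (i : Fin q) :
    kappa σ * |(correction p h σ W k).S i| ≤ ∑ j ∈ Finset.range k, scaledDelta p h σ W j := by
  induction k with
  | zero => simp [correction]
  | succ k ih =>
    rw [correction_succ_S, Finset.sum_range_succ]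
    have h1 := abs_add_le ((correction p h σ W k).S i) (solS h (innerDelta p h σ W k) i)
    have h2 := abs_solS_le h (innerDelta p h σ W k) i
    have h3 := kappa_pos σ
    calc _ ≤ kappa σ * (|(correction p h σ W k).S i| + matNorm (innerDelta p h σ W k)) := by
          gcongr
          exact h1.trans (by gcongr)
      _ ≤ _ := by rw [mul_add]; exact add_le_add ih le_rfl

lemma correction_X_mul_sub_succ (hσ : IsRegular σ) (k : ℕ) :
    (correction p h σ W (k + 1)).X * rectDiag ℓ σ - rectDiag ℓ σ * (correction p h σ W (k + 1)).Y
      = ((correction p h σ W k).X * rectDiag ℓ σ - rectDiag ℓ σ * (correction p h σ W k).Y)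
        + (innerDelta p h σ W k - rectDiag ℓ (solS h (innerDelta p h σ W k))) := by
  rw [← solX_mul_sub_mul_solY h hσ, correction_succ_X, correction_succ_Y, Matrix.add_mul,
    Matrix.mul_add]
  abel

lemma matNorm_correction_X_mul_sub_le (hσ : IsRegular σ) (k : ℕ) :
    matNorm ((correction p h σ W k).X * rectDiag ℓ σ - rectDiag ℓ σ * (correction p h σ W k).Y)
      ≤ (∑ j ∈ Finset.range k, scaledDelta p h σ W j) / kappa σ := by
  induction k with
  | zero => simp [correction, matNorm_zero]
  | succ k ih =>
    rw [correction_X_mul_sub_succ hσ, Finset.sum_range_succ, add_div]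
    refine matNorm_add_le ih ((matNorm_sub_solS_le h _).trans_eq (matNorm_innerDelta k))

lemma matNorm_two_smul_sub_le (hσ : IsRegular σ) (k : ℕ) :
    matNorm ((2 : ℂ) • innerDelta p h σ W 0 - ((correction p h σ W (k + 1)).X * rectDiag ℓ σ
        - rectDiag ℓ σ * (correction p h σ W (k + 1)).Y))
      ≤ (scaledDelta p h σ W 0 + ∑ j ∈ Finset.range (k + 1), scaledDelta p h σ W j)
        / kappa σ := by
  induction k with
  | zero =>
    rw [correction_X_mul_sub_succ hσ]
    have h1 : (2 : ℂ) • innerDelta p h σ W 0 -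
        ((correction p h σ W 0).X * rectDiag ℓ σ - rectDiag ℓ σ * (correction p h σ W 0).Y
          + (innerDelta p h σ W 0 - rectDiag ℓ (solS h (innerDelta p h σ W 0))))
        = innerDelta p h σ W 0 + rectDiag ℓ (solS h (innerDelta p h σ W 0)) := by
      simp only [correction, Matrix.zero_mul, Matrix.mul_zero]
      module
    rw [h1, zero_add, Finset.sum_range_one, add_div]
    refine matNorm_add_le (matNorm_innerDelta 0).le ?_
    rw [← matNorm_innerDelta]
    exact matNorm_rectDiag_le (matNorm_nonneg _) (abs_solS_le h _)
  | succ k ih =>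
    rw [correction_X_mul_sub_succ hσ, Finset.sum_range_succ, ← add_assoc, add_div, ← sub_sub]
    refine matNorm_sub_le ih ((matNorm_sub_solS_le h _).trans_eq (matNorm_innerDelta _))

lemma innerDelta_succ_eq (hσ : IsRegular σ) (k : ℕ) : innerDelta p h σ W (k + 1)
    = (1 + (cPoly p (correction p h σ W (k + 1)).X)ᴴ) * W
        * (1 + cPoly p (correction p h σ W (k + 1)).Y)
      - (1 + (cPoly p (correction p h σ W k).X)ᴴ) * W * (1 + cPoly p (correction p h σ W k).Y)
      + (solX σ (innerDelta p h σ W k) * rectDiag ℓ σ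
        - rectDiag ℓ σ * solY h σ (innerDelta p h σ W k)) := by
  rw [solX_mul_sub_mul_solY h hσ]
  have h1 : innerDelta p h σ W (k + 1)
    = (1 + (cPoly p (correction p h σ W (k + 1)).X)ᴴ) * W
        * (1 + cPoly p (correction p h σ W (k + 1)).Y) - rectDiag ℓ σ
        - rectDiag ℓ (correction p h σ W (k + 1)).S := rfl
  have h2 : innerDelta p h σ W k
    = (1 + (cPoly p (correction p h σ W k).X)ᴴ) * W
        * (1 + cPoly p (correction p h σ W k).Y) - rectDiag ℓ σ
        - rectDiag ℓ (correction p h σ W k).S := rfl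
  rw [h1, correction_succ_S, rectDiag_add]
  generalize rectDiag ℓ (solS h (innerDelta p h σ W k)) = S'
  rw [h2]
  abel

lemma matNorm_W_le : matNorm W ≤ (kappa σ * bigK σ + scaledDelta p h σ W 0) / kappa σ := by
  have h1 : W = rectDiag ℓ σ + innerDelta p h σ W 0 := by rw [innerDelta_zero]; abel
  have hk := kappa_pos σ
  have h2 : matNorm (rectDiag ℓ σ) ≤ bigK σ :=
    matNorm_rectDiag_le (zero_le_one.trans (one_le_bigK σ)) (abs_le_bigK σ)
  calc matNorm W = matNorm (rectDiag ℓ σ + innerDelta p h σ W 0) := by rw [← h1]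
    _ ≤ bigK σ + scaledDelta p h σ W 0 / kappa σ := matNorm_add_le h2 (matNorm_innerDelta 0).le
    _ = _ := by field_simp

/-- One inner correction multiplies the inner residual by `stepFactor`, which is small because the
terms linear in the new correction cancel up to products with `Δ_1` and with old corrections. -/
lemma scaledDelta_succ_le (hp : 2 ≤ p) (hσ : IsRegular σ) {ξ : ℝ} (hξ1 : 1 ≤ ξ)
    (hξ : q = 1 ∨ 3 / 2 ≤ ξ) (k : ℕ)
    (hm : ξ * ∑ j ∈ Finset.range (k + 1), scaledDelta p h σ W j ≤ 1 / 6) :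
    scaledDelta p h σ W (k + 1) ≤ scaledDelta p h σ W k *
      stepFactor ξ (kappa σ * bigK σ + scaledDelta p h σ W 0) (scaledDelta p h σ W 0)
        (∑ j ∈ Finset.range k, scaledDelta p h σ W j)
        (∑ j ∈ Finset.range (k + 1), scaledDelta p h σ W j) := by
  have hk := kappa_pos σ
  have hW : W = rectDiag ℓ σ + innerDelta p h σ W 0 := by rw [innerDelta_zero]; abel
  have hm1 : ∑ j ∈ Finset.range k, scaledDelta p h σ W j
      ≤ ∑ j ∈ Finset.range (k + 1), scaledDelta p h σ W j := by
    rw [Finset.sum_range_succ]; exact le_add_of_nonneg_right (scaledDelta_nonneg k)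
  have key := matNorm_sandwich_sub_le (Z := solX σ (innerDelta p h σ W k))
    (T := solY h σ (innerDelta p h σ W k)) (R := rectDiag ℓ σ) (Δ := innerDelta p h σ W 0)
    hp (correction_X_skew (p := p) (h := h) (σ := σ) (W := W) k)
    (by rw [← correction_succ_X]; exact correction_X_skew _) hk hξ1 hm1 hm
    (matNorm_correction_X_le hξ1 hξ k) (matNorm_correction_Y_le k)
    (matNorm_solX_le h hξ1 hξ _) (matNorm_solY_le h _)
    (by rw [← correction_succ_X]; exact matNorm_correction_X_le hξ1 hξ (k + 1))
    (by rw [← correction_succ_Y]; exact matNorm_correction_Y_le (k + 1))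
    (matNorm_innerDelta 0).le (by rw [← hW]; exact matNorm_W_le (p := p) (h := h))
    (by rw [solX_mul_sub_mul_solY h hσ]
        exact (matNorm_sub_solS_le h _).trans_eq (matNorm_innerDelta k))
    ((matNorm_correction_X_mul_sub_le hσ k).trans (by gcongr))
    (by rw [← correction_succ_X, ← correction_succ_Y]
        exact matNorm_correction_X_mul_sub_le hσ (k + 1))
    (by rw [← correction_succ_X, ← correction_succ_Y]
        exact matNorm_two_smul_sub_le hσ k)
  rw [← correction_succ_X, ← correction_succ_Y, ← hW, ← innerDelta_succ_eq hσ,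
    matNorm_innerDelta, div_mul_eq_mul_div, div_le_div_iff_of_pos_right hk] at key
  exact key

/-- For `p = 1` a term `X Σ Y` is left over, which brings in the factor `K`. -/
lemma scaledDelta_one_le_of_p_eq_one (hσ : IsRegular σ) {ξ : ℝ} (hξ1 : 1 ≤ ξ)
    (hξ : q = 1 ∨ 3 / 2 ≤ ξ) :
    scaledDelta 1 h σ W 1 ≤ scaledDelta 1 h σ W 0 ^ 2 *
      (ξ + 1 + ξ * (kappa σ * bigK σ + scaledDelta 1 h σ W 0)) := by
  have hk := kappa_pos σ
  have hW : W = rectDiag ℓ σ + innerDelta 1 h σ W 0 := by rw [innerDelta_zero]; abel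
  set X := (correction 1 h σ W 1).X with hX
  set Y := (correction 1 h σ W 1).Y with hY
  have hX1 : X = solX σ (innerDelta 1 h σ W 0) := by
    rw [hX, correction_succ_X]; simp [correction]
  have hY1 : Y = solY h σ (innerDelta 1 h σ W 0) := by
    rw [hY, correction_succ_Y]; simp [correction]
  have nX : matNorm X ≤ ξ * scaledDelta 1 h σ W 0 := by
    rw [hX1]; exact matNorm_solX_le h hξ1 hξ _
  have nY : matNorm Y ≤ scaledDelta 1 h σ W 0 := by
    rw [hY1]; exact matNorm_solY_le h _
  have hXs : Xᴴ = -X := correction_X_skew 1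
  have e : innerDelta 1 h σ W 1
      = innerDelta 1 h σ W 0 * Y - X * innerDelta 1 h σ W 0 - X * W * Y := by
    have h1 := innerDelta_succ_eq (p := 1) (h := h) (W := W) hσ 0
    rw [← hX1, ← hY1] at h1
    rw [h1, zero_add, ← hX, ← hY, cPoly_one, cPoly_one, hXs]
    simp only [correction, cPoly_zero, Matrix.conjTranspose_zero, add_zero, Matrix.one_mul,
      Matrix.mul_one, Matrix.add_mul, Matrix.mul_add, Matrix.neg_mul]
    have h2 : X * W = X * rectDiag ℓ σ + X * innerDelta 1 h σ W 0 := by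
      rw [← Matrix.mul_add, ← hW]
    have h3 : W * Y = rectDiag ℓ σ * Y + innerDelta 1 h σ W 0 * Y := by
      rw [← Matrix.add_mul, ← hW]
    rw [h3, h2, Matrix.add_mul]
    abel
  have n0 : matNorm (innerDelta 1 h σ W 0) ≤ scaledDelta 1 h σ W 0 / kappa σ :=
    (matNorm_innerDelta 0).le
  have n1 := matNorm_sub_le (matNorm_sub_le (matNorm_mul_le n0 nY) (matNorm_mul_le nX n0))
    (matNorm_mul_le (matNorm_mul_le nX (matNorm_W_le (p := 1) (h := h) (σ := σ) (W := W))) nY)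
  rw [← e, matNorm_innerDelta, div_le_iff₀ hk] at n1
  refine n1.trans (le_of_eq ?_)
  field_simp
  ring

end Chain

section StepFactor

lemma stepFactor_le {ξ k m₀ m₁ m G G₁ G₂ Q τ : ℝ} (hξ : 0 ≤ ξ) (hm₀ : 0 ≤ m₀)
    (hm : 0 ≤ m) (hτ0 : 0 ≤ τ) (hτ : τ ≤ 1) (h₀ : m₀ ≤ G * τ) (h₁ : m₁ ≤ G₁ * τ)
    (h₂ : m ≤ G₂ * τ) (hk : k * m ^ 3 ≤ Q * τ) (hG : 0 ≤ G) (hG₁ : 0 ≤ G₁) (hG₂ : 0 ≤ G₂) :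
    stepFactor ξ k m₀ m₁ m ≤ ((ξ + 1) / 2 * (G + G₂) + (ξ + 1) ^ 2 / 2 * (G₂ * G)
      + (ξ + 1) / 2 * (G₁ * (1 + (ξ + 1) * G))
      + ξ / 2 * (G₂ * (1 + (ξ + 1) * G) * G₂ + G₁ * (1 + (ξ + 1) * G) * G₂
        + G₁ * (G₂ * (1 + (ξ + 1) * G)))
      + Q * (ξ ^ 2 + 7 / 5 * (ξ + 1) * ξ ^ 3)) * τ := by
  have h₀' : m₀ ≤ G := h₀.trans (mul_le_of_le_one_right hG hτ)
  have h₂' : m ≤ G₂ := h₂.trans (mul_le_of_le_one_right hG₂ hτ)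
  calc stepFactor ξ k m₀ m₁ m
      ≤ (ξ + 1) / 2 * (G * τ + G₂ * τ) + (ξ + 1) ^ 2 / 2 * ((G₂ * τ) * G)
        + (ξ + 1) / 2 * ((G₁ * τ) * (1 + (ξ + 1) * G))
        + ξ / 2 * ((G₂ * τ) * (1 + (ξ + 1) * G) * G₂ + (G₁ * τ) * (1 + (ξ + 1) * G) * G₂
          + (G₁ * τ) * (G₂ * (1 + (ξ + 1) * G)))
        + (Q * τ) * (ξ ^ 2 + 7 / 5 * (ξ + 1) * ξ ^ 3) := by
        rw [stepFactor]
        gcongr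
    _ = _ := by ring

end StepFactor

/-! ### One step of `H_p` -/

section Step

variable {m n ℓ q : ℕ}

/-- `T` has regular `Σ` and defects of relative size at most `w`, measured as in the hypothesis of
the theorem with the condition number of `T` itself. -/
structure IsApprox (a : ℝ) (M : Matrix (Fin m) (Fin n) ℂ) (T : Triplet m n ℓ q) (w : ℝ) :
    Prop where
  reg : IsRegular T.σ
  defectU : (kappa T.σ * bigK T.σ) ^ a * matNorm (stiefelDefect T.U) ≤ w
  defectV : (kappa T.σ * bigK T.σ) ^ a * matNorm (stiefelDefect T.V) ≤ w
  residual : kappa T.σ ^ a * bigK T.σ ^ (a - 1) * matNorm (residual M T) ≤ w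

/-- What is needed of a step from `T` to `T'`: the new defects, the corrections of `U` and `V` as
right factors `1 + Γ`, and a change of `Σ` which is small compared with the gaps. -/
structure IsGoodStep (a g w w' : ℝ) (M : Matrix (Fin m) (Fin n) ℂ) (T T' : Triplet m n ℓ q) :
    Prop where
  approx : IsApprox a M T' w'
  factorU : ∃ Γ : Matrix (Fin ℓ) (Fin ℓ) ℂ, T'.U = T.U * (1 + Γ) ∧ matNorm Γ ≤ g * w
  factorV : ∃ Γ : Matrix (Fin q) (Fin q) ℂ, T'.V = T.V * (1 + Γ) ∧ matNorm Γ ≤ g * w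
  sigma : ∀ i, 2 * (kappa T.σ * |T'.σ i - T.σ i|) < 1

lemma kappa_mul_bigK_pos (σ : Fin q → ℝ) : 0 < kappa σ * bigK σ :=
  mul_pos (kappa_pos σ) (zero_lt_one.trans_le (one_le_bigK σ))

lemma one_le_kappa_mul_bigK (σ : Fin q → ℝ) : 1 ≤ kappa σ * bigK σ :=
  one_le_mul_of_one_le_of_one_le (one_le_kappa σ) (one_le_bigK σ)

lemma kappa_bigK_rpow (σ : Fin q → ℝ) (a : ℝ) :
    (kappa σ * bigK σ) ^ a = kappa σ * bigK σ * (kappa σ * bigK σ) ^ (a - 1) := by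
  have h := kappa_mul_bigK_pos σ
  conv_lhs => rw [show a = 1 + (a - 1) by ring, Real.rpow_add h, Real.rpow_one]

lemma kappa_rpow_mul_bigK_rpow (σ : Fin q → ℝ) (a : ℝ) :
    kappa σ ^ a * bigK σ ^ (a - 1) = kappa σ * (kappa σ * bigK σ) ^ (a - 1) := by
  have h := kappa_pos σ
  have hK : 0 < bigK σ := zero_lt_one.trans_le (one_le_bigK σ)
  rw [Real.mul_rpow h.le hK.le, ← mul_assoc]
  congr 1
  conv_lhs => rw [show a = 1 + (a - 1) by ring, Real.rpow_add h, Real.rpow_one]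

lemma stiefelDefect_conjTranspose {r k : ℕ} (U : Matrix (Fin r) (Fin k) ℂ) :
    (stiefelDefect U)ᴴ = stiefelDefect U := by
  simp [stiefelDefect]

/-- The defect of `U (1 + Ω) (1 + Θ)`. -/
lemma stiefelDefect_mul_mul {r k : ℕ} (U : Matrix (Fin r) (Fin k) ℂ)
    {Ω : Matrix (Fin k) (Fin k) ℂ} (hΩ : Ωᴴ = Ω) (Θ : Matrix (Fin k) (Fin k) ℂ) :
    stiefelDefect (U * (1 + Ω) * (1 + Θ)) = ((1 + Θᴴ) * (1 + Θ) - 1)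
      + (1 + Θᴴ) * ((1 + Ω) * (1 + stiefelDefect U) * (1 + Ω) - 1) * (1 + Θ) := by
  have h1 : 1 + stiefelDefect U = Uᴴ * U := by rw [stiefelDefect]; abel
  have h2 : (1 + Θᴴ) * ((1 + Ω) * (Uᴴ * U) * (1 + Ω) - 1) * (1 + Θ)
      = (1 + Θᴴ) * ((1 + Ω) * (Uᴴ * U) * (1 + Ω)) * (1 + Θ) - (1 + Θᴴ) * (1 + Θ) := by
    rw [Matrix.mul_sub, Matrix.sub_mul, Matrix.mul_one]
  rw [h1, h2, stiefelDefect]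
  simp only [Matrix.conjTranspose_mul, Matrix.conjTranspose_add, Matrix.conjTranspose_one, hΩ,
    Matrix.mul_assoc]
  abel

lemma matNorm_stiefelDefect_mul_mul_le {r k p : ℕ} (hp : 1 ≤ p) (U : Matrix (Fin r) (Fin k) ℂ)
    {X : Matrix (Fin k) (Fin k) ℂ} {x e D : ℝ} (hx : x ≤ 1 / 2) (hX : matNorm X ≤ x)
    (he : matNorm (stiefelDefect U) ≤ e) (he1 : e < 1)
    (hD : matNorm ((1 + (cPoly p X)ᴴ) * (1 + cPoly p X) - 1) ≤ D) :
    matNorm (stiefelDefect (U * (1 + sPoly p (stiefelDefect U)) * (1 + cPoly p X)))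
      ≤ D + (1 + (x + x ^ 2)) * (e ^ (p + 1) / (1 - e)) * (1 + (x + x ^ 2)) := by
  rw [stiefelDefect_mul_mul U (sPoly_conjTranspose p (stiefelDefect_conjTranspose U))]
  have hc := matNorm_cPoly_le hp hx hX
  exact matNorm_add_le hD (matNorm_mul_le (matNorm_mul_le
    (matNorm_add_le matNorm_one_le (by rwa [matNorm_conjTranspose]))
    (matNorm_invSqrt_error_le hp he he1)) (matNorm_add_le matNorm_one_le hc))

/-- `Δ_1 + Σ = (1 + Ω) (Δ + Σ) (1 + Λ)`. -/
noncomputable def startMatrix (p : ℕ) (M : Matrix (Fin m) (Fin n) ℂ) (T : Triplet m n ℓ q) :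
    Matrix (Fin ℓ) (Fin q) ℂ :=
  (1 + sPoly p (stiefelDefect T.U)) * (residual M T + rectDiag ℓ T.σ)
    * (1 + sPoly p (stiefelDefect T.V))

lemma residual_mapH (p : ℕ) (h : q ≤ ℓ) (M : Matrix (Fin m) (Fin n) ℂ) (T : Triplet m n ℓ q) :
    residual M (mapH p h M T) = innerDelta p h T.σ (startMatrix p M T) p := by
  have h1 : residual M T + rectDiag ℓ T.σ = T.Uᴴ * M * T.V := by rw [residual]; abel
  rw [innerDelta, innerResidual, startMatrix, h1, residual]
  simp only [mapH, h1, Matrix.conjTranspose_mul, Matrix.conjTranspose_add,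
    Matrix.conjTranspose_one, sPoly_conjTranspose p (stiefelDefect_conjTranspose T.U),
    Matrix.mul_assoc, rectDiag_add, sub_sub]

/-- The first residual of the inner iteration, in units of `κ (κ K)^{a-1}`. -/
lemma scaledDelta_zero_le {p : ℕ} {h : q ≤ ℓ} {M : Matrix (Fin m) (Fin n) ℂ}
    {T : Triplet m n ℓ q} {s w e e₀ : ℝ} (hs : 0 ≤ s) (hw : 0 ≤ w)
    (hU : matNorm (stiefelDefect T.U) ≤ e)
    (hV : matNorm (stiefelDefect T.V) ≤ e) (he₀ : e ≤ e₀) (he1 : e₀ < 1)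
    (he : kappa T.σ * bigK T.σ * s * e ≤ w)
    (hd : kappa T.σ * s * matNorm (residual M T) ≤ w) :
    s * scaledDelta p h T.σ (startMatrix p M T) 0
      ≤ ((1 + 1 / 2 * (e₀ / (1 - e₀))) ^ 2 + 1 / (1 - e₀) + 1 / 4 * (e₀ / (1 - e₀) ^ 2)) * w := by
  have hκ := kappa_pos T.σ
  have hK := one_le_bigK T.σ
  have he0 : 0 ≤ e := (matNorm_nonneg _).trans hU
  set R := rectDiag ℓ T.σ
  set Ω := sPoly p (stiefelDefect T.U)
  set Λ := sPoly p (stiefelDefect T.V)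
  set η := 1 / 2 * (e / (1 - e)) with hη
  set η₀ := 1 / 2 * (e₀ / (1 - e₀)) with hη₀
  have hηη : η ≤ η₀ := by
    have : 0 ≤ e₀ := he0.trans he₀
    rw [hη, hη₀]; gcongr
  have hη0 : 0 ≤ η := mul_nonneg (by norm_num) (div_nonneg he0 (by linarith))
  have hΩ : matNorm Ω ≤ η := matNorm_sPoly_le p hU (by linarith)
  have hΛ : matNorm Λ ≤ η := matNorm_sPoly_le p hV (by linarith)
  have hR : matNorm R ≤ bigK T.σ := matNorm_rectDiag_le (by linarith) (abs_le_bigK T.σ)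
  have e1 : startMatrix p M T - R
      = (1 + Ω) * residual M T * (1 + Λ) + (Ω * R + R * Λ + Ω * R * Λ) := by
    rw [startMatrix]
    simp only [Matrix.add_mul, Matrix.mul_add, Matrix.one_mul, Matrix.mul_one]
    abel
  have n1 : matNorm (startMatrix p M T - R)
      ≤ (1 + η) * matNorm (residual M T) * (1 + η)
        + (η * bigK T.σ + bigK T.σ * η + η * bigK T.σ * η) := by
    rw [e1]
    exact matNorm_add_le (matNorm_mul_le (matNorm_mul_le (matNorm_add_le matNorm_one_le hΩ) le_rfl)
      (matNorm_add_le matNorm_one_le hΛ)) (matNorm_add_le (matNorm_add_le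
      (matNorm_mul_le hΩ hR) (matNorm_mul_le hR hΛ)) (matNorm_mul_le (matNorm_mul_le hΩ hR) hΛ))
  rw [scaledDelta, innerDelta_zero]
  have h2 : kappa T.σ * bigK T.σ * s * (2 * η) ≤ 1 / (1 - e₀) * w := by
    have : kappa T.σ * bigK T.σ * s * (2 * η)
        = kappa T.σ * bigK T.σ * s * e * (1 / (1 - e)) := by rw [hη]; ring
    rw [this, mul_comm (1 / (1 - e₀))]
    have h3 : 1 / (1 - e) ≤ 1 / (1 - e₀) := one_div_le_one_div_of_le (by linarith) (by linarith)
    exact mul_le_mul he h3 (one_div_nonneg.2 (by linarith)) hw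
  have h3 : kappa T.σ * bigK T.σ * s * (η * η) ≤ 1 / 4 * (e₀ / (1 - e₀) ^ 2) * w := by
    have : kappa T.σ * bigK T.σ * s * (η * η)
        = kappa T.σ * bigK T.σ * s * e * (1 / 4 * (e / (1 - e) ^ 2)) := by
      have hne : 1 - e ≠ 0 := by linarith
      rw [hη]; field_simp; ring
    rw [this, mul_comm (1 / 4 * (e₀ / (1 - e₀) ^ 2))]
    have h3 : 1 / 4 * (e / (1 - e) ^ 2) ≤ 1 / 4 * (e₀ / (1 - e₀) ^ 2) := by
      have : 0 ≤ e₀ := he0.trans he₀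
      gcongr
    exact mul_le_mul he h3 (by positivity) hw
  have h4 : kappa T.σ * s * matNorm (residual M T) * ((1 + η) * (1 + η)) ≤ w * (1 + η₀) ^ 2 := by
    rw [sq]
    have : 0 ≤ 1 + η₀ := by linarith
    exact mul_le_mul hd (by gcongr) (by positivity) hw
  have h5 := mul_le_mul_of_nonneg_left n1 (mul_nonneg hs hκ.le)
  calc s * (kappa T.σ * matNorm (startMatrix p M T - R))
      = s * kappa T.σ * matNorm (startMatrix p M T - R) := by ring
    _ ≤ _ := h5
    _ = kappa T.σ * s * matNorm (residual M T) * ((1 + η) * (1 + η))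
        + kappa T.σ * bigK T.σ * s * (2 * η) + kappa T.σ * bigK T.σ * s * (η * η) := by ring
    _ ≤ w * (1 + η₀) ^ 2 + 1 / (1 - e₀) * w + 1 / 4 * (e₀ / (1 - e₀) ^ 2) * w :=
        add_le_add (add_le_add h4 h2) h3
    _ = _ := by ring

lemma matNorm_factor_le {k p : ℕ} (hp : 1 ≤ p) {E X : Matrix (Fin k) (Fin k) ℂ}
    {w x x₁ : ℝ} (hw : w ≤ 1 / 20) (hE : matNorm E ≤ w) (hX : matNorm X ≤ x) (hx : x ≤ 69 / 500)
    (hx₁ : x ≤ x₁ * w) :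
    ∃ Γ : Matrix (Fin k) (Fin k) ℂ, (1 + sPoly p E) * (1 + cPoly p X) = 1 + Γ
      ∧ matNorm Γ ≤ (53 / 100 + 117 / 100 * x₁) * w := by
  have hw0 : 0 ≤ w := (matNorm_nonneg _).trans hE
  have hx0 : 0 ≤ x := (matNorm_nonneg _).trans hX
  refine ⟨sPoly p E + (1 + sPoly p E) * cPoly p X, by noncomm_ring, ?_⟩
  have hs : matNorm (sPoly p E) ≤ 53 / 100 * w := by
    refine (matNorm_sPoly_le p hE (by linarith)).trans ?_
    have : w / (1 - w) ≤ 106 / 100 * w := by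
      rw [div_le_iff₀ (by linarith)]; nlinarith
    linarith
  refine (matNorm_add_le hs (matNorm_mul_le (matNorm_add_le matNorm_one_le hs)
    (matNorm_cPoly_le hp (by linarith) hX))).trans ?_
  have h1 : (1 + 53 / 100 * w) * (x + x ^ 2) ≤ 117 / 100 * x := by
    calc (1 + 53 / 100 * w) * (x + x ^ 2) = ((1 + 53 / 100 * w) * (1 + x)) * x := by ring
      _ ≤ ((1 + 53 / 100 * (1 / 20)) * (1 + 69 / 500)) * x := by gcongr
      _ ≤ _ := by nlinarith
  linarith

/-- Bounds on the inner iteration make `H_p` a good step. Here `μ` bounds `κ` times the sum of the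
inner residuals, `c` is the constant of `kappa_perturb`, `x` bounds the skew Hermitian corrections,
`D` the failure of `1 + c_p(X)` and `1 + c_p(Y)` to be unitary, and `g₁`, `g₃` control the growth
of `κ` and of `(κ K)^{a-1}`. -/
lemma isGoodStep_mapH {p : ℕ} (hp : 1 ≤ p) {h : q ≤ ℓ} {M : Matrix (Fin m) (Fin n) ℂ}
    {T : Triplet m n ℓ q} {a w w' c μ x x₁ D Z g₁ g₃ : ℝ} (ha : 1 ≤ a)
    (hT : IsApprox a M T w) (hw : w ≤ 1 / 20)
    (hc1 : 1 ≤ c) (hc : q = 1 ∨ 2 ≤ c)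
    (hμ : ∑ j ∈ Finset.range p, scaledDelta p h T.σ (startMatrix p M T) j ≤ μ)
    (hcμ : c * μ < 1) (hμ2 : 2 * μ < 1)
    (hX : matNorm (correction p h T.σ (startMatrix p M T) p).X ≤ x)
    (hY : matNorm (correction p h T.σ (startMatrix p M T) p).Y ≤ x)
    (hx : x ≤ 69 / 500) (hx₁ : x ≤ x₁ * w)
    (hDX : matNorm ((1 + (cPoly p (correction p h T.σ (startMatrix p M T) p).X)ᴴ)
      * (1 + cPoly p (correction p h T.σ (startMatrix p M T) p).X) - 1) ≤ D)
    (hDY : matNorm ((1 + (cPoly p (correction p h T.σ (startMatrix p M T) p).Y)ᴴ)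
      * (1 + cPoly p (correction p h T.σ (startMatrix p M T) p).Y) - 1) ≤ D)
    (hZ : (kappa T.σ * bigK T.σ) ^ a * D ≤ Z)
    (hg₁ : 1 / (1 - c * μ) ≤ g₁) (hg₃ : ((1 + μ) * g₁) ^ (a - 1) ≤ g₃)
    (hdefect : (Z + 3 / 2 * w ^ (p + 1)) * ((1 + μ) * g₁ * g₃) ≤ w')
    (hres : (kappa T.σ * bigK T.σ) ^ (a - 1) *
      scaledDelta p h T.σ (startMatrix p M T) p * (g₁ * g₃) ≤ w') :
    IsGoodStep a (53 / 100 + 117 / 100 * x₁) w w' M T (mapH p h M T) := by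
  set κ := kappa T.σ with hκdef
  set K := bigK T.σ with hKdef
  set S := (correction p h T.σ (startMatrix p M T) p).S with hSdef
  set X := (correction p h T.σ (startMatrix p M T) p).X with hXdef
  set Y := (correction p h T.σ (startMatrix p M T) p).Y with hYdef
  have hκ : 0 < κ := kappa_pos _
  have hκ1 : 1 ≤ κ := one_le_kappa _
  have hK1 : 1 ≤ K := one_le_bigK _
  have hy : 1 ≤ κ * K := one_le_kappa_mul_bigK _
  have hya : 1 ≤ (κ * K) ^ a := Real.one_le_rpow hy (by linarith)
  have hw0 : 0 ≤ w := (mul_nonneg (by positivity) (matNorm_nonneg _)).trans hT.defectU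
  have hEU : matNorm (stiefelDefect T.U) ≤ w :=
    (le_mul_of_one_le_left (matNorm_nonneg _) hya).trans hT.defectU
  have hEV : matNorm (stiefelDefect T.V) ≤ w :=
    (le_mul_of_one_le_left (matNorm_nonneg _) hya).trans hT.defectV
  have hx0 : 0 ≤ x := (matNorm_nonneg _).trans hX
  have hμ0 : 0 ≤ μ := (Finset.sum_nonneg fun j _ => scaledDelta_nonneg j).trans hμ
  have hS : ∀ i, κ * |S i| ≤ μ := fun i => (kappa_mul_abs_correction_S_le p i).trans hμ
  have hσ' : (mapH p h M T).σ = T.σ + S := rfl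
  have hU' : (mapH p h M T).U = T.U * (1 + sPoly p (stiefelDefect T.U)) * (1 + cPoly p X) := rfl
  have hV' : (mapH p h M T).V = T.V * (1 + sPoly p (stiefelDefect T.V)) * (1 + cPoly p Y) := rfl
  obtain ⟨hreg, hκ', hK'⟩ := kappa_perturb (σ' := (mapH p h M T).σ) (S := μ / κ) hT.reg hc1 hc
    (fun i => by
      rw [hσ', Pi.add_apply, add_sub_cancel_left, le_div_iff₀ hκ, mul_comm]; exact hS i)
    hμ0 (by rw [← hκdef, mul_div_cancel₀ _ hκ.ne']) hcμ
  set κ' := kappa (mapH p h M T).σ with hκ'def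
  set K' := bigK (mapH p h M T).σ with hK'def
  have hκ'1 : 1 ≤ κ' := one_le_kappa _
  have hK'1 : 1 ≤ K' := one_le_bigK _
  have hg₁0 : 0 < g₁ := (one_div_pos.2 (by linarith)).trans_le hg₁
  have hκ'' : κ' ≤ κ * g₁ := hκ'.trans (by
    rw [div_eq_mul_one_div]; exact mul_le_mul_of_nonneg_left hg₁ hκ.le)
  have hy' : κ' * K' ≤ κ * K * ((1 + μ) * g₁) := by
    calc κ' * K' ≤ (κ * g₁) * (K * (1 + μ)) := mul_le_mul hκ'' hK' (by linarith) (by positivity)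
      _ = _ := by ring
  have hs' : (κ' * K') ^ (a - 1) ≤ (κ * K) ^ (a - 1) * g₃ := by
    calc (κ' * K') ^ (a - 1) ≤ (κ * K * ((1 + μ) * g₁)) ^ (a - 1) :=
          Real.rpow_le_rpow (by positivity) hy' (by linarith)
      _ = (κ * K) ^ (a - 1) * ((1 + μ) * g₁) ^ (a - 1) :=
          Real.mul_rpow (by positivity) (by positivity)
      _ ≤ _ := by gcongr
  have hg₃0 : 0 ≤ g₃ := (by positivity : (0 : ℝ) ≤ ((1 + μ) * g₁) ^ (a - 1)).trans hg₃
  set s := (κ * K) ^ (a - 1) with hsdef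
  have hs1 : 1 ≤ s := Real.one_le_rpow hy (by linarith)
  have hya_eq : (κ * K) ^ a = κ * K * s := kappa_bigK_rpow _ a
  have hya' : (κ' * K') ^ a ≤ (κ * K) ^ a * ((1 + μ) * g₁ * g₃) := by
    rw [kappa_bigK_rpow, hya_eq]
    calc κ' * K' * (κ' * K') ^ (a - 1) ≤ (κ * K * ((1 + μ) * g₁)) * (s * g₃) :=
          mul_le_mul hy' hs' (by positivity) (by positivity)
      _ = _ := by ring
  have hdef : ∀ {r k : ℕ} (U : Matrix (Fin r) (Fin k) ℂ) (X : Matrix (Fin k) (Fin k) ℂ),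
      (κ * K) ^ a * matNorm (stiefelDefect U) ≤ w → matNorm X ≤ x →
      matNorm ((1 + (cPoly p X)ᴴ) * (1 + cPoly p X) - 1) ≤ D →
      (κ' * K') ^ a *
        matNorm (stiefelDefect (U * (1 + sPoly p (stiefelDefect U)) * (1 + cPoly p X))) ≤ w' := by
    intro r k U X hU hX hD
    set e := matNorm (stiefelDefect U)
    have he0 : 0 ≤ e := matNorm_nonneg _
    have hew : e ≤ w := (le_mul_of_one_le_left he0 hya).trans hU
    have h1 := matNorm_stiefelDefect_mul_mul_le hp U (by linarith) hX le_rfl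
      (by linarith : e < 1) hD
    have h2 : (1 + (x + x ^ 2)) * (e ^ (p + 1) / (1 - e)) * (1 + (x + x ^ 2))
        ≤ 3 / 2 * e ^ (p + 1) := by
      have h3 : 1 + (x + x ^ 2) ≤ 116 / 100 := by nlinarith
      have h4 : 1 / (1 - e) ≤ 20 / 19 := by
        rw [div_le_div_iff₀ (by linarith) (by norm_num)]; linarith
      have h5 : 0 ≤ 1 / (1 - e) := one_div_nonneg.2 (by linarith)
      calc _ = e ^ (p + 1) * ((1 + (x + x ^ 2)) * (1 + (x + x ^ 2)) * (1 / (1 - e))) := by ring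
        _ ≤ e ^ (p + 1) * ((116 / 100) * (116 / 100) * (20 / 19)) := by gcongr
        _ ≤ e ^ (p + 1) * (3 / 2) := by gcongr; norm_num
        _ = _ := by ring
    have h6 : (κ * K) ^ a * (3 / 2 * e ^ (p + 1)) ≤ 3 / 2 * w ^ (p + 1) := by
      calc (κ * K) ^ a * (3 / 2 * e ^ (p + 1)) = 3 / 2 * (((κ * K) ^ a * e) * e ^ p) := by ring
        _ ≤ 3 / 2 * (w * w ^ p) := by gcongr
        _ = _ := by ring
    calc _ ≤ ((κ * K) ^ a * ((1 + μ) * g₁ * g₃)) * (D + 3 / 2 * e ^ (p + 1)) :=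
          mul_le_mul hya' (h1.trans (by linarith)) (matNorm_nonneg _) (by positivity)
      _ = ((κ * K) ^ a * D + (κ * K) ^ a * (3 / 2 * e ^ (p + 1))) * ((1 + μ) * g₁ * g₃) := by ring
      _ ≤ (Z + 3 / 2 * w ^ (p + 1)) * ((1 + μ) * g₁ * g₃) := by gcongr
      _ ≤ w' := hdefect
  refine ⟨⟨hreg, hdef _ _ hT.defectU hX hDX, hdef _ _ hT.defectV hY hDY, ?_⟩, ?_, ?_, ?_⟩
  · rw [kappa_rpow_mul_bigK_rpow, residual_mapH, matNorm_innerDelta]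
    calc κ' * (κ' * K') ^ (a - 1) * (scaledDelta p h T.σ (startMatrix p M T) p / κ)
        ≤ (κ * g₁) * (s * g₃) * (scaledDelta p h T.σ (startMatrix p M T) p / κ) := by
          have := scaledDelta_nonneg (p := p) (h := h) (σ := T.σ) (W := startMatrix p M T) p
          gcongr
      _ = s * scaledDelta p h T.σ (startMatrix p M T) p * (g₁ * g₃) := by field_simp
      _ ≤ w' := hres
  · obtain ⟨Γ, h1, h2⟩ := matNorm_factor_le hp hw hEU hX hx hx₁
    exact ⟨Γ, by rw [hU', Matrix.mul_assoc, h1], h2⟩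
  · obtain ⟨Γ, h1, h2⟩ := matNorm_factor_le hp hw hEV hY hx hx₁
    exact ⟨Γ, by rw [hV', Matrix.mul_assoc, h1], h2⟩
  · intro i
    rw [hσ', Pi.add_apply, add_sub_cancel_left]
    linarith [hS i]

end Step

/-! ### The order of convergence of one step -/

section Order

variable {m n ℓ q p : ℕ} {h : q ≤ ℓ} {M : Matrix (Fin m) (Fin n) ℂ} {T : Triplet m n ℓ q}

lemma IsApprox.nonneg {a w : ℝ} (hT : IsApprox a M T w) : 0 ≤ w :=
  (mul_nonneg (Real.rpow_nonneg (kappa_mul_bigK_pos _).le _) (matNorm_nonneg _)).trans hT.defectU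

lemma IsApprox.scaledDelta_zero_le {a w u b e₀ Y₀ : ℝ} (ha : 1 ≤ a) (hT : IsApprox a M T w)
    (hw : w ≤ u) (hY₀ : Y₀ ≤ kappa T.σ * bigK T.σ * (kappa T.σ * bigK T.σ) ^ (a - 1))
    (hY₀0 : 0 < Y₀) (hu : u ≤ e₀ * Y₀) (he₀ : e₀ < 1)
    (hb : (1 + 1 / 2 * (e₀ / (1 - e₀))) ^ 2 + 1 / (1 - e₀) + 1 / 4 * (e₀ / (1 - e₀) ^ 2) ≤ b) :
    (kappa T.σ * bigK T.σ) ^ (a - 1) * scaledDelta p h T.σ (startMatrix p M T) 0 ≤ b * w := by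
  have hy := one_le_kappa_mul_bigK T.σ
  have hs : 1 ≤ (kappa T.σ * bigK T.σ) ^ (a - 1) := Real.one_le_rpow hy (by linarith)
  have hU := hT.defectU
  have hV := hT.defectV
  have hd := hT.residual
  rw [kappa_bigK_rpow] at hU hV
  rw [kappa_rpow_mul_bigK_rpow] at hd
  have hmax : kappa T.σ * bigK T.σ * (kappa T.σ * bigK T.σ) ^ (a - 1)
      * max (matNorm (stiefelDefect T.U)) (matNorm (stiefelDefect T.V)) ≤ w := by
    rw [mul_max_of_nonneg _ _ (by positivity)]
    exact max_le hU hV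
  have he0 : 0 ≤ max (matNorm (stiefelDefect T.U)) (matNorm (stiefelDefect T.V)) :=
    (matNorm_nonneg _).trans (le_max_left _ _)
  refine (HighOrderSVD.scaledDelta_zero_le (by linarith) hT.nonneg (le_max_left _ _)
    (le_max_right _ _) ?_ he₀ hmax hd).trans (mul_le_mul_of_nonneg_right hb hT.nonneg)
  refine le_of_mul_le_mul_right ?_ hY₀0
  calc _ ≤ max (matNorm (stiefelDefect T.U)) (matNorm (stiefelDefect T.V))
        * (kappa T.σ * bigK T.σ * (kappa T.σ * bigK T.σ) ^ (a - 1)) := by gcongr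
    _ ≤ w := by rw [mul_comm]; exact hmax
    _ ≤ _ := hw.trans hu

/-- The case `p = 1`, with the numerical constants as parameters: `y₀` is a lower bound for `κ K`
and `b w / (κ K)` bounds `κ` times the first inner residual. -/
lemma isGoodStep_of_p_eq_one {w ξ c y₀ e₀ b μ g₁ g₃ : ℝ} (hT : IsApprox 2 M T w)
    (hw : w ≤ 0.0289) (hξ1 : 1 ≤ ξ) (hξ : q = 1 ∨ 3 / 2 ≤ ξ) (hc1 : 1 ≤ c) (hc : q = 1 ∨ 2 ≤ c)
    (hy₀1 : 1 ≤ y₀) (hy₀ : y₀ ≤ kappa T.σ * bigK T.σ) (he₀u : 0.0289 ≤ e₀ * (y₀ * y₀))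
    (he₀ : e₀ < 1)
    (hb : (1 + 1 / 2 * (e₀ / (1 - e₀))) ^ 2 + 1 / (1 - e₀) + 1 / 4 * (e₀ / (1 - e₀) ^ 2) ≤ b)
    (hμ : b * 0.0289 ≤ μ * y₀) (hμ2 : c * μ ≤ 0.12) (hμ3 : ξ * μ ≤ 0.1) (hμ4 : μ ≤ 0.12)
    (hξb : ξ * b ≤ 2.07 * y₀) (hg₁ : 1 / (1 - c * μ) ≤ g₁) (hg₃ : (1 + μ) * g₁ ≤ g₃)
    (hdefect : ((ξ * b) ^ 2 + 3 / 2) * ((1 + μ) * g₁ * g₃) * 0.0578 ≤ 1)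
    (hres : b ^ 2 * ((ξ + 1) / y₀ + ξ + ξ * μ) * (g₁ * g₃) * 0.0578 ≤ 1) :
    IsGoodStep 2 (53 / 100 + 117 / 100 * 2.07) w (w * (w / (2 * 0.0289)) ^ 1) M T
      (mapH 1 h M T) := by
  have hw0 := hT.nonneg
  have hy1 := one_le_kappa_mul_bigK T.σ
  have hs1 : (kappa T.σ * bigK T.σ) ^ ((2 : ℝ) - 1) = kappa T.σ * bigK T.σ := by
    rw [show (2 : ℝ) - 1 = 1 by norm_num, Real.rpow_one]
  have hs2 : (kappa T.σ * bigK T.σ) ^ (2 : ℝ) = (kappa T.σ * bigK T.σ) ^ 2 := by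
    rw [show (2 : ℝ) = (2 : ℕ) by norm_num, Real.rpow_natCast]
  have h0 := hT.scaledDelta_zero_le (p := 1) (h := h) (Y₀ := y₀ * y₀) (by norm_num) hw
    (by rw [hs1]; gcongr) (by positivity) he₀u he₀ hb
  rw [hs1] at h0
  have hμ0' := scaledDelta_nonneg (p := 1) (h := h) (σ := T.σ) (W := startMatrix 1 M T) 0
  have hstep := scaledDelta_one_le_of_p_eq_one (h := h) (W := startMatrix 1 M T) hT.reg hξ1 hξ
  have hX := matNorm_correction_X_le (p := 1) (h := h) (W := startMatrix 1 M T) (σ := T.σ)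
    hξ1 hξ 1
  have hY := matNorm_correction_Y_le (p := 1) (h := h) (W := startMatrix 1 M T) (σ := T.σ) 1
  have hXs := correction_X_skew (p := 1) (h := h) (W := startMatrix 1 M T) (σ := T.σ) 1
  have hYs := correction_Y_skew (p := 1) (h := h) (W := startMatrix 1 M T) (σ := T.σ) 1
  rw [Finset.sum_range_one] at hX hY
  set y := kappa T.σ * bigK T.σ
  set μ₀ := scaledDelta 1 h T.σ (startMatrix 1 M T) 0
  have hb0 : 0 ≤ b := le_trans (by
    have : 0 ≤ e₀ := by
      by_contra hneg
      have : e₀ * (y₀ * y₀) < 0 := mul_neg_of_neg_of_pos (not_le.1 hneg) (by positivity)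
      linarith
    have h1 : 0 < 1 - e₀ := by linarith
    positivity) hb
  have hy₀μ : y₀ * μ₀ ≤ b * w := (mul_le_mul_of_nonneg_right hy₀ hμ0').trans h0
  have hμ₀ : μ₀ ≤ μ := by
    refine le_of_mul_le_mul_right ?_ (by linarith : 0 < y₀)
    calc μ₀ * y₀ ≤ b * w := by rw [mul_comm]; exact hy₀μ
      _ ≤ b * 0.0289 := by gcongr
      _ ≤ _ := hμ
  have hμ0 : 0 ≤ μ := hμ0'.trans hμ₀
  have hg₁0 : 0 < g₁ := (one_div_pos.2 (by linarith)).trans_le hg₁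
  have hg₃0 : 0 < g₃ := (by positivity : 0 < (1 + μ) * g₁).trans_le hg₃
  have hYx : matNorm (correction 1 h T.σ (startMatrix 1 M T) 1).Y ≤ ξ * μ₀ :=
    hY.trans (by nlinarith)
  have hD : ∀ {k : ℕ} {A : Matrix (Fin k) (Fin k) ℂ}, Aᴴ = -A → matNorm A ≤ ξ * μ₀ →
      matNorm ((1 + (cPoly 1 A)ᴴ) * (1 + cPoly 1 A) - 1) ≤ (ξ * μ₀) ^ 2 := by
    intro k A hA hAn
    have : (1 + (cPoly 1 A)ᴴ) * (1 + cPoly 1 A) - 1 = -(A ^ 2) := by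
      rw [cPoly_one, hA]; noncomm_ring
    rw [this, matNorm_neg]
    exact matNorm_pow_le hAn 2
  have hyμ2 : (y * μ₀) ^ 2 ≤ (b * w) ^ 2 := by gcongr
  refine isGoodStep_mapH le_rfl (c := c) (μ := μ) (x := ξ * μ₀) (x₁ := 2.07)
    (D := (ξ * μ₀) ^ 2) (Z := (ξ * b) ^ 2 * w ^ 2) (g₁ := g₁) (g₃ := g₃) (by norm_num) hT
    (by linarith) hc1 hc
    (by rw [Finset.sum_range_one]; exact hμ₀) (by linarith) (by linarith) hX hYx ?_ ?_
    (hD hXs hX) (hD hYs hYx) ?_ hg₁ ?_ ?_ ?_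
  · calc ξ * μ₀ ≤ ξ * μ := by gcongr
      _ ≤ _ := by linarith
  · refine le_of_mul_le_mul_right ?_ (by linarith : 0 < y₀)
    calc ξ * μ₀ * y₀ = ξ * (y₀ * μ₀) := by ring
      _ ≤ ξ * (b * w) := by gcongr
      _ = (ξ * b) * w := by ring
      _ ≤ (2.07 * y₀) * w := by gcongr
      _ = _ := by ring
  · rw [hs2]
    calc y ^ 2 * (ξ * μ₀) ^ 2 = ξ ^ 2 * (y * μ₀) ^ 2 := by ring
      _ ≤ ξ ^ 2 * (b * w) ^ 2 := by gcongr
      _ = _ := by ring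
  · rw [show (2 : ℝ) - 1 = 1 by norm_num, Real.rpow_one]; exact hg₃
  · calc ((ξ * b) ^ 2 * w ^ 2 + 3 / 2 * w ^ (1 + 1)) * ((1 + μ) * g₁ * g₃)
        = ((ξ * b) ^ 2 + 3 / 2) * ((1 + μ) * g₁ * g₃) * 0.0578 * (w ^ 2 / 0.0578) := by ring
      _ ≤ 1 * (w ^ 2 / 0.0578) := by gcongr
      _ = _ := by ring
  · rw [hs1]
    have h1 : y * scaledDelta 1 h T.σ (startMatrix 1 M T) 1
        ≤ (b * w) ^ 2 * ((ξ + 1) / y₀ + ξ + ξ * μ) := by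
      have hd : (ξ + 1) / y ≤ (ξ + 1) / y₀ := by gcongr
      have hm : ξ * μ₀ / y ≤ ξ * μ := by
        rw [div_le_iff₀ (by linarith)]
        calc ξ * μ₀ ≤ ξ * μ := by gcongr
          _ ≤ ξ * μ * y := le_mul_of_one_le_right (by positivity) hy1
      calc y * scaledDelta 1 h T.σ (startMatrix 1 M T) 1
          ≤ y * (μ₀ ^ 2 * (ξ + 1 + ξ * (y + μ₀))) := by gcongr
        _ = (y * μ₀) ^ 2 * ((ξ + 1) / y + ξ + ξ * μ₀ / y) := by
            have : y ≠ 0 := by linarith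
            field_simp
            ring
        _ ≤ _ := by gcongr
    calc _ ≤ (b * w) ^ 2 * ((ξ + 1) / y₀ + ξ + ξ * μ) * (g₁ * g₃) := by gcongr
      _ = b ^ 2 * ((ξ + 1) / y₀ + ξ + ξ * μ) * (g₁ * g₃) * 0.0578 * (w ^ 2 / 0.0578) := by ring
      _ ≤ 1 * (w ^ 2 / 0.0578) := by gcongr
      _ = _ := by ring

/-- The case `p ≥ 2`, given the outcome of the inner iteration: the sum of the inner residuals is
at most `C` times the first, and the last one at most `P τ^p` times the first, `τ = w / u`. -/
lemma isGoodStep_of_two_le {w u ξ c b C P μ g₁ g₃ : ℝ} (hp : 2 ≤ p) (hT : IsApprox (4 / 3) M T w)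
    (hu0 : 0 < u) (hu : u ≤ 1 / 20) (hw : w ≤ u)
    (hξ1 : 1 ≤ ξ) (hξ : q = 1 ∨ 3 / 2 ≤ ξ) (hc1 : 1 ≤ c) (hc : q = 1 ∨ 2 ≤ c)
    (hC : 0 ≤ C) (hP : 0 ≤ P) (hb : 0 ≤ b)
    (hs : (kappa T.σ * bigK T.σ) ^ ((4 / 3 : ℝ) - 1) *
      scaledDelta p h T.σ (startMatrix p M T) 0 ≤ b * w)
    (hsum : ∑ j ∈ Finset.range p, scaledDelta p h T.σ (startMatrix p M T) j
      ≤ C * scaledDelta p h T.σ (startMatrix p M T) 0)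
    (hlast : scaledDelta p h T.σ (startMatrix p M T) p
      ≤ scaledDelta p h T.σ (startMatrix p M T) 0 * (P * (w / u) ^ p))
    (hμ : C * scaledDelta p h T.σ (startMatrix p M T) 0 ≤ μ)
    (hcμ : c * μ ≤ 1 / 5) (hμ2 : μ ≤ 1 / 5) (hξμ : ξ * μ ≤ 69 / 500)
    (hx₁ : ξ * C * b ≤ 4.04)
    (hg₁ : 1 / (1 - c * μ) ≤ g₁) (hg₃0 : 0 ≤ g₃) (hg₃ : (1 + μ) * g₁ ≤ g₃ ^ 3)
    (hdefect : (3 * (ξ * C * b * u) ^ (2 * (p / 2) + 2) + 3 / 2 * u ^ (p + 1))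
      * ((1 + μ) * g₁ * g₃) ≤ u * (1 / 2) ^ p)
    (hres : b * P * (g₁ * g₃) ≤ (1 / 2) ^ p) :
    IsGoodStep (4 / 3) (53 / 100 + 117 / 100 * 4.04) w (w * (w / (2 * u)) ^ p) M T
      (mapH p h M T) := by
  have hw0 := hT.nonneg
  have hy1 := one_le_kappa_mul_bigK T.σ
  have hs1 : 1 ≤ (kappa T.σ * bigK T.σ) ^ ((4 / 3 : ℝ) - 1) :=
    Real.one_le_rpow hy1 (by norm_num)
  have hs3 : ((kappa T.σ * bigK T.σ) ^ ((4 / 3 : ℝ) - 1)) ^ 3 = kappa T.σ * bigK T.σ := by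
    rw [← Real.rpow_natCast, ← Real.rpow_mul (by linarith)]
    norm_num
  have hya := kappa_bigK_rpow T.σ (4 / 3)
  have hX := matNorm_correction_X_le (p := p) (h := h) (W := startMatrix p M T) (σ := T.σ)
    hξ1 hξ p
  have hY := matNorm_correction_Y_le (p := p) (h := h) (W := startMatrix p M T) (σ := T.σ) p
  have hXs := correction_X_skew (p := p) (h := h) (W := startMatrix p M T) (σ := T.σ) p
  have hYs := correction_Y_skew (p := p) (h := h) (W := startMatrix p M T) (σ := T.σ) p
  have hμ0' := scaledDelta_nonneg (p := p) (h := h) (σ := T.σ) (W := startMatrix p M T) 0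
  set y := kappa T.σ * bigK T.σ
  set s := y ^ ((4 / 3 : ℝ) - 1)
  set μ₀ := scaledDelta p h T.σ (startMatrix p M T) 0
  have hμ0 : 0 ≤ μ := (by positivity : 0 ≤ C * μ₀).trans hμ
  have hg₁0 : 0 < g₁ := (one_div_pos.2 (by linarith)).trans_le hg₁
  set x := ξ * (C * μ₀) with hx
  have hx0 : 0 ≤ x := by positivity
  have hXx : matNorm (correction p h T.σ (startMatrix p M T) p).X ≤ x :=
    hX.trans (by rw [hx]; gcongr)
  have hYx : matNorm (correction p h T.σ (startMatrix p M T) p).Y ≤ x :=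
    (hY.trans hsum).trans (le_mul_of_one_le_left (by positivity) hξ1)
  have hxμ : x ≤ 69 / 500 := le_trans (by rw [hx]; gcongr) hξμ
  have hsx : s * x ≤ ξ * C * b * w := by
    calc s * x = ξ * C * (s * μ₀) := by rw [hx]; ring
      _ ≤ ξ * C * (b * w) := by gcongr
      _ = _ := by ring
  have hτ0 : 0 ≤ w / u := by positivity
  have hτ1 : w / u ≤ 1 := (div_le_one hu0).2 hw
  have hwu : w = u * (w / u) := by field_simp
  refine isGoodStep_mapH (by omega) (c := c) (μ := μ) (x := x) (x₁ := 4.04)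
    (D := 3 * (x ^ 2) ^ (p / 2 + 1)) (Z := 3 * (ξ * C * b * w) ^ (2 * (p / 2) + 2)) (g₁ := g₁)
    (g₃ := g₃) (by norm_num) hT (by linarith) hc1 hc (hsum.trans hμ) (by linarith) (by linarith)
    hXx hYx hxμ ?_
    (matNorm_cPoly_unitary_error_le hp hXs (by linarith) hXx)
    (matNorm_cPoly_unitary_error_le hp hYs (by linarith) hYx) ?_ hg₁ ?_ ?_ ?_
  · calc x ≤ s * x := le_mul_of_one_le_left hx0 hs1
      _ ≤ ξ * C * b * w := hsx
      _ ≤ _ := by gcongr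
  · have hy4 : y ^ (4 / 3 : ℝ) = s ^ 4 := by rw [hya, pow_succ s 3, hs3]
    rw [hy4, ← pow_mul, show 2 * (p / 2 + 1) = 2 * (p / 2) + 2 by ring]
    calc s ^ 4 * (3 * x ^ (2 * (p / 2) + 2))
        ≤ s ^ (2 * (p / 2) + 2) * (3 * x ^ (2 * (p / 2) + 2)) := by
          gcongr
          omega
      _ = 3 * (s * x) ^ (2 * (p / 2) + 2) := by rw [mul_pow]; ring
      _ ≤ _ := by gcongr
  · calc ((1 + μ) * g₁) ^ ((4 / 3 : ℝ) - 1) ≤ (g₃ ^ 3) ^ ((4 / 3 : ℝ) - 1) :=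
          Real.rpow_le_rpow (by positivity) hg₃ (by norm_num)
      _ = g₃ := by
          rw [← Real.rpow_natCast, ← Real.rpow_mul hg₃0]; norm_num
  · have h1 : (ξ * C * b * w) ^ (2 * (p / 2) + 2)
        ≤ (ξ * C * b * u) ^ (2 * (p / 2) + 2) * (w / u) ^ (p + 1) := by
      have e : ξ * C * b * w = (ξ * C * b * u) * (w / u) := by field_simp
      rw [e, mul_pow]
      gcongr ?_ * ?_
      exact pow_le_pow_of_le_one hτ0 hτ1 (by omega)
    have h2 : w ^ (p + 1) = u ^ (p + 1) * (w / u) ^ (p + 1) := by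
      rw [← mul_pow, ← hwu]
    have h3 : 0 ≤ (1 + μ) * g₁ * g₃ := by positivity
    calc (3 * (ξ * C * b * w) ^ (2 * (p / 2) + 2) + 3 / 2 * w ^ (p + 1)) * ((1 + μ) * g₁ * g₃)
        ≤ (3 * ((ξ * C * b * u) ^ (2 * (p / 2) + 2) * (w / u) ^ (p + 1))
          + 3 / 2 * (u ^ (p + 1) * (w / u) ^ (p + 1))) * ((1 + μ) * g₁ * g₃) := by
          rw [h2]; gcongr
      _ = (3 * (ξ * C * b * u) ^ (2 * (p / 2) + 2) + 3 / 2 * u ^ (p + 1))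
          * ((1 + μ) * g₁ * g₃) * (w / u) ^ (p + 1) := by ring
      _ ≤ u * (1 / 2) ^ p * (w / u) ^ (p + 1) := by gcongr
      _ = u * (w / u) * ((1 / 2) ^ p * (w / u) ^ p) := by rw [pow_succ]; ring
      _ = _ := by rw [← hwu, ← mul_pow]; congr 2; field_simp
  · have hg0 : 0 ≤ g₁ * g₃ := by positivity
    calc s * scaledDelta p h T.σ (startMatrix p M T) p * (g₁ * g₃)
        ≤ s * (μ₀ * (P * (w / u) ^ p)) * (g₁ * g₃) := by gcongr
      _ = (s * μ₀) * (P * (w / u) ^ p * (g₁ * g₃)) := by ring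
      _ ≤ (b * w) * (P * (w / u) ^ p * (g₁ * g₃)) := by gcongr
      _ = b * P * (g₁ * g₃) * (w * (w / u) ^ p) := by ring
      _ ≤ (1 / 2) ^ p * (w * (w / u) ^ p) := by gcongr
      _ = w * ((1 / 2) ^ p * (w / u) ^ p) := by ring
      _ = _ := by rw [← mul_pow]; congr 2; field_simp

end Order

/-! ### The numerical constants -/

section Constants

variable {m n ℓ q p : ℕ} {h : q ≤ ℓ} {M : Matrix (Fin m) (Fin n) ℂ} {T : Triplet m n ℓ q}

lemma kappa_bigK_rpow_third_pow (σ : Fin q → ℝ) :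
    ((kappa σ * bigK σ) ^ ((4 / 3 : ℝ) - 1)) ^ 3 = kappa σ * bigK σ := by
  rw [← Real.rpow_natCast, ← Real.rpow_mul (kappa_mul_bigK_pos σ).le]
  norm_num

lemma le_kappa_bigK_rpow_third {σ : Fin q → ℝ} {s₀ : ℝ}
    (h : s₀ ^ 3 ≤ kappa σ * bigK σ) : s₀ ≤ (kappa σ * bigK σ) ^ ((4 / 3 : ℝ) - 1) := by
  rw [← kappa_bigK_rpow_third_pow] at h
  exact le_of_pow_le_pow_left₀ (by norm_num)
    (Real.rpow_nonneg (kappa_mul_bigK_pos σ).le _) h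

/-- The inner residuals enter `stepFactor` through `m₀ ≤ G τ` and through the product `k m^3`. The
latter stays bounded however large `κ K` is. This is what the exponent `a = 4 / 3` is made for. -/
lemma scaledDelta_zero_bounds {w u b G s₀ : ℝ} (hu : 0 < u) (hw0 : 0 ≤ w) (hw : w ≤ u)
    (hs₀0 : 0 < s₀) (hs₀ : s₀ ≤ (kappa T.σ * bigK T.σ) ^ ((4 / 3 : ℝ) - 1))
    (hG : b * u ≤ G * s₀) (hb : 0 ≤ b)
    (hs : (kappa T.σ * bigK T.σ) ^ ((4 / 3 : ℝ) - 1) *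
      scaledDelta p h T.σ (startMatrix p M T) 0 ≤ b * w) :
    scaledDelta p h T.σ (startMatrix p M T) 0 ≤ G * (w / u) ∧
    (kappa T.σ * bigK T.σ + scaledDelta p h T.σ (startMatrix p M T) 0)
        * scaledDelta p h T.σ (startMatrix p M T) 0 ^ 3 ≤ ((b * u) ^ 3 + G ^ 4) * (w / u) := by
  have hs3 := kappa_bigK_rpow_third_pow T.σ
  have hμ0 := scaledDelta_nonneg (p := p) (h := h) (σ := T.σ) (W := startMatrix p M T) 0
  set y := kappa T.σ * bigK T.σ
  set s := y ^ ((4 / 3 : ℝ) - 1)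
  set μ₀ := scaledDelta p h T.σ (startMatrix p M T) 0
  have hsμ : 0 ≤ s * μ₀ := mul_nonneg (hs₀0.le.trans hs₀) hμ0
  have hτ0 : 0 ≤ w / u := by positivity
  have hτ1 : w / u ≤ 1 := (div_le_one hu).2 hw
  have hwu : w = u * (w / u) := by field_simp
  have h1 : μ₀ ≤ G * (w / u) := by
    refine le_of_mul_le_mul_right ?_ hs₀0
    calc μ₀ * s₀ ≤ s * μ₀ := by rw [mul_comm]; gcongr
      _ ≤ b * w := hs
      _ = b * u * (w / u) := by rw [mul_assoc, ← hwu]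
      _ ≤ G * s₀ * (w / u) := by gcongr
      _ = _ := by ring
  have hτn : ∀ k : ℕ, 1 ≤ k → (w / u) ^ k ≤ w / u := fun k hk =>
    pow_le_of_le_one hτ0 hτ1 (by omega)
  refine ⟨h1, ?_⟩
  have hG0 : 0 ≤ G := by
    by_contra hneg
    have : G * s₀ < 0 := mul_neg_of_neg_of_pos (not_le.1 hneg) hs₀0
    linarith [mul_nonneg hb hu.le]
  calc (y + μ₀) * μ₀ ^ 3 = (s * μ₀) ^ 3 + μ₀ ^ 4 := by rw [mul_pow, hs3]; ring
    _ ≤ (b * w) ^ 3 + (G * (w / u)) ^ 4 := by gcongr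
    _ = (b * u * (w / u)) ^ 3 + (G * (w / u)) ^ 4 := by rw [mul_assoc b, ← hwu]
    _ = (b * u) ^ 3 * (w / u) ^ 3 + G ^ 4 * (w / u) ^ 4 := by ring
    _ ≤ (b * u) ^ 3 * (w / u) + G ^ 4 * (w / u) := by
        gcongr
        · exact hτn 3 (by norm_num)
        · exact hτn 4 (by norm_num)
    _ = _ := by ring

/-- Two inner corrections reduce the inner residual by the factors `R₁ τ` and `R₂ τ`. -/
lemma stepFactor_two_steps {ξ y Q G R₁ R₂ μ τ μ₀ μ₁ μ₂ : ℝ} (hξ1 : 1 ≤ ξ) (hy : 0 ≤ y)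
    (hG0 : 0 ≤ G) (hR₁0 : 0 ≤ R₁) (hR₂0 : 0 ≤ R₂) (hμ : (1 + R₁) * G ≤ μ)
    (hR₁ : (ξ + 1) / 2 * (G + G) + (ξ + 1) ^ 2 / 2 * (G * G) + ξ / 2 * (G * (1 + (ξ + 1) * G) * G)
      + Q * (ξ ^ 2 + 7 / 5 * (ξ + 1) * ξ ^ 3) ≤ R₁)
    (hR₂ : (ξ + 1) / 2 * (G + μ) + (ξ + 1) ^ 2 / 2 * (μ * G)
      + (ξ + 1) / 2 * (G * (1 + (ξ + 1) * G))
      + ξ / 2 * (μ * (1 + (ξ + 1) * G) * μ + G * (1 + (ξ + 1) * G) * μ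
        + G * (μ * (1 + (ξ + 1) * G)))
      + (1 + R₁) ^ 3 * Q * (ξ ^ 2 + 7 / 5 * (ξ + 1) * ξ ^ 3) ≤ R₂)
    (hξμ : ξ * μ ≤ 1 / 6) (hτ0 : 0 ≤ τ) (hτ1 : τ ≤ 1)
    (hμ0 : 0 ≤ μ₀) (hμ₁0 : 0 ≤ μ₁) (hm : μ₀ ≤ G * τ) (hk : (y + μ₀) * μ₀ ^ 3 ≤ Q * τ)
    (hstep₁ : ξ * μ₀ ≤ 1 / 6 → μ₁ ≤ μ₀ * stepFactor ξ (y + μ₀) μ₀ 0 μ₀)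
    (hstep₂ : ξ * (μ₀ + μ₁) ≤ 1 / 6 → μ₂ ≤ μ₁ * stepFactor ξ (y + μ₀) μ₀ μ₀ (μ₀ + μ₁)) :
    μ₀ + μ₁ ≤ (1 + R₁) * μ₀ ∧ μ₂ ≤ μ₀ * (R₁ * R₂ * τ ^ 2) ∧ (1 + R₁) * μ₀ ≤ μ := by
  have hμ₀G : μ₀ ≤ G := hm.trans (mul_le_of_le_one_right hG0 hτ1)
  have hGμ : G ≤ μ := le_trans (le_mul_of_one_le_left hG0 (by linarith)) hμ
  have hξ0 : 0 ≤ ξ := by linarith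
  have hsm : (1 + R₁) * μ₀ ≤ μ := le_trans (by gcongr) hμ
  have h1 : μ₁ ≤ μ₀ * (R₁ * τ) := by
    refine (hstep₁ ?_).trans (mul_le_mul_of_nonneg_left ?_ hμ0)
    · calc ξ * μ₀ ≤ ξ * μ := by gcongr; linarith
        _ ≤ _ := hξμ
    · refine (stepFactor_le (G₁ := 0) hξ0 hμ0 hμ0 hτ0 hτ1 hm (by simp) hm hk hG0 le_rfl
        hG0).trans (mul_le_mul_of_nonneg_right (le_trans (le_of_eq ?_) hR₁) hτ0)
      ring
  have hsum : μ₀ + μ₁ ≤ (1 + R₁) * μ₀ := by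
    have : R₁ * τ ≤ R₁ := mul_le_of_le_one_right hR₁0 hτ1
    have := mul_le_mul_of_nonneg_left this hμ0
    linarith
  have hsumτ : μ₀ + μ₁ ≤ μ * τ := hsum.trans (by
    calc (1 + R₁) * μ₀ ≤ (1 + R₁) * (G * τ) := by gcongr
      _ = (1 + R₁) * G * τ := by ring
      _ ≤ _ := by gcongr)
  have hμ0' : 0 ≤ μ := hG0.trans hGμ
  have hk0 : 0 ≤ y + μ₀ := add_nonneg hy hμ0
  have h01 : 0 ≤ μ₀ + μ₁ := add_nonneg hμ0 hμ₁0
  have h2 : μ₂ ≤ μ₁ * (R₂ * τ) := by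
    refine (hstep₂ ?_).trans (mul_le_mul_of_nonneg_left ?_ hμ₁0)
    · calc ξ * (μ₀ + μ₁) ≤ ξ * μ := by gcongr; exact hsum.trans hsm
        _ ≤ _ := hξμ
    · have hk' : (y + μ₀) * (μ₀ + μ₁) ^ 3 ≤ ((1 + R₁) ^ 3 * Q) * τ := by
        calc (y + μ₀) * (μ₀ + μ₁) ^ 3 ≤ (y + μ₀) * ((1 + R₁) * μ₀) ^ 3 := by gcongr
          _ = (1 + R₁) ^ 3 * ((y + μ₀) * μ₀ ^ 3) := by ring
          _ ≤ (1 + R₁) ^ 3 * (Q * τ) := by gcongr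
          _ = _ := by ring
      exact (stepFactor_le hξ0 hμ0 h01 hτ0 hτ1 hm hm hsumτ hk'
        hG0 hG0 hμ0').trans (mul_le_mul_of_nonneg_right hR₂ hτ0)
  refine ⟨hsum, ?_, hsm⟩
  calc μ₂ ≤ μ₁ * (R₂ * τ) := h2
    _ ≤ μ₀ * (R₁ * τ) * (R₂ * τ) := by gcongr
    _ = _ := by ring

/-- The case `p = 2`: two inner corrections, which reduce the residual by `R₁ τ` and `R₂ τ`. -/
lemma isGoodStep_of_p_eq_two {w ξ c e₀ b G s₀ R₁ R₂ μ g₁ g₃ : ℝ} (hT : IsApprox (4 / 3) M T w)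
    (hw : w ≤ 0.046) (hξ1 : 1 ≤ ξ) (hξ : q = 1 ∨ 3 / 2 ≤ ξ) (hc1 : 1 ≤ c) (hc : q = 1 ∨ 2 ≤ c)
    (hs₀0 : 0 < s₀) (hs₀ : s₀ ^ 3 ≤ kappa T.σ * bigK T.σ)
    (he₀u : 0.046 ≤ e₀ * s₀ ^ 4) (he₀ : e₀ < 1) (hb0 : 0 ≤ b)
    (hb : (1 + 1 / 2 * (e₀ / (1 - e₀))) ^ 2 + 1 / (1 - e₀) + 1 / 4 * (e₀ / (1 - e₀) ^ 2) ≤ b)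
    (hG0 : 0 ≤ G) (hG : b * 0.046 ≤ G * s₀) (hR₁0 : 0 ≤ R₁)
    (hR₂0 : 0 ≤ R₂) (hμ : (1 + R₁) * G ≤ μ)
    (hR₁ : (ξ + 1) / 2 * (G + G) + (ξ + 1) ^ 2 / 2 * (G * G) + ξ / 2 * (G * (1 + (ξ + 1) * G) * G)
      + ((b * 0.046) ^ 3 + G ^ 4) * (ξ ^ 2 + 7 / 5 * (ξ + 1) * ξ ^ 3) ≤ R₁)
    (hR₂ : (ξ + 1) / 2 * (G + μ) + (ξ + 1) ^ 2 / 2 * (μ * G)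
      + (ξ + 1) / 2 * (G * (1 + (ξ + 1) * G))
      + ξ / 2 * (μ * (1 + (ξ + 1) * G) * μ + G * (1 + (ξ + 1) * G) * μ
        + G * (μ * (1 + (ξ + 1) * G)))
      + (1 + R₁) ^ 3 * ((b * 0.046) ^ 3 + G ^ 4) * (ξ ^ 2 + 7 / 5 * (ξ + 1) * ξ ^ 3) ≤ R₂)
    (hcμ : c * μ ≤ 1 / 5) (hμ2 : μ ≤ 1 / 5) (hξμ : ξ * μ ≤ 69 / 500)
    (hx₁ : ξ * (1 + R₁) * b ≤ 4.04)
    (hg₁ : 1 / (1 - c * μ) ≤ g₁) (hg₃0 : 0 ≤ g₃) (hg₃ : (1 + μ) * g₁ ≤ g₃ ^ 3)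
    (hdefect : (3 * (ξ * (1 + R₁) * b * 0.046) ^ 4 + 3 / 2 * 0.046 ^ 3)
      * ((1 + μ) * g₁ * g₃) ≤ 0.046 * (1 / 2) ^ 2)
    (hres : b * (R₁ * R₂) * (g₁ * g₃) ≤ (1 / 2) ^ 2) :
    IsGoodStep (4 / 3) (53 / 100 + 117 / 100 * 4.04) w (w * (w / (2 * 0.046)) ^ 2) M T
      (mapH 2 h M T) := by
  have hy0 := (kappa_mul_bigK_pos T.σ).le
  have hs₀' := le_kappa_bigK_rpow_third hs₀
  have hs := hT.scaledDelta_zero_le (p := 2) (h := h) (Y₀ := s₀ ^ 4) (by norm_num) hw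
    (by calc s₀ ^ 4 = s₀ ^ 3 * s₀ := by ring
          _ ≤ _ := by gcongr) (by positivity) he₀u he₀ hb
  obtain ⟨hm, hk⟩ := scaledDelta_zero_bounds (by norm_num) hT.nonneg hw hs₀0 hs₀' hG hb0 hs
  have hstep₁ := scaledDelta_succ_le (p := 2) (h := h) (W := startMatrix 2 M T) le_rfl hT.reg
    hξ1 hξ 0
  have hstep₂ := scaledDelta_succ_le (p := 2) (h := h) (W := startMatrix 2 M T) le_rfl hT.reg
    hξ1 hξ 1
  simp only [zero_add, Finset.sum_range_succ, Finset.sum_range_zero, Nat.reduceAdd]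
    at hstep₁ hstep₂
  obtain ⟨h1, h2, h3⟩ := stepFactor_two_steps hξ1 hy0 hG0 hR₁0 hR₂0 hμ hR₁ hR₂ (by linarith)
    (div_nonneg hT.nonneg (by norm_num)) ((div_le_one (by norm_num)).2 hw)
    (scaledDelta_nonneg 0) (scaledDelta_nonneg 1) hm hk hstep₁ hstep₂
  refine isGoodStep_of_two_le (C := 1 + R₁) (P := R₁ * R₂) (μ := μ) le_rfl hT (by norm_num)
    (by norm_num) hw hξ1 hξ hc1 hc (by linarith) (mul_nonneg hR₁0 hR₂0) hb0 hs ?_ h2 h3 hcμ hμ2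
    hξμ hx₁ hg₁ hg₃0 hg₃ (by norm_num at hdefect ⊢; exact hdefect) hres
  rw [Finset.sum_range_succ, Finset.sum_range_one]; exact h1

/-- The case `p ≥ 3`. The constants are not tight here, and those for `q ≥ 2` serve for all `q`. -/
lemma isGoodStep_of_three_le {w : ℝ} (hp : 3 ≤ p) (hT : IsApprox (4 / 3) M T w)
    (hw : w ≤ 0.0297) :
    IsGoodStep (4 / 3) (53 / 100 + 117 / 100 * 4.04) w (w * (w / (2 * 0.0297)) ^ p) M T
      (mapH p h M T) := by
  have hy1 := one_le_kappa_mul_bigK T.σ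
  have hs₀' : 1 ≤ (kappa T.σ * bigK T.σ) ^ ((4 / 3 : ℝ) - 1) :=
    le_kappa_bigK_rpow_third (by simpa using hy1)
  have hs := hT.scaledDelta_zero_le (p := p) (h := h) (Y₀ := 1) (e₀ := 0.0297) (b := 2.07)
    (by norm_num) hw (one_le_mul_of_one_le_of_one_le hy1 hs₀') (by norm_num) (by norm_num)
    (by norm_num) (by norm_num)
  obtain ⟨hm, hk⟩ := scaledDelta_zero_bounds (G := 0.0615) (by norm_num) hT.nonneg hw
    zero_lt_one hs₀' (by norm_num) (by norm_num) hs
  have hstep := scaledDelta_succ_le (p := p) (h := h) (W := startMatrix p M T) (by omega) hT.reg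
    (ξ := 3 / 2) (by norm_num) (Or.inr le_rfl)
  have hτ0 : 0 ≤ w / 0.0297 := div_nonneg hT.nonneg (by norm_num)
  have hτ1 : w / 0.0297 ≤ 1 := (div_le_one (by norm_num)).2 hw
  have hν0 := scaledDelta_nonneg (p := p) (h := h) (σ := T.σ) (W := startMatrix p M T)
  set ν := scaledDelta p h T.σ (startMatrix p M T)
  set y := kappa T.σ * bigK T.σ
  set τ := w / 0.0297
  have hk0 : 0 ≤ y + ν 0 := add_nonneg (by linarith) (hν0 0)
  have hν0G : ν 0 ≤ 0.0615 := hm.trans (mul_le_of_le_one_right (by norm_num) hτ1)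
  -- the first correction is better than the later ones, since there are no old terms
  have h1 : ν 1 ≤ ν 0 * (0.173 * τ) := by
    have := hstep 0
    simp only [zero_add, Finset.sum_range_succ, Finset.sum_range_zero] at this
    refine (this (by linarith)).trans (mul_le_mul_of_nonneg_left ?_ (hν0 0))
    refine (stepFactor_le (G₁ := 0) (by norm_num) (hν0 0) (hν0 0) hτ0 hτ1 hm (by simp) hm hk
      (by norm_num) le_rfl (by norm_num)).trans (mul_le_mul_of_nonneg_right ?_ hτ0)
    norm_num
  -- the sum of a geometric series with ratio `2 / 5` is controlled by `∑ ν j + 5 / 3 * ν k`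
  have key : ∀ k, ∑ j ∈ Finset.range (k + 1), ν j + 5 / 3 * ν (k + 1) ≤ 1.3 * ν 0 ∧
      ν (k + 1) ≤ ν 0 * (0.173 * τ) * (2 / 5 * τ) ^ k := by
    intro k
    induction k with
    | zero =>
      refine ⟨?_, by simpa using h1⟩
      rw [zero_add, Finset.sum_range_one]
      have : ν 0 * (0.173 * τ) ≤ ν 0 * 0.173 :=
        mul_le_mul_of_nonneg_left (by linarith) (hν0 0)
      linarith [hν0 0]
    | succ k ih =>
      obtain ⟨ih1, ih2⟩ := ih
      have hsum : ∑ j ∈ Finset.range (k + 2), ν j ≤ 1.3 * ν 0 := by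
        rw [Finset.sum_range_succ]; linarith [hν0 (k + 1)]
      have hsum' : ∑ j ∈ Finset.range (k + 1), ν j ≤ 1.3 * ν 0 := by linarith [hν0 (k + 1)]
      have hs0 : 0 ≤ ∑ j ∈ Finset.range (k + 2), ν j := Finset.sum_nonneg fun j _ => hν0 j
      have hle : (1.3 : ℝ) * ν 0 ≤ 0.08 * τ := by linarith
      have hkm : (y + ν 0) * (∑ j ∈ Finset.range (k + 2), ν j) ^ 3
          ≤ (1.3 ^ 3 * ((2.07 * 0.0297) ^ 3 + 0.0615 ^ 4)) * τ := by
        calc (y + ν 0) * (∑ j ∈ Finset.range (k + 2), ν j) ^ 3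
            ≤ (y + ν 0) * (1.3 * ν 0) ^ 3 := by gcongr
          _ = 1.3 ^ 3 * ((y + ν 0) * ν 0 ^ 3) := by ring
          _ ≤ 1.3 ^ 3 * (((2.07 * 0.0297) ^ 3 + 0.0615 ^ 4) * τ) := by gcongr
          _ = _ := by ring
      have h2 : ν (k + 2) ≤ ν (k + 1) * (2 / 5 * τ) := by
        refine (hstep (k + 1) ?_).trans (mul_le_mul_of_nonneg_left ?_ (hν0 _))
        · linarith
        · refine (stepFactor_le (G₁ := 0.08) (G₂ := 0.08) (by norm_num) (hν0 0) hs0 hτ0 hτ1 hm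
            (hsum'.trans hle) (hsum.trans hle) hkm (by norm_num) (by norm_num) (by norm_num)).trans
            (mul_le_mul_of_nonneg_right ?_ hτ0)
          norm_num
      refine ⟨?_, ?_⟩
      · rw [Finset.sum_range_succ]
        have : ν (k + 1) * (2 / 5 * τ) ≤ ν (k + 1) * (2 / 5) :=
          mul_le_mul_of_nonneg_left (by linarith) (hν0 _)
        linarith
      · calc ν (k + 2) ≤ ν (k + 1) * (2 / 5 * τ) := h2
          _ ≤ ν 0 * (0.173 * τ) * (2 / 5 * τ) ^ k * (2 / 5 * τ) := by gcongr
          _ = _ := by ring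
  obtain ⟨r, rfl⟩ : ∃ r, p = r + 3 := ⟨p - 3, by omega⟩
  obtain ⟨k1, k2⟩ := key (r + 2)
  have hhalf : ∀ x : ℝ, 0 ≤ x → x ≤ 1 → (1 / 2 * x) ^ (r + 3) ≤ x ^ 3 * (1 / 2) ^ (r + 3) := by
    intro x hx0 hx1
    rw [mul_pow, mul_comm]
    gcongr ?_ * _
    exact pow_le_pow_of_le_one hx0 hx1 (by omega)
  refine isGoodStep_of_two_le (u := 0.0297) (ξ := 3 / 2) (c := 2) (b := 2.07) (C := 1.3)
    (P := 0.173 * (2 / 5) ^ (r + 2)) (μ := 0.08) (g₁ := 1.1905) (g₃ := 1.088) (by omega) hT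
    (by norm_num) (by norm_num) hw (by norm_num) (Or.inr le_rfl) (by norm_num) (Or.inr le_rfl)
    (by norm_num) (by positivity) (by norm_num) hs ?_ ?_ (by linarith) (by norm_num)
    (by norm_num) (by norm_num) (by norm_num) (by norm_num) (by norm_num) (by norm_num) ?_ ?_
  · linarith [hν0 (r + 3)]
  · refine k2.trans (le_of_eq ?_)
    rw [mul_pow, show r + 3 = (r + 2) + 1 by ring, pow_succ τ]
    ring
  · have h2 := hhalf 0.24 (by norm_num) (by norm_num)
    have h3 := hhalf 0.0594 (by norm_num) (by norm_num)
    have h4 : (3 / 2 * 1.3 * 2.07 * 0.0297 : ℝ) ^ (2 * ((r + 3) / 2) + 2) ≤ 0.12 ^ (r + 3 + 1) := by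
      calc (3 / 2 * 1.3 * 2.07 * 0.0297 : ℝ) ^ (2 * ((r + 3) / 2) + 2)
          ≤ 0.12 ^ (2 * ((r + 3) / 2) + 2) := by gcongr; norm_num
        _ ≤ _ := pow_le_pow_of_le_one (by norm_num) (by norm_num) (by omega)
    rw [pow_succ (0.12 : ℝ)] at h4
    rw [pow_succ (0.0297 : ℝ)]
    norm_num at h2 h3 h4 ⊢
    have h5 : (0 : ℝ) ≤ (1 / 2) ^ (r + 3) := by positivity
    linarith
  · have h2 := hhalf 0.8 (by norm_num) (by norm_num)
    rw [pow_succ (1 / 2 * 0.8 : ℝ)] at h2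
    norm_num at h2 ⊢
    have h5 : (0 : ℝ) ≤ (1 / 2) ^ (r + 3) := by positivity
    linarith

/-- The constant `g` in the bounds `‖Γ‖ ≤ g w` for the factors `1 + Γ` of one step. -/
noncomputable def factorConst (p : ℕ) : ℝ :=
  if p = 1 then 53 / 100 + 117 / 100 * 2.07 else 53 / 100 + 117 / 100 * 4.04

/-- One step of `H_p` turns relative defects `w` into `w (w / (2 u₀)) ^ p`, which is the source of the
order `p + 1`. The numbers passed below are bounds, rounded to a few digits, for the quantities that
the general lemmas introduce one after the other, starting from `w = u₀`. The cases `q = 1` and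
`q ≥ 2` differ since `κ K ≥ 2` holds only in the second, while the bound for the solution of the
linear equation and the one for the change of `κ` are better in the first. -/
theorem isGoodStep (hp : 1 ≤ p) (hq : 1 ≤ q) {w : ℝ} (hT : IsApprox (aConst p) M T w)
    (hw : w ≤ u0Const p) :
    IsGoodStep (aConst p) (factorConst p) w (w * (w / (2 * u0Const p)) ^ p) M T
      (mapH p h M T) := by
  have hy1 := one_le_kappa_mul_bigK T.σ
  rcases (by omega : p = 1 ∨ p = 2 ∨ 3 ≤ p) with rfl | rfl | hp3
  · simp only [aConst, u0Const, factorConst, if_true] at hT hw ⊢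
    rcases hq.eq_or_lt with hq1 | hq2
    · exact isGoodStep_of_p_eq_one (ξ := 1) (c := 1) (y₀ := 1) (e₀ := 0.0289) (b := 2.068)
        (μ := 0.0598) (g₁ := 1.0637) (g₃ := 1.1274) hT hw le_rfl (Or.inl hq1.symm) le_rfl
        (Or.inl hq1.symm) le_rfl hy1 (by norm_num) (by norm_num) (by norm_num) (by norm_num)
        (by norm_num) (by norm_num) (by norm_num) (by norm_num) (by norm_num) (by norm_num)
        (by norm_num) (by norm_num)
    · exact isGoodStep_of_p_eq_one (ξ := 3 / 2) (c := 2) (y₀ := 2) (e₀ := 0.0289 / 4) (b := 2.017)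
        (μ := 0.02915) (g₁ := 1.062) (g₃ := 1.093) hT hw (by norm_num) (Or.inr le_rfl)
        (by norm_num) (Or.inr le_rfl) (by norm_num) (two_le_kappa_mul_bigK hT.reg hq2)
        (by norm_num) (by norm_num) (by norm_num) (by norm_num) (by norm_num) (by norm_num)
        (by norm_num) (by norm_num) (by norm_num) (by norm_num) (by norm_num) (by norm_num)
  · simp only [aConst, u0Const, factorConst, if_true, OfNat.ofNat_ne_one, if_false] at hT hw ⊢
    rcases hq.eq_or_lt with hq1 | hq2
    · exact isGoodStep_of_p_eq_two (ξ := 1) (c := 1) (e₀ := 0.046) (b := 2.11) (G := 0.0971)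
        (s₀ := 1) (R₁ := 0.223) (R₂ := 0.385) (μ := 0.119) (g₁ := 1.136) (g₃ := 1.084) hT hw le_rfl
        (Or.inl hq1.symm) le_rfl (Or.inl hq1.symm) zero_lt_one (by simpa using hy1)
        (by norm_num) (by norm_num) (by norm_num) (by norm_num) (by norm_num) (by norm_num)
        (by norm_num) (by norm_num) (by norm_num) (by norm_num) (by norm_num) (by norm_num)
        (by norm_num) (by norm_num) (by norm_num) (by norm_num) (by norm_num) (by norm_num)
        (by norm_num) (by norm_num)
    · have h2 := two_le_kappa_mul_bigK hT.reg hq2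
      exact isGoodStep_of_p_eq_two (ξ := 3 / 2) (c := 2) (e₀ := 0.01835) (b := 2.043) (G := 0.0747)
        (s₀ := 1.259) (R₁ := 0.2215) (R₂ := 0.3818) (μ := 0.0913) (g₁ := 1.2235) (g₃ := 1.102) hT
        hw (by norm_num) (Or.inr le_rfl) (by norm_num) (Or.inr le_rfl) (by norm_num)
        (le_trans (by norm_num) h2)
        (by norm_num) (by norm_num) (by norm_num) (by norm_num) (by norm_num) (by norm_num)
        (by norm_num) (by norm_num) (by norm_num) (by norm_num) (by norm_num) (by norm_num)
        (by norm_num) (by norm_num) (by norm_num) (by norm_num) (by norm_num) (by norm_num)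
        (by norm_num) (by norm_num)
  · have h1 : p ≠ 1 := by omega
    have h2 : p ≠ 2 := by omega
    simp only [aConst, u0Const, factorConst, h1, h2, if_false] at hT hw ⊢
    exact isGoodStep_of_three_le hp3 hT hw

end Constants

/-! ### The spectral norm -/

section Spectral

open scoped Matrix.Norms.L2Operator

open WithLp (toLp)

variable {r c k ℓ q : ℕ}

lemma norm_toLp_mulVec_le (A : Matrix (Fin r) (Fin c) ℂ) (v : Fin c → ℂ) :
    ‖toLp 2 (A *ᵥ v)‖ ≤ ‖A‖ * ‖toLp 2 v‖ :=
  A.l2_opNorm_mulVec (toLp 2 v)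

lemma l2_opNorm_le_bound {A : Matrix (Fin r) (Fin c) ℂ} {b : ℝ} (hb : 0 ≤ b)
    (h : ∀ v : Fin c → ℂ, ‖toLp 2 (A *ᵥ v)‖ ≤ b * ‖toLp 2 v‖) : ‖A‖ ≤ b := by
  rw [Matrix.l2_opNorm_def]
  exact ContinuousLinearMap.opNorm_le_bound _ hb fun v => h v.ofLp

/-- Schur's test. -/
lemma l2_opNorm_le_matNorm (A : Matrix (Fin r) (Fin c) ℂ) : ‖A‖ ≤ matNorm A := by
  have h0 := matNorm_nonneg A
  refine l2_opNorm_le_bound h0 fun v => ?_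
  refine le_of_sq_le_sq ?_ (by positivity)
  rw [mul_pow, EuclideanSpace.norm_sq_eq, EuclideanSpace.norm_sq_eq]
  have hrow : ∀ i, ‖(A *ᵥ v) i‖ ^ 2 ≤ matNorm A * ∑ j, ‖A i j‖ * ‖v j‖ ^ 2 := by
    intro i
    have h1 : ‖(A *ᵥ v) i‖ ≤ ∑ j, ‖A i j‖ * ‖v j‖ := by
      rw [Matrix.mulVec, dotProduct]
      exact (norm_sum_le _ _).trans (Finset.sum_le_sum fun j _ => (norm_mul _ _).le)
    have h2 : (∑ j, ‖A i j‖ * ‖v j‖) ^ 2 ≤ (∑ j, ‖A i j‖) * ∑ j, ‖A i j‖ * ‖v j‖ ^ 2 :=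
      Finset.sum_sq_le_sum_mul_sum_of_sq_le_mul _ (fun j _ => norm_nonneg _)
        (fun j _ => by positivity) (fun j _ => le_of_eq (by ring))
    calc _ ≤ (∑ j, ‖A i j‖ * ‖v j‖) ^ 2 := by gcongr
      _ ≤ _ := h2
      _ ≤ _ := by gcongr; exact row_sum_le_matNorm A i
  calc ∑ i, ‖(A *ᵥ v) i‖ ^ 2 ≤ ∑ i, matNorm A * ∑ j, ‖A i j‖ * ‖v j‖ ^ 2 :=
        Finset.sum_le_sum fun i _ => hrow i
    _ = matNorm A * ∑ j, (∑ i, ‖A i j‖) * ‖v j‖ ^ 2 := by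
        rw [← Finset.mul_sum, Finset.sum_comm]; simp only [Finset.sum_mul]
    _ ≤ matNorm A * ∑ j, matNorm A * ‖v j‖ ^ 2 := by
        gcongr with j; exact col_sum_le_matNorm A j
    _ = _ := by rw [← Finset.mul_sum]; ring

lemma rowNorm_le_sqrt_mul_l2_opNorm (A : Matrix (Fin r) (Fin c) ℂ) :
    rowNorm A ≤ √(c : ℝ) * ‖A‖ := by
  refine (rowNorm_le_iff (by positivity)).2 fun i => ?_
  have h1 : ‖toLp 2 (Aᴴ *ᵥ Pi.single i 1)‖ ≤ ‖A‖ := by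
    have := norm_toLp_mulVec_le Aᴴ (Pi.single i 1)
    rwa [Matrix.l2_opNorm_conjTranspose, PiLp.toLp_single, PiLp.norm_single, norm_one,
      mul_one] at this
  have h2 : ∑ j, ‖A i j‖ ^ 2 ≤ ‖A‖ ^ 2 := by
    calc ∑ j, ‖A i j‖ ^ 2 = ‖toLp 2 (Aᴴ *ᵥ Pi.single i 1)‖ ^ 2 := by
          rw [EuclideanSpace.norm_sq_eq]
          simp
      _ ≤ _ := by gcongr
  have h3 : (∑ j, ‖A i j‖) ^ 2 ≤ c * ∑ j, ‖A i j‖ ^ 2 := by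
    simpa using sq_sum_le_card_mul_sum_sq (s := Finset.univ) (f := fun j => ‖A i j‖)
  refine le_of_sq_le_sq ?_ (by positivity)
  rw [mul_pow, Real.sq_sqrt (Nat.cast_nonneg c)]
  exact h3.trans (by gcongr)

lemma l2_opNorm_one_add_le (E : Matrix (Fin k) (Fin k) ℂ) : ‖1 + E‖ ≤ 1 + matNorm E := by
  refine (l2_opNorm_le_matNorm _).trans (matNorm_add_le matNorm_one_le le_rfl)

lemma one_add_stiefelDefect (U : Matrix (Fin r) (Fin k) ℂ) : 1 + stiefelDefect U = Uᴴ * U := by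
  rw [stiefelDefect]; abel

lemma l2_opNorm_sq_le (U : Matrix (Fin r) (Fin k) ℂ) :
    ‖U‖ ^ 2 ≤ 1 + matNorm (stiefelDefect U) := by
  rw [sq, ← Matrix.l2_opNorm_conjTranspose_mul_self, ← one_add_stiefelDefect]
  exact l2_opNorm_one_add_le _

/-- The factors `√ℓ`, `√m` (and `√q`, `√n` for `V`) in the theorem come from comparing the row and
column sums of `U` with its spectral norm, which is close to `1`. -/
lemma rowNorm_le_of_stiefelDefect (U : Matrix (Fin r) (Fin k) ℂ) :
    rowNorm U ≤ √(k : ℝ) * √(1 + matNorm (stiefelDefect U)) :=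
  (rowNorm_le_sqrt_mul_l2_opNorm U).trans
    (mul_le_mul_of_nonneg_left (Real.le_sqrt_of_sq_le (l2_opNorm_sq_le U)) (Real.sqrt_nonneg _))

lemma matNorm_le_of_stiefelDefect (hk : k ≤ r) (U : Matrix (Fin r) (Fin k) ℂ) :
    matNorm U ≤ √(r : ℝ) * √(1 + matNorm (stiefelDefect U)) := by
  refine max_le ((rowNorm_le_of_stiefelDefect U).trans (by gcongr)) ?_
  refine (rowNorm_le_sqrt_mul_l2_opNorm Uᴴ).trans ?_
  rw [Matrix.l2_opNorm_conjTranspose]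
  exact mul_le_mul_of_nonneg_left (Real.le_sqrt_of_sq_le (l2_opNorm_sq_le U)) (Real.sqrt_nonneg _)

/-- `I + E` is invertible if `‖E‖ < 1`. -/
lemma isUnit_det_one_add {E : Matrix (Fin k) (Fin k) ℂ} (hE : matNorm E < 1) :
    IsUnit (1 + E).det := by
  rw [isUnit_iff_ne_zero]
  intro h0
  obtain ⟨v, hv0, hv⟩ := Matrix.exists_mulVec_eq_zero_iff.2 h0
  rw [Matrix.add_mulVec, Matrix.one_mulVec] at hv
  have h1 : v = -(E *ᵥ v) := eq_neg_of_add_eq_zero_left hv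
  have h2 : ‖toLp 2 v‖ ≤ matNorm E * ‖toLp 2 v‖ := by
    calc ‖toLp 2 v‖ = ‖toLp 2 (E *ᵥ v)‖ := by
          conv_lhs => rw [h1]
          rw [WithLp.toLp_neg, norm_neg]
      _ ≤ ‖E‖ * ‖toLp 2 v‖ := norm_toLp_mulVec_le _ _
      _ ≤ _ := by gcongr; exact l2_opNorm_le_matNorm E
  have h3 : 0 < ‖toLp 2 v‖ := norm_pos_iff.2 (by simpa using hv0)
  nlinarith

lemma norm_toLp_rectDiag_mulVec (h : q ≤ ℓ) (σ : Fin q → ℝ) (v : Fin q → ℂ) :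
    ‖toLp 2 (rectDiag ℓ σ *ᵥ v)‖ ^ 2 = ∑ i, (|σ i| * ‖v i‖) ^ 2 := by
  rw [EuclideanSpace.norm_sq_eq, ← sum_dite_lt h]
  refine Finset.sum_congr rfl fun i _ => ?_
  simp only [Matrix.mulVec, dotProduct]
  split_ifs with hi
  · rw [Finset.sum_eq_single ⟨i, hi⟩]
    · simp [rectDiag]
    · intro k _ hk
      have : (i : ℕ) ≠ k := fun e => hk (Fin.ext e.symm)
      simp [rectDiag, this]
    · simp
  · rw [Finset.sum_eq_zero]
    · simp
    · intro k _
      have : (i : ℕ) ≠ k := fun e => hi (e ▸ k.2)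
      simp [rectDiag, this]

/-- A one-sided perturbation bound of Weyl type, for two matrices which are close to diagonal and
whose diagonals are ordered alike. Some `v ≠ 0` is supported where `|σ₂| ≥ |σ₂ j|` while `R v`
is supported where `|σ₁| ≤ |σ₁ j|`, since these are fewer than `q` linear conditions. -/
lemma abs_sub_le_of_eq_mul_mul (h : q ≤ ℓ) {σ₁ σ₂ : Fin q → ℝ}
    {Δ₁ Δ₂ : Matrix (Fin ℓ) (Fin q) ℂ} {L : Matrix (Fin ℓ) (Fin ℓ) ℂ}
    {R : Matrix (Fin q) (Fin q) ℂ} (heq : rectDiag ℓ σ₂ + Δ₂ = L * (rectDiag ℓ σ₁ + Δ₁) * R)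
    (j : Fin q) (hj : ∀ k, |σ₁ j| < |σ₁ k| → |σ₂ j| ≤ |σ₂ k|) :
    |σ₂ j| - matNorm Δ₂ ≤ ‖L‖ * ‖R‖ * (|σ₁ j| + matNorm Δ₁) := by
  classical
  let N : Matrix (Fin q) (Fin q) ℂ := Matrix.of fun k i =>
    if |σ₁ j| < |σ₁ k| then R k i else if |σ₂ j| ≤ |σ₂ k| then 0 else (1 : Matrix _ _ ℂ) k i
  have hN : N.det = 0 := Matrix.det_eq_zero_of_row_eq_zero j fun i => by simp [N]
  obtain ⟨v, hv0, hv⟩ := Matrix.exists_mulVec_eq_zero_iff.2 hN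
  have hvR : ∀ k, |σ₁ j| < |σ₁ k| → (R *ᵥ v) k = 0 := by
    intro k hk
    have := congrFun hv k
    simpa [N, Matrix.mulVec, dotProduct, hk] using this
  have hvs : ∀ k, |σ₂ k| < |σ₂ j| → v k = 0 := by
    intro k hk
    have h1 : ¬|σ₁ j| < |σ₁ k| := fun h' => absurd (hj k h') (not_le.2 hk)
    have := congrFun hv k
    simpa [N, Matrix.mulVec, dotProduct, h1, not_le.2 hk, Matrix.one_apply] using this
  have hpos : 0 < ‖toLp 2 v‖ := norm_pos_iff.2 (by simpa using hv0)
  have hlow : |σ₂ j| * ‖toLp 2 v‖ ≤ ‖toLp 2 (rectDiag ℓ σ₂ *ᵥ v)‖ := by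
    refine le_of_sq_le_sq ?_ (norm_nonneg _)
    rw [norm_toLp_rectDiag_mulVec h, mul_pow, EuclideanSpace.norm_sq_eq, Finset.mul_sum]
    refine Finset.sum_le_sum fun k _ => ?_
    rw [mul_pow]
    rcases lt_or_ge |σ₂ k| |σ₂ j| with hk | hk
    · simp [hvs k hk]
    · gcongr
  have hup : ‖toLp 2 (rectDiag ℓ σ₁ *ᵥ (R *ᵥ v))‖ ≤ |σ₁ j| * ‖toLp 2 (R *ᵥ v)‖ := by
    refine le_of_sq_le_sq ?_ (by positivity)
    rw [norm_toLp_rectDiag_mulVec h, mul_pow, EuclideanSpace.norm_sq_eq, Finset.mul_sum]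
    refine Finset.sum_le_sum fun k _ => ?_
    rw [mul_pow]
    rcases lt_or_ge |σ₁ j| |σ₁ k| with hk | hk
    · simp [hvR k hk]
    · gcongr
  have hd : ∀ (Δ : Matrix (Fin ℓ) (Fin q) ℂ) (w : Fin q → ℂ),
      ‖toLp 2 (Δ *ᵥ w)‖ ≤ matNorm Δ * ‖toLp 2 w‖ := fun Δ w =>
    (norm_toLp_mulVec_le _ _).trans
      (mul_le_mul_of_nonneg_right (l2_opNorm_le_matNorm Δ) (norm_nonneg _))
  have hA : ‖toLp 2 ((rectDiag ℓ σ₂ + Δ₂) *ᵥ v)‖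
      ≤ ‖L‖ * ((|σ₁ j| + matNorm Δ₁) * (‖R‖ * ‖toLp 2 v‖)) := by
    rw [heq, ← Matrix.mulVec_mulVec, ← Matrix.mulVec_mulVec]
    refine (norm_toLp_mulVec_le _ _).trans ?_
    gcongr
    calc _ ≤ ‖toLp 2 (rectDiag ℓ σ₁ *ᵥ (R *ᵥ v))‖ + ‖toLp 2 (Δ₁ *ᵥ (R *ᵥ v))‖ := by
          rw [Matrix.add_mulVec, WithLp.toLp_add]; exact norm_add_le _ _
      _ ≤ |σ₁ j| * ‖toLp 2 (R *ᵥ v)‖ + matNorm Δ₁ * ‖toLp 2 (R *ᵥ v)‖ := add_le_add hup (hd _ _)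
      _ = (|σ₁ j| + matNorm Δ₁) * ‖toLp 2 (R *ᵥ v)‖ := by ring
      _ ≤ _ := by
        have := matNorm_nonneg Δ₁
        gcongr
        exact norm_toLp_mulVec_le _ _
  have hB : ‖toLp 2 (rectDiag ℓ σ₂ *ᵥ v)‖
      ≤ ‖toLp 2 ((rectDiag ℓ σ₂ + Δ₂) *ᵥ v)‖ + matNorm Δ₂ * ‖toLp 2 v‖ := by
    rw [Matrix.add_mulVec, WithLp.toLp_add]
    refine (norm_le_add_norm_add _ (toLp 2 (Δ₂ *ᵥ v))).trans (by gcongr; exact hd _ _)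
  refine le_of_mul_le_mul_right ?_ hpos
  linarith

/-- If `P^* (I + E) P = I` then `P` is invertible, with inverse `Q = P^* (I + E)`. Its norm, and
that of `Q`, are close to `1`. -/
lemma exists_inverse_of_conj_eq_one {E P : Matrix (Fin k) (Fin k) ℂ} (hE : Eᴴ = E)
    (hP : Pᴴ * (1 + E) * P = 1) : ∃ Q : Matrix (Fin k) (Fin k) ℂ, P * Q = 1 ∧
      ‖P‖ ^ 2 * (1 - matNorm E) ≤ 1 ∧ ‖Q‖ ^ 2 ≤ 1 + matNorm E := by
  have hPQ : P * (Pᴴ * (1 + E)) = 1 := mul_eq_one_comm.1 hP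
  refine ⟨Pᴴ * (1 + E), hPQ, ?_, ?_⟩
  · have h1 : P * Pᴴ = 1 - P * Pᴴ * E := by
      rw [← Matrix.mul_assoc, Matrix.mul_add, Matrix.mul_one] at hPQ
      exact eq_sub_of_add_eq hPQ
    have h2 : ‖P * Pᴴ‖ = ‖P‖ ^ 2 := by
      have := Matrix.l2_opNorm_conjTranspose_mul_self Pᴴ
      rwa [Matrix.conjTranspose_conjTranspose, Matrix.l2_opNorm_conjTranspose, ← sq] at this
    have h3 : ‖(1 : Matrix (Fin k) (Fin k) ℂ)‖ ≤ 1 :=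
      (l2_opNorm_le_matNorm _).trans matNorm_one_le
    have h4 : ‖P‖ ^ 2 ≤ 1 + ‖P‖ ^ 2 * matNorm E := by
      calc ‖P‖ ^ 2 = ‖1 - P * Pᴴ * E‖ := by rw [← h1, h2]
        _ ≤ ‖(1 : Matrix (Fin k) (Fin k) ℂ)‖ + ‖P * Pᴴ * E‖ := norm_sub_le _ _
        _ ≤ 1 + ‖P‖ ^ 2 * matNorm E := by
          refine add_le_add h3 ((Matrix.l2_opNorm_mul _ _).trans ?_)
          rw [h2]
          gcongr
          exact l2_opNorm_le_matNorm E
    linarith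
  · rw [sq, ← Matrix.l2_opNorm_conjTranspose_mul_self]
    have h1 : (Pᴴ * (1 + E))ᴴ * (Pᴴ * (1 + E)) = 1 + E := by
      rw [Matrix.conjTranspose_mul, Matrix.conjTranspose_conjTranspose, Matrix.conjTranspose_add,
        Matrix.conjTranspose_one, hE, Matrix.mul_assoc, hPQ, Matrix.mul_one]
    rw [h1]
    exact l2_opNorm_one_add_le E

/-- The singular values of `U^* M V` for nearly isometric `U`, `V` compared with those obtained
from exactly isometric matrices `U P`, `V N`, provided that the orders of the `|σ j|` agree. -/
lemma abs_abs_sub_abs_le {m n : ℕ} (h : q ≤ ℓ) {M : Matrix (Fin m) (Fin n) ℂ}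
    {T T' : Triplet m n ℓ q} {P : Matrix (Fin ℓ) (Fin ℓ) ℂ} {N : Matrix (Fin q) (Fin q) ℂ}
    {e : ℝ} (heU : matNorm (stiefelDefect T.U) ≤ e) (heV : matNorm (stiefelDefect T.V) ≤ e)
    (he : e < 1) (hT' : IsSVDSolution M T') (hU : T'.U = T.U * P) (hV : T'.V = T.V * N)
    (j : Fin q) (h₁ : ∀ k, |T.σ j| < |T.σ k| → |T'.σ j| ≤ |T'.σ k|)
    (h₂ : ∀ k, |T'.σ j| < |T'.σ k| → |T.σ j| ≤ |T.σ k|) :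
    |(|T'.σ j| - |T.σ j|)| ≤ (matNorm (residual M T) + |T.σ j| * e) / (1 - e) := by
  obtain ⟨hEU, hEV, hres⟩ := hT'
  have conj : ∀ {r k : ℕ} {A A' : Matrix (Fin r) (Fin k) ℂ} {B : Matrix (Fin k) (Fin k) ℂ},
      stiefelDefect A' = 0 → A' = A * B → Bᴴ * (1 + stiefelDefect A) * B = 1 := by
    intro r k A A' B h0 h1
    have := one_add_stiefelDefect A'
    rw [h0, add_zero, h1, Matrix.conjTranspose_mul] at this
    rw [one_add_stiefelDefect, this]
    simp only [Matrix.mul_assoc]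
  obtain ⟨Q, hPQ, hPn, hQn⟩ := exists_inverse_of_conj_eq_one (stiefelDefect_conjTranspose T.U)
    (conj hEU hU)
  obtain ⟨R, hNR, hNn, hRn⟩ := exists_inverse_of_conj_eq_one (stiefelDefect_conjTranspose T.V)
    (conj hEV hV)
  have hA : rectDiag ℓ T.σ + residual M T = T.Uᴴ * M * T.V := by rw [residual]; abel
  have hA' : rectDiag ℓ T'.σ + 0 = T'.Uᴴ * M * T'.V := by
    rw [← hres, residual]; abel
  have hfw : rectDiag ℓ T'.σ + 0 = Pᴴ * (rectDiag ℓ T.σ + residual M T) * N := by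
    rw [hA', hA, hU, hV, Matrix.conjTranspose_mul]
    simp only [Matrix.mul_assoc]
  have hbw : rectDiag ℓ T.σ + residual M T = Qᴴ * (rectDiag ℓ T'.σ + 0) * R := by
    have h3 : Qᴴ * Pᴴ = 1 := by
      rw [← Matrix.conjTranspose_mul, hPQ, Matrix.conjTranspose_one]
    calc rectDiag ℓ T.σ + residual M T
        = (Qᴴ * Pᴴ) * (rectDiag ℓ T.σ + residual M T) * (N * R) := by
          rw [h3, hNR, Matrix.one_mul, Matrix.mul_one]
      _ = _ := by rw [hfw]; simp only [Matrix.mul_assoc]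
  have h3 := abs_sub_le_of_eq_mul_mul h hfw j h₁
  have h4 := abs_sub_le_of_eq_mul_mul h hbw j h₂
  rw [Matrix.l2_opNorm_conjTranspose, matNorm_zero] at h3 h4
  have he0 : 0 ≤ e := (matNorm_nonneg _).trans heU
  have hd0 := matNorm_nonneg (residual M T)
  have hs0 := abs_nonneg (T.σ j)
  have ht0 := abs_nonneg (T'.σ j)
  have h1e : 0 < 1 - e := by linarith
  -- `x y ≤ (x ^ 2 + y ^ 2) / 2` bounds the products of norms by the bounds for the squares
  have hPN : ‖P‖ * ‖N‖ * (1 - e) ≤ 1 := by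
    have a1 : ‖P‖ ^ 2 * (1 - e) ≤ 1 := le_trans (by gcongr) hPn
    have a2 : ‖N‖ ^ 2 * (1 - e) ≤ 1 := le_trans (by gcongr) hNn
    have a3 : ‖P‖ * ‖N‖ ≤ (‖P‖ ^ 2 + ‖N‖ ^ 2) / 2 := by nlinarith [sq_nonneg (‖P‖ - ‖N‖)]
    have := mul_le_mul_of_nonneg_right a3 h1e.le
    linarith
  have hQR : ‖Q‖ * ‖R‖ ≤ 1 + e := by nlinarith [sq_nonneg (‖Q‖ - ‖R‖)]
  rw [le_div_iff₀ h1e]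
  have h5 : |T'.σ j| * (1 - e) ≤ |T.σ j| + matNorm (residual M T) := by
    calc |T'.σ j| * (1 - e) ≤ (‖P‖ * ‖N‖ * (|T.σ j| + matNorm (residual M T))) * (1 - e) := by
          gcongr; linarith
      _ = (‖P‖ * ‖N‖ * (1 - e)) * (|T.σ j| + matNorm (residual M T)) := by ring
      _ ≤ 1 * (|T.σ j| + matNorm (residual M T)) := by gcongr
      _ = _ := one_mul _
  have h6 : |T.σ j| - matNorm (residual M T) ≤ (1 + e) * |T'.σ j| := by
    refine h4.trans ?_
    rw [add_zero]
    gcongr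
  rcases abs_cases (|T'.σ j| - |T.σ j|) with ⟨h7, h8⟩ | ⟨h7, h8⟩
  · rw [h7]; linarith
  · rw [h7]
    nlinarith [mul_nonneg he0 (by linarith : 0 ≤ |T.σ j| - |T'.σ j|)]

end Spectral

/-! ### The rate `2 ^ (-(p + 1) ^ i + 1)` -/

section Rate

/-- The factor by which the `i`-th iterate is closer to the limit than the bound for `T 0`. -/
noncomputable def rate (p i : ℕ) : ℝ := (2 : ℝ) ^ (-(((p : ℤ) + 1) ^ i) + 1)

lemma rate_pos (p i : ℕ) : 0 < rate p i := zpow_pos two_pos _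

lemma rate_zero (p : ℕ) : rate p 0 = 1 := by simp [rate]

lemma rate_succ (p i : ℕ) : rate p (i + 1) = rate p i * (rate p i / 2) ^ p := by
  have h2 : (2 : ℝ) ≠ 0 := two_ne_zero
  have h1 : rate p i / 2 = (2 : ℝ) ^ (-(((p : ℤ) + 1) ^ i)) := by
    rw [rate, zpow_add₀ h2, zpow_one, mul_div_cancel_right₀ _ h2]
  rw [h1, rate, rate, ← zpow_natCast, ← zpow_mul, ← zpow_add₀ h2]
  congr 1
  ring

lemma rate_le_one (p i : ℕ) : rate p i ≤ 1 := by
  induction i with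
  | zero => rw [rate_zero]
  | succ i ih =>
    have h0 := rate_pos p i
    rw [rate_succ]
    exact mul_le_one₀ ih (by positivity) (pow_le_one₀ (by positivity) (by linarith))

lemma rate_succ_le (p i : ℕ) : rate p (i + 1) ≤ (1 / 2) ^ p * rate p i := by
  have h0 := rate_pos p i
  rw [rate_succ, mul_comm]
  gcongr
  exact rate_le_one p i

end Rate

/-! ### Convergence of the singular vectors -/

section Limit

open Filter Topology

variable {r k : ℕ}

lemma le_geometric_of_succ_le {w : ℕ → ℝ} {ρ : ℝ} (hρ : 0 ≤ ρ) (hw : ∀ i, w (i + 1) ≤ ρ * w i)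
    (i j : ℕ) : w (i + j) ≤ w i * ρ ^ j := by
  induction j with
  | zero => simp
  | succ j ih =>
    calc w (i + j + 1) ≤ ρ * w (i + j) := hw _
      _ ≤ ρ * (w i * ρ ^ j) := by gcongr
      _ = _ := by ring

/-- The distance of an iterate to all later ones is bounded by the sum of a geometric series. -/
lemma rowNorm_sub_le_of_geometric {A : ℕ → Matrix (Fin r) (Fin k) ℂ} {w : ℕ → ℝ} {b ρ : ℝ}
    (hb : 0 ≤ b) (hρ : ρ < 1) (hw0 : ∀ i, 0 ≤ w i)
    (hw : ∀ i, w (i + 1) ≤ ρ * w i) (hA : ∀ i, rowNorm (A (i + 1) - A i) ≤ b * w i) (i j : ℕ) :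
    rowNorm (A i - A (i + j)) ≤ b * w i / (1 - ρ) := by
  -- the bound with a remainder is what passes through the induction
  suffices h : rowNorm (A i - A (i + j)) ≤ b * (w i - w (i + j)) / (1 - ρ) by
    refine h.trans (div_le_div_of_nonneg_right ?_ (by linarith))
    exact mul_le_mul_of_nonneg_left (by linarith [hw0 (i + j)]) hb
  induction j with
  | zero => simp [(rowNorm_le_iff (A := (0 : Matrix (Fin r) (Fin k) ℂ)) le_rfl).2]
  | succ j ih =>
    have h1 : A i - A (i + (j + 1)) = (A i - A (i + j)) + -(A (i + j + 1) - A (i + j)) := by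
      rw [← add_assoc]; abel
    have h2 : w (i + j) ≤ (w (i + j) - w (i + j + 1)) / (1 - ρ) := by
      rw [le_div_iff₀ (by linarith)]
      linarith [hw (i + j)]
    calc _ ≤ rowNorm (A i - A (i + j)) + b * w (i + j) := by
          rw [h1]
          refine (rowNorm_add_le _ _).trans (add_le_add le_rfl ?_)
          rw [rowNorm_neg]
          exact hA _
      _ ≤ b * (w i - w (i + j)) / (1 - ρ)
          + b * ((w (i + j) - w (i + j + 1)) / (1 - ρ)) := by gcongr
      _ = _ := by rw [← add_assoc]; ring

lemma rowNorm_sub_lim_le {A : ℕ → Matrix (Fin r) (Fin k) ℂ} {B : Matrix (Fin r) (Fin k) ℂ}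
    (hA : Tendsto A atTop (𝓝 B)) {b : ℝ} (hb : 0 ≤ b) {i : ℕ}
    (h : ∀ j, rowNorm (A i - A (i + j)) ≤ b) : rowNorm (A i - B) ≤ b := by
  refine (rowNorm_le_iff hb).2 fun x => ?_
  have hent : ∀ y, Tendsto (fun j => ‖(A i - A (j + i)) x y‖) atTop (𝓝 ‖(A i - B) x y‖) := by
    intro y
    have h1 := tendsto_pi_nhds.1 (tendsto_pi_nhds.1 hA x) y
    have h2 := (tendsto_add_atTop_iff_nat i).2 h1
    simpa only [Matrix.sub_apply] using (h2.const_sub (A i x y)).norm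
  refine le_of_tendsto' (tendsto_finsetSum Finset.univ fun y _ => hent y) fun j => ?_
  rw [add_comm]
  exact (row_sum_le _ x).trans (h j)

lemma tendsto_zero_of_matNorm_le {A : ℕ → Matrix (Fin r) (Fin k) ℂ} {w : ℕ → ℝ}
    (hw : Tendsto w atTop (𝓝 0)) (hA : ∀ i, matNorm (A i) ≤ w i) : Tendsto A atTop (𝓝 0) :=
  tendsto_pi_nhds.2 fun x => tendsto_pi_nhds.2 fun y =>
    squeeze_zero_norm (fun i => (norm_apply_le_matNorm (A i) x y).trans (hA i)) hw

lemma tendsto_zero_of_succ_le {w : ℕ → ℝ} {ρ : ℝ} (hρ0 : 0 ≤ ρ) (hρ : ρ < 1)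
    (hw0 : ∀ i, 0 ≤ w i) (hw : ∀ i, w (i + 1) ≤ ρ * w i) : Tendsto w atTop (𝓝 0) := by
  refine squeeze_zero hw0 (fun i => ?_)
    (by simpa using (tendsto_pow_atTop_nhds_zero_of_lt_one hρ0 hρ).const_mul (w 0))
  simpa using le_geometric_of_succ_le hρ0 hw 0 i

/-- Nearly isometric matrices `U i`, each obtained from the previous one by a right factor `1 + Γ`
with small `Γ`, converge to an isometric matrix. It is a right multiple of each `U i`, because
`U i (U i^* U i)⁻¹ U i^*` fixes all later `U j`. -/
lemma exists_limit_of_factors (hk : k ≤ r) {U : ℕ → Matrix (Fin r) (Fin k) ℂ} {w : ℕ → ℝ}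
    {g ρ u C : ℝ} (hg : 0 ≤ g) (hρ0 : 0 ≤ ρ) (hρ : ρ < 1) (hw0 : ∀ i, 0 ≤ w i)
    (hw : ∀ i, w (i + 1) ≤ ρ * w i) (hE : ∀ i, matNorm (stiefelDefect (U i)) ≤ w i)
    (hwu : ∀ i, w i ≤ u) (hu : u < 1)
    (hstep : ∀ i, ∃ Γ : Matrix (Fin k) (Fin k) ℂ, U (i + 1) = U i * (1 + Γ) ∧
      matNorm Γ ≤ g * w i)
    (hC : √(1 + u) * g ≤ C * (1 - ρ)) :
    ∃ B : Matrix (Fin r) (Fin k) ℂ, Tendsto U atTop (𝓝 B) ∧ stiefelDefect B = 0 ∧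
      (∀ i, ∃ P : Matrix (Fin k) (Fin k) ℂ, B = U i * P) ∧ (∀ i, matNorm (U i - B) ≤ C * √(r : ℝ) * w i) ∧
      ∀ i, rowNorm (U i - B) ≤ C * √(k : ℝ) * w i := by
  have hsub : ∀ i, ∀ Γ : Matrix (Fin k) (Fin k) ℂ, U i * (1 + Γ) - U i = U i * Γ := by
    intro i Γ; rw [Matrix.mul_add, Matrix.mul_one]; abel
  have hsqrt : ∀ i, √(1 + matNorm (stiefelDefect (U i))) ≤ √(1 + u) := fun i =>
    Real.sqrt_le_sqrt (by linarith [hE i, hwu i])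
  have hrow : ∀ i, rowNorm (U (i + 1) - U i) ≤ √(k : ℝ) * √(1 + u) * g * w i := by
    intro i
    obtain ⟨Γ, h1, h2⟩ := hstep i
    rw [h1, hsub, mul_assoc _ g]
    refine (rowNorm_mul_le _ _).trans (mul_le_mul ?_ ((rowNorm_le_matNorm Γ).trans h2)
      (rowNorm_nonneg _) (by positivity))
    exact (rowNorm_le_of_stiefelDefect (U i)).trans (by gcongr ?_ * ?_; exact hsqrt i)
  have hmat : ∀ i, matNorm (U (i + 1) - U i) ≤ √(r : ℝ) * √(1 + u) * g * w i := by
    intro i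
    obtain ⟨Γ, h1, h2⟩ := hstep i
    rw [h1, hsub, mul_assoc _ g]
    refine matNorm_mul_le ?_ h2
    exact (matNorm_le_of_stiefelDefect hk (U i)).trans (by gcongr ?_ * ?_; exact hsqrt i)
  have hcol : ∀ i, rowNorm ((U (i + 1))ᴴ - (U i)ᴴ) ≤ √(r : ℝ) * √(1 + u) * g * w i := by
    intro i
    rw [← Matrix.conjTranspose_sub]
    exact (le_max_right _ _).trans (hmat i)
  have hC0 : 0 ≤ C := by
    by_contra hneg
    have : C * (1 - ρ) < 0 := mul_neg_of_neg_of_pos (not_le.1 hneg) (by linarith)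
    linarith [mul_nonneg (Real.sqrt_nonneg (1 + u)) hg]
  have hfin : ∀ (N : ℕ) (i : ℕ), √(N : ℝ) * √(1 + u) * g * w i / (1 - ρ) ≤ C * √(N : ℝ) * w i := by
    intro N i
    rw [div_le_iff₀ (by linarith)]
    calc _ = √(N : ℝ) * w i * (√(1 + u) * g) := by ring
      _ ≤ √(N : ℝ) * w i * (C * (1 - ρ)) := by
        have := hw0 i
        gcongr
      _ = _ := by ring
  have hcauchy : ∀ x y, ∃ z : ℂ, Tendsto (fun i => U i x y) atTop (𝓝 z) := by
    intro x y
    refine cauchySeq_tendsto_of_complete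
      (cauchySeq_of_le_geometric ρ (√(r : ℝ) * √(1 + u) * g * w 0) hρ fun i => ?_)
    rw [dist_comm, dist_eq_norm, ← Matrix.sub_apply]
    refine ((norm_apply_le_matNorm _ x y).trans (hmat i)).trans ?_
    rw [mul_assoc _ (w 0)]
    gcongr
    simpa using le_geometric_of_succ_le hρ0 hw 0 i
  choose B hB using hcauchy
  have hlim : Tendsto U atTop (𝓝 (Matrix.of B)) :=
    tendsto_pi_nhds.2 fun x => tendsto_pi_nhds.2 fun y => hB x y
  have hrowlim : ∀ i, rowNorm (U i - Matrix.of B) ≤ C * √(k : ℝ) * w i := fun i =>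
    rowNorm_sub_lim_le hlim (mul_nonneg (by positivity) (hw0 i)) fun j =>
      (rowNorm_sub_le_of_geometric (by positivity) hρ hw0 hw hrow i j).trans (hfin k i)
  refine ⟨Matrix.of B, hlim, ?_, fun i => ?_, fun i => max_le ((hrowlim i).trans ?_) ?_, hrowlim⟩
  · have h1 : Tendsto (fun i => stiefelDefect (U i)) atTop (𝓝 (stiefelDefect (Matrix.of B))) := by
      have hc : Continuous fun A : Matrix (Fin r) (Fin k) ℂ => stiefelDefect A := by
        unfold stiefelDefect; fun_prop
      exact (hc.tendsto _).comp hlim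
    exact tendsto_nhds_unique h1
      (tendsto_zero_of_matNorm_le (tendsto_zero_of_succ_le hρ0 hρ hw0 hw) hE)
  · have hdet : IsUnit (1 + stiefelDefect (U i)).det :=
      isUnit_det_one_add (((hE i).trans (hwu i)).trans_lt hu)
    have hfac : ∀ j, ∃ P : Matrix (Fin k) (Fin k) ℂ, U (j + i) = U i * P := by
      intro j
      induction j with
      | zero => exact ⟨1, by simp⟩
      | succ j ih =>
        obtain ⟨P, hP⟩ := ih
        obtain ⟨Γ, hΓ, -⟩ := hstep (j + i)
        exact ⟨P * (1 + Γ), by rw [add_right_comm, hΓ, hP, Matrix.mul_assoc]⟩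
    have hfix : ∀ j, U i * ((1 + stiefelDefect (U i))⁻¹ * ((U i)ᴴ * U (j + i))) = U (j + i) := by
      intro j
      obtain ⟨P, hP⟩ := hfac j
      rw [hP, ← Matrix.mul_assoc (U i)ᴴ, ← one_add_stiefelDefect,
        Matrix.nonsing_inv_mul_cancel_left _ _ hdet]
    refine ⟨(1 + stiefelDefect (U i))⁻¹ * ((U i)ᴴ * Matrix.of B), ?_⟩
    have hlim' := (tendsto_add_atTop_iff_nat i).2 hlim
    have hc : Continuous fun A : Matrix (Fin r) (Fin k) ℂ =>
        U i * ((1 + stiefelDefect (U i))⁻¹ * ((U i)ᴴ * A)) := by fun_prop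
    refine tendsto_nhds_unique hlim' (((hc.tendsto _).comp hlim').congr fun j => ?_)
    exact hfix j
  · have := hw0 i
    gcongr
  · have hlimH : Tendsto (fun i => (U i)ᴴ) atTop (𝓝 (Matrix.of B)ᴴ) :=
      ((continuous_id.matrix_conjTranspose).tendsto _).comp hlim
    rw [Matrix.conjTranspose_sub]
    refine rowNorm_sub_lim_le (A := fun i => (U i)ᴴ) hlimH
      (mul_nonneg (by positivity) (hw0 i)) fun j => ?_
    exact (rowNorm_sub_le_of_geometric (A := fun i => (U i)ᴴ) (by positivity) hρ hw0 hw hcol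
      i j).trans (hfin r i)

end Limit

/-! ### Convergence of the singular values -/

section Sigma

open Filter Topology

variable {m n ℓ q p : ℕ} {M : Matrix (Fin m) (Fin n) ℂ}

lemma pos_of_small_change {σ σ' : Fin q → ℝ} (hσ : IsRegular σ)
    (hs : ∀ i, 2 * (kappa σ * |σ' i - σ i|) < 1) {j : Fin q} (hj : 0 < σ j) : 0 < σ' j := by
  have hk := kappa_pos σ
  have h1 := one_le_kappa_mul_abs (hσ.1 j) (inv_abs_le_kappa σ j)
  rw [abs_of_pos hj] at h1
  have h2 : kappa σ * (σ j - σ' j) ≤ kappa σ * |σ' j - σ j| :=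
    mul_le_mul_of_nonneg_left (by rw [abs_sub_comm]; exact le_abs_self _) hk.le
  refine pos_of_mul_pos_right (a := kappa σ) ?_ hk.le
  linarith [hs j]

lemma neg_of_small_change {σ σ' : Fin q → ℝ} (hσ : IsRegular σ)
    (hs : ∀ i, 2 * (kappa σ * |σ' i - σ i|) < 1) {j : Fin q} (hj : σ j < 0) : σ' j < 0 := by
  have hk := kappa_pos σ
  have h1 := one_le_kappa_mul_abs (hσ.1 j) (inv_abs_le_kappa σ j)
  rw [abs_of_neg hj] at h1
  have h2 : kappa σ * (σ' j - σ j) ≤ kappa σ * |σ' j - σ j| :=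
    mul_le_mul_of_nonneg_left (le_abs_self _) hk.le
  have h3 : kappa σ * σ' j < 0 := by linarith [hs j]
  exact neg_of_mul_neg_right h3 hk.le

/-- The gap between `|σ j|` and `|σ k|` is at least `1 / κ`. -/
lemma abs_lt_abs_of_small_change {σ σ' : Fin q → ℝ} (hσ : IsRegular σ)
    (hs : ∀ i, 2 * (kappa σ * |σ' i - σ i|) < 1) {j k : Fin q} (hjk : |σ j| < |σ k|) :
    |σ' j| < |σ' k| := by
  have hκ := kappa_pos σ
  have hne : k ≠ j := by rintro rfl; exact lt_irrefl _ hjk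
  have hgap : 1 ≤ kappa σ * (|σ k| - |σ j|) := by
    have h1 := one_le_kappa_mul_abs (hσ.2 k j hne).1 (inv_abs_sub_le_kappa σ hne)
    have h2 := one_le_kappa_mul_abs (hσ.2 k j hne).2 (inv_abs_add_le_kappa σ hne)
    have h3 : |σ k - σ j| = |σ k| - |σ j| ∨ |σ k + σ j| = |σ k| - |σ j| := by
      rcases abs_cases (σ k) with ⟨a1, a2⟩ | ⟨a1, a2⟩ <;>
      rcases abs_cases (σ j) with ⟨b1, b2⟩ | ⟨b1, b2⟩ <;> rw [a1, b1] at hjk <;>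
      rw [a1, b1]
      · left; rw [abs_of_nonneg (by linarith)]
      · right; rw [abs_of_nonneg (by linarith)]; ring
      · right; rw [abs_of_nonpos (by linarith)]; ring
      · left; rw [abs_of_nonpos (by linarith)]; ring
    rcases h3 with h3 | h3
    · rwa [h3] at h1
    · rwa [h3] at h2
  have hdiff : ∀ i, kappa σ * |(|σ' i| - |σ i|)| ≤ kappa σ * |σ' i - σ i| := fun i =>
    mul_le_mul_of_nonneg_left (abs_abs_sub_abs_le_abs_sub _ _) hκ.le
  have hk1 : kappa σ * (|σ k| - |σ' k|) ≤ kappa σ * |(|σ' k| - |σ k|)| :=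
    mul_le_mul_of_nonneg_left (by rw [abs_sub_comm]; exact le_abs_self _) hκ.le
  have hj1 : kappa σ * (|σ' j| - |σ j|) ≤ kappa σ * |(|σ' j| - |σ j|)| :=
    mul_le_mul_of_nonneg_left (le_abs_self _) hκ.le
  refine lt_of_mul_lt_mul_left (a := kappa σ) ?_ hκ.le
  linarith [hs j, hs k, hdiff j, hdiff k]

/-- Signs and the order of the `|σ j|` never change, so they persist weakly in the limit. -/
lemma sign_and_order_of_limit {σ : ℕ → Fin q → ℝ} {τ : Fin q → ℝ} (hσ : ∀ i, IsRegular (σ i))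
    (hs : ∀ i j, 2 * (kappa (σ i) * |σ (i + 1) j - σ i j|) < 1)
    (hτ : ∀ j, Tendsto (fun i => σ i j) atTop (𝓝 (τ j))) (i : ℕ) :
    (∀ j, 0 < σ i j → 0 ≤ τ j) ∧ (∀ j, σ i j < 0 → τ j ≤ 0) ∧
      ∀ j k, |σ i j| < |σ i k| → |τ j| ≤ |τ k| := by
  have hτ' : ∀ j, Tendsto (fun x => σ (x + i) j) atTop (𝓝 (τ j)) := fun j =>
    (tendsto_add_atTop_iff_nat i).2 (hτ j)
  refine ⟨fun j hj => ?_, fun j hj => ?_, fun j k hjk => ?_⟩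
  · refine ge_of_tendsto' (hτ' j) fun x => le_of_lt ?_
    induction x with
    | zero => simpa using hj
    | succ x ih => rw [add_right_comm]; exact pos_of_small_change (hσ _) (hs _) ih
  · refine le_of_tendsto' (hτ' j) fun x => le_of_lt ?_
    induction x with
    | zero => simpa using hj
    | succ x ih => rw [add_right_comm]; exact neg_of_small_change (hσ _) (hs _) ih
  · refine le_of_tendsto_of_tendsto' (hτ' j).abs (hτ' k).abs fun x => le_of_lt ?_
    induction x with
    | zero => simpa using hjk
    | succ x ih => rw [add_right_comm]; exact abs_lt_abs_of_small_change (hσ _) (hs _) ih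

/-- `‖Δ‖` and `|σ j| ‖E‖` are both bounded by `w / (κ (κ K) ^ (a - 1))`. -/
lemma IsApprox.sigma_bound {T : Triplet m n ℓ q} {w : ℝ} (hT : IsApprox (aConst p) M T w)
    (hq : 1 ≤ q) (hw : w ≤ u0Const p) (j : Fin q) :
    ∃ e, matNorm (stiefelDefect T.U) ≤ e ∧ matNorm (stiefelDefect T.V) ≤ e ∧ e < 1 ∧
      (matNorm (HighOrderSVD.residual M T) + |T.σ j| * e) / (1 - e) ≤ sigmaConst p q * w := by
  have hw0 := hT.nonneg
  have hκ := kappa_pos T.σ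
  have hy1 := one_le_kappa_mul_bigK T.σ
  have ha : 1 ≤ aConst p := by unfold aConst; split_ifs <;> norm_num
  have hz1 : 1 ≤ (kappa T.σ * bigK T.σ) ^ (aConst p - 1) :=
    Real.one_le_rpow hy1 (by linarith)
  have hU := hT.defectU
  have hV := hT.defectV
  have hD := hT.residual
  rw [kappa_bigK_rpow] at hU hV
  rw [kappa_rpow_mul_bigK_rpow] at hD
  set z := (kappa T.σ * bigK T.σ) ^ (aConst p - 1) with hz
  have hK := zero_lt_one.trans_le (one_le_bigK T.σ)
  have hyz : 0 < kappa T.σ * bigK T.σ * z := by positivity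
  have hκz : 0 < kappa T.σ * z := by positivity
  have hκz1 : 1 ≤ kappa T.σ * z := one_le_mul_of_one_le_of_one_le (one_le_kappa T.σ) hz1
  have he : w / (kappa T.σ * bigK T.σ * z) ≤ u0Const p := by
    refine le_trans (div_le_self hw0 ?_) hw
    exact one_le_mul_of_one_le_of_one_le hy1 hz1
  have hu1 : u0Const p < 1 := by unfold u0Const; split_ifs <;> norm_num
  refine ⟨w / (kappa T.σ * bigK T.σ * z), (le_div_iff₀' hyz).2 hU, (le_div_iff₀' hyz).2 hV,
    he.trans_lt hu1, ?_⟩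
  have h1 : matNorm (HighOrderSVD.residual M T) + |T.σ j| * (w / (kappa T.σ * bigK T.σ * z))
      ≤ 2 * (w / (kappa T.σ * z)) := by
    have h2 : |T.σ j| * (w / (kappa T.σ * bigK T.σ * z)) ≤ w / (kappa T.σ * z) := by
      calc _ ≤ bigK T.σ * (w / (kappa T.σ * bigK T.σ * z)) := by
            gcongr; exact abs_le_bigK T.σ j
        _ = _ := by field_simp
    have h3 : matNorm (HighOrderSVD.residual M T) ≤ w / (kappa T.σ * z) := (le_div_iff₀' hκz).2 hD
    linarith
  rw [div_le_iff₀ (by linarith)]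
  have h4 : sigmaConst p q * w * (1 - u0Const p)
      ≤ sigmaConst p q * w * (1 - w / (kappa T.σ * bigK T.σ * z)) := by
    have : 0 ≤ sigmaConst p q := by unfold sigmaConst; split_ifs <;> norm_num
    gcongr
  refine (h1.trans ?_).trans h4
  -- for `p = 1` and `q ≥ 2` the bound `2 ≤ κ K` gains a factor `2`
  by_cases hpq : p = 1 ∧ q ≠ 1
  · obtain ⟨rfl, hq1⟩ := hpq
    have hz2 : 2 ≤ z := by
      rw [hz]
      norm_num [aConst]
      exact two_le_kappa_mul_bigK hT.reg (by omega)
    have h5 : w / (kappa T.σ * z) ≤ w / 2 := by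
      gcongr
      exact hz2.trans (le_mul_of_one_le_left (by linarith) (one_le_kappa T.σ))
    simp only [sigmaConst, u0Const, hq1, if_true, if_false]
    linarith
  · have h5 : w / (kappa T.σ * z) ≤ w := div_le_self hw0 hκz1
    unfold sigmaConst u0Const
    split_ifs with h6 h7 h7
    · linarith
    · exact absurd ⟨h6, h7⟩ hpq
    · linarith
    · linarith

lemma IsApprox.mono {a w w' : ℝ} {T : Triplet m n ℓ q} (hT : IsApprox a M T w) (h : w ≤ w') :
    IsApprox a M T w' :=
  ⟨hT.reg, hT.defectU.trans h, hT.defectV.trans h, hT.residual.trans h⟩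

lemma IsApprox.matNorm_le {a w : ℝ} {T : Triplet m n ℓ q} (ha : 1 ≤ a) (hT : IsApprox a M T w) :
    matNorm (stiefelDefect T.U) ≤ w ∧ matNorm (stiefelDefect T.V) ≤ w ∧
      matNorm (HighOrderSVD.residual M T) ≤ w := by
  have hy1 := Real.one_le_rpow (one_le_kappa_mul_bigK T.σ) (by linarith : 0 ≤ a)
  have h1 := Real.one_le_rpow (one_le_kappa T.σ) (by linarith : 0 ≤ a)
  have h2 := Real.one_le_rpow (one_le_bigK T.σ) (by linarith : 0 ≤ a - 1)
  exact ⟨(le_mul_of_one_le_left (matNorm_nonneg _) hy1).trans hT.defectU,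
    (le_mul_of_one_le_left (matNorm_nonneg _) hy1).trans hT.defectV,
    (le_mul_of_one_le_left (matNorm_nonneg _) (one_le_mul_of_one_le_of_one_le h1 h2)).trans
      hT.residual⟩

lemma factorConst_nonneg (p : ℕ) : 0 ≤ factorConst p := by
  unfold factorConst; split_ifs <;> norm_num

/-- The sum of the geometric series of corrections stays below `γ₁`. -/
lemma sqrt_mul_factorConst_le (hp : 1 ≤ p) :
    √(1 + u0Const p) * factorConst p ≤ gammaConst p * (1 - (1 / 2) ^ p) := by
  by_cases h1 : p = 1
  · subst h1
    have hs : √(1 + u0Const 1) ≤ 1.0145 := by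
      rw [Real.sqrt_le_left (by norm_num)]; norm_num [u0Const]
    simp only [factorConst, gammaConst, if_true]
    norm_num at hs ⊢
    linarith
  · have hs : √(1 + u0Const p) ≤ 1.023 := by
      rw [Real.sqrt_le_left (by norm_num)]; unfold u0Const; split_ifs; norm_num; norm_num
    have hpow : (1 / 2 : ℝ) ^ p ≤ (1 / 2) ^ 2 :=
      pow_le_pow_of_le_one (by norm_num) (by norm_num) (by omega)
    have hg : (9.41 : ℝ) ≤ gammaConst p := by
      unfold gammaConst; split_ifs; norm_num; norm_num
    calc √(1 + u0Const p) * factorConst p ≤ 1.023 * factorConst p := by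
          gcongr; exact factorConst_nonneg p
      _ ≤ 9.41 * (1 - (1 / 2) ^ 2) := by simp only [factorConst, h1, if_false]; norm_num
      _ ≤ _ := by gcongr

end Sigma

/-! ### Convergence of the iteration -/

section Iteration

open Filter Topology

variable {m n ℓ q p : ℕ} {M : Matrix (Fin m) (Fin n) ℂ}

/-- All iterates satisfy the hypothesis of the theorem, with `ε` replaced by
`2 ^ (-(p + 1) ^ i + 1) ε` and with their own condition numbers. -/
lemma isApprox_iterate {h : q ≤ ℓ} {T : ℕ → Triplet m n ℓ q} {ε : ℝ} (hp : 1 ≤ p) (hq : 1 ≤ q)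
    (hT : ∀ i, T (i + 1) = mapH p h M (T i)) (h0 : IsApprox (aConst p) M (T 0) ε)
    (hε : ε ≤ u0Const p) (i : ℕ) : IsApprox (aConst p) M (T i) (rate p i * ε) := by
  have hε0 := h0.nonneg
  induction i with
  | zero => rwa [rate_zero, one_mul]
  | succ i ih =>
    have hr0 := rate_pos p i
    have hu : 0 < u0Const p := by unfold u0Const; split_ifs <;> norm_num
    rw [hT]
    have hle : rate p i * ε ≤ u0Const p :=
      (mul_le_of_le_one_left hε0 (rate_le_one p i)).trans hε
    refine (isGoodStep hp hq ih hle).approx.mono ?_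
    have h1 : rate p i * ε / (2 * u0Const p) ≤ rate p i / 2 := by
      rw [div_le_div_iff₀ (by positivity) two_pos]
      nlinarith [mul_le_mul_of_nonneg_left hε hr0.le]
    calc rate p i * ε * (rate p i * ε / (2 * u0Const p)) ^ p
        ≤ rate p i * ε * (rate p i / 2) ^ p := by gcongr
      _ = rate p (i + 1) * ε := by rw [rate_succ]; ring

/-- The singular values of the limit are as close to those of an iterate as its defects are
small. -/
lemma abs_sigma_sub_le (h : q ≤ ℓ) {T T' : Triplet m n ℓ q} {w : ℝ} (hq : 1 ≤ q)
    (hT : IsApprox (aConst p) M T w) (hw : w ≤ u0Const p) (hT' : IsSVDSolution M T')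
    (hU : ∃ P : Matrix (Fin ℓ) (Fin ℓ) ℂ, T'.U = T.U * P)
    (hV : ∃ N : Matrix (Fin q) (Fin q) ℂ, T'.V = T.V * N)
    (hpos : ∀ j, 0 < T.σ j → 0 ≤ T'.σ j) (hneg : ∀ j, T.σ j < 0 → T'.σ j ≤ 0)
    (hord : ∀ j k, |T.σ j| < |T.σ k| → |T'.σ j| ≤ |T'.σ k|) (j : Fin q) :
    |T.σ j - T'.σ j| ≤ sigmaConst p q * w := by
  obtain ⟨P, hP⟩ := hU
  obtain ⟨N, hN⟩ := hV
  obtain ⟨e, he₁, he₂, he, hbound⟩ := hT.sigma_bound hq hw j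
  have h1 := abs_abs_sub_abs_le h he₁ he₂ he hT' hP hN j (hord j) fun k hk =>
    not_lt.1 fun h' => absurd (hord k j h') (not_le.2 hk)
  refine le_trans (le_of_eq ?_) (h1.trans hbound)
  rcases lt_or_gt_of_ne (hT.reg.1 j) with hj | hj
  · rw [abs_of_neg hj, abs_of_nonpos (hneg j hj), neg_sub_neg]
  · rw [abs_of_pos hj, abs_of_nonneg (hpos j hj), abs_sub_comm]

lemma tendsto_conjTranspose_mul_mul (M : Matrix (Fin m) (Fin n) ℂ)
    {U : ℕ → Matrix (Fin m) (Fin ℓ) ℂ} {V : ℕ → Matrix (Fin n) (Fin q) ℂ}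
    {A : Matrix (Fin m) (Fin ℓ) ℂ} {B : Matrix (Fin n) (Fin q) ℂ}
    (hU : Tendsto U atTop (𝓝 A)) (hV : Tendsto V atTop (𝓝 B)) :
    Tendsto (fun i => (U i)ᴴ * M * V i) atTop (𝓝 (Aᴴ * M * B)) := by
  have hc : Continuous fun X : Matrix (Fin m) (Fin ℓ) ℂ => Xᴴ * M := by fun_prop
  have hUM : Tendsto (fun i => (U i)ᴴ * M) atTop (𝓝 (Aᴴ * M)) := (hc.tendsto A).comp hU
  refine tendsto_pi_nhds.2 fun x => tendsto_pi_nhds.2 fun y => ?_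
  rw [Matrix.mul_apply]
  refine (tendsto_finsetSum Finset.univ fun z _ => ?_).congr fun i => (Matrix.mul_apply ..).symm
  exact (tendsto_pi_nhds.1 (tendsto_pi_nhds.1 hUM x) z).mul
    (tendsto_pi_nhds.1 (tendsto_pi_nhds.1 hV z) y)

lemma exists_limit_of_rectDiag (h : q ≤ ℓ) {σ : ℕ → Fin q → ℝ} {D : Matrix (Fin ℓ) (Fin q) ℂ}
    (hD : Tendsto (fun i => rectDiag ℓ (σ i)) atTop (𝓝 D)) :
    ∃ τ : Fin q → ℝ, D = rectDiag ℓ τ ∧ ∀ j, Tendsto (fun i => σ i j) atTop (𝓝 (τ j)) := by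
  have hent := fun x y => tendsto_pi_nhds.1 (tendsto_pi_nhds.1 hD x) y
  have hτ : ∀ j, Tendsto (fun i => σ i j) atTop (𝓝 (D (Fin.castLE h j) j).re) := fun j => by
    have := (Complex.continuous_re.tendsto _).comp (hent (Fin.castLE h j) j)
    simpa [Function.comp_def, rectDiag] using this
  refine ⟨fun j => (D (Fin.castLE h j) j).re, ?_, hτ⟩
  refine tendsto_nhds_unique hD (tendsto_pi_nhds.2 fun x => tendsto_pi_nhds.2 fun y => ?_)
  simp only [rectDiag, Matrix.of_apply]
  split_ifs
  · exact (Complex.continuous_ofReal.tendsto _).comp (hτ y)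
  · exact tendsto_const_nhds

theorem exists_limit_of_isApprox {h : q ≤ ℓ} (hℓm : ℓ ≤ m) (hqn : q ≤ n)
    {T : ℕ → Triplet m n ℓ q} {ε : ℝ} (hp : 1 ≤ p) (hq : 1 ≤ q)
    (hT : ∀ i, T (i + 1) = mapH p h M (T i)) (h0 : IsApprox (aConst p) M (T 0) ε)
    (hε : ε ≤ u0Const p) :
    ∃ Tlim : Triplet m n ℓ q, IsSVDSolution M Tlim ∧
      ((∀ j, 0 ≤ (T 0).σ j) → ∀ j, 0 ≤ Tlim.σ j) ∧
      ∀ i : ℕ,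
        matNorm ((T i).U - Tlim.U) ≤ gammaConst p * √(m : ℝ) * rate p i * ε ∧
        rowNorm ((T i).U - Tlim.U) ≤ gammaConst p * √(ℓ : ℝ) * rate p i * ε ∧
        matNorm ((T i).V - Tlim.V) ≤ gammaConst p * √(n : ℝ) * rate p i * ε ∧
        rowNorm ((T i).V - Tlim.V) ≤ gammaConst p * √(q : ℝ) * rate p i * ε ∧
        matNorm (rectDiag ℓ (T i).σ - rectDiag ℓ Tlim.σ) ≤ sigmaConst p q * rate p i * ε := by
  have hε0 := h0.nonneg
  have ha : 1 ≤ aConst p := by unfold aConst; split_ifs <;> norm_num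
  have hu1 : u0Const p < 1 := by unfold u0Const; split_ifs <;> norm_num
  have happ := isApprox_iterate hp hq hT h0 hε
  have hw0 : ∀ i, 0 ≤ rate p i * ε := fun i => (happ i).nonneg
  have hwu : ∀ i, rate p i * ε ≤ u0Const p := fun i =>
    (mul_le_of_le_one_left hε0 (rate_le_one p i)).trans hε
  have hstep := fun i => isGoodStep (h := h) hp hq (happ i) (hwu i)
  simp only [← hT] at hstep
  have hρ0 : (0 : ℝ) ≤ (1 / 2) ^ p := by positivity
  have hρ : (1 / 2 : ℝ) ^ p < 1 := pow_lt_one₀ (by norm_num) (by norm_num) (by omega)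
  have hw : ∀ i, rate p (i + 1) * ε ≤ (1 / 2) ^ p * (rate p i * ε) := fun i => by
    rw [← mul_assoc]
    exact mul_le_mul_of_nonneg_right (rate_succ_le p i) hε0
  have hC := sqrt_mul_factorConst_le hp
  obtain ⟨U, hU, hEU, hUP, hUm, hUr⟩ := exists_limit_of_factors hℓm (factorConst_nonneg p)
    hρ0 hρ hw0 hw (fun i => ((happ i).matNorm_le ha).1) hwu hu1 (fun i => (hstep i).factorU) hC
  obtain ⟨V, hV, hEV, hVP, hVm, hVr⟩ := exists_limit_of_factors hqn (factorConst_nonneg p)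
    hρ0 hρ hw0 hw (fun i => ((happ i).matNorm_le ha).2.1) hwu hu1 (fun i => (hstep i).factorV) hC
  have hΔ : Tendsto (fun i => residual M (T i)) atTop (𝓝 0) :=
    tendsto_zero_of_matNorm_le (tendsto_zero_of_succ_le hρ0 hρ hw0 hw)
      fun i => ((happ i).matNorm_le ha).2.2
  have hUMV := tendsto_conjTranspose_mul_mul M hU hV
  have hdiag : Tendsto (fun i => rectDiag ℓ (T i).σ) atTop (𝓝 (Uᴴ * M * V)) := by
    have := hUMV.sub hΔ
    rw [sub_zero] at this
    exact this.congr fun i => by rw [residual]; abel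
  obtain ⟨τ, hlim, hτ⟩ := exists_limit_of_rectDiag h hdiag
  have hsol : IsSVDSolution M (⟨U, V, τ⟩ : Triplet m n ℓ q) :=
    ⟨hEU, hEV, by rw [residual, hlim, sub_self]⟩
  have hsign := sign_and_order_of_limit (fun i => (happ i).reg) (fun i => (hstep i).sigma) hτ
  refine ⟨⟨U, V, τ⟩, hsol, fun hnn j => ?_, fun i => ⟨?_, ?_, ?_, ?_, ?_⟩⟩
  · exact (hsign 0).1 j (lt_of_le_of_ne (hnn j) ((happ 0).reg.1 j).symm)
  · rw [mul_assoc]; exact hUm i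
  · rw [mul_assoc]; exact hUr i
  · rw [mul_assoc]; exact hVm i
  · rw [mul_assoc]; exact hVr i
  · obtain ⟨h1, h2, h3⟩ := hsign i
    have hσ := abs_sigma_sub_le h hq (happ i) (hwu i) hsol (hUP i) (hVP i) h1 h2 h3
    rw [← rectDiag_sub, mul_assoc]
    have hs : 0 ≤ sigmaConst p q := by unfold sigmaConst; split_ifs <;> norm_num
    exact matNorm_rectDiag_le (mul_nonneg hs (hw0 i)) hσ

end Iteration

end HighOrderSVD

theorem theorem1 {m n ℓ q p : ℕ} (hp : 1 ≤ p) (hq : 1 ≤ q) (hqℓ : q ≤ ℓ) (hℓm : ℓ ≤ m)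
    (hqn : q ≤ n) (M : Matrix (Fin m) (Fin n) ℂ)
    (T : ℕ → HighOrderSVD.Triplet m n ℓ q)
    (hT : ∀ i, T (i + 1) = HighOrderSVD.mapH p hqℓ M (T i))
    (hreg : HighOrderSVD.IsRegular (T 0).σ)
    (κ K a ε : ℝ)
    (hκ : κ = HighOrderSVD.kappa (T 0).σ)
    (hK : K = HighOrderSVD.bigK (T 0).σ)
    (ha : a = HighOrderSVD.aConst p)
    (hU : (κ * K) ^ a * HighOrderSVD.matNorm (HighOrderSVD.stiefelDefect (T 0).U) ≤ ε)
    (hV : (κ * K) ^ a * HighOrderSVD.matNorm (HighOrderSVD.stiefelDefect (T 0).V) ≤ ε)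
    (hΔ : κ ^ a * K ^ (a - 1) * HighOrderSVD.matNorm (HighOrderSVD.residual M (T 0)) ≤ ε)
    (hε : ε ≤ HighOrderSVD.u0Const p) :
    (∀ i, HighOrderSVD.IsRegular (T i).σ) ∧
    ∃ Tlim : HighOrderSVD.Triplet m n ℓ q,
      HighOrderSVD.IsSVDSolution M Tlim ∧
      ((∀ j, 0 ≤ (T 0).σ j) → ∀ j, 0 ≤ Tlim.σ j) ∧
      HighOrderSVD.ConvergesWithOrder (p + 1) T Tlim ∧
      ∀ i : ℕ,
        HighOrderSVD.matNorm ((T i).U - Tlim.U) ≤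
          HighOrderSVD.gammaConst p * √(m : ℝ) * (2 : ℝ) ^ (-(((p : ℤ) + 1) ^ i) + 1) * ε ∧
        HighOrderSVD.rowNorm ((T i).U - Tlim.U) ≤
          HighOrderSVD.gammaConst p * √(ℓ : ℝ) * (2 : ℝ) ^ (-(((p : ℤ) + 1) ^ i) + 1) * ε ∧
        HighOrderSVD.matNorm ((T i).V - Tlim.V) ≤
          HighOrderSVD.gammaConst p * √(n : ℝ) * (2 : ℝ) ^ (-(((p : ℤ) + 1) ^ i) + 1) * ε ∧
        HighOrderSVD.rowNorm ((T i).V - Tlim.V) ≤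
          HighOrderSVD.gammaConst p * √(q : ℝ) * (2 : ℝ) ^ (-(((p : ℤ) + 1) ^ i) + 1) * ε ∧
        HighOrderSVD.matNorm
            (HighOrderSVD.rectDiag ℓ (T i).σ - HighOrderSVD.rectDiag ℓ Tlim.σ) ≤
          HighOrderSVD.sigmaConst p q * (2 : ℝ) ^ (-(((p : ℤ) + 1) ^ i) + 1) * ε := by
  subst hκ hK ha
  have h0 : HighOrderSVD.IsApprox (HighOrderSVD.aConst p) M (T 0) ε := ⟨hreg, hU, hV, hΔ⟩
  obtain ⟨Tlim, hsol, hnn, hbounds⟩ :=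
    HighOrderSVD.exists_limit_of_isApprox hℓm hqn hp hq hT h0 hε
  refine ⟨fun i => (HighOrderSVD.isApprox_iterate hp hq hT h0 hε i).reg, Tlim, hsol, hnn, ?_,
    hbounds⟩
  have hε0 := h0.nonneg
  have hγ : 0 ≤ HighOrderSVD.gammaConst p := by
    unfold HighOrderSVD.gammaConst; split_ifs <;> norm_num
  have hs : 0 ≤ HighOrderSVD.sigmaConst p q := by
    unfold HighOrderSVD.sigmaConst; split_ifs <;> norm_num
  set A := HighOrderSVD.gammaConst p * √(m : ℝ) * ε with hA
  set B := HighOrderSVD.gammaConst p * √(n : ℝ) * ε with hB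
  set C := HighOrderSVD.sigmaConst p q * ε with hC
  have hA0 : 0 ≤ A := by positivity
  have hB0 : 0 ≤ B := by positivity
  have hC0 : 0 ≤ C := by positivity
  -- the summand `1` makes the constant positive when `ε = 0`
  refine ⟨A + B + C + 1, by positivity, fun i => ?_⟩
  obtain ⟨hUi, -, hVi, -, hσi⟩ := hbounds i
  have hr0 := HighOrderSVD.rate_pos p i
  have hr : (2 : ℝ) ^ (-(((p + 1 : ℕ) : ℤ) ^ i) + 1) = HighOrderSVD.rate p i := by
    rw [HighOrderSVD.rate]; push_cast; rfl
  rw [hr]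
  have hAr : A * HighOrderSVD.rate p i ≤ (A + B + C + 1) * HighOrderSVD.rate p i := by
    gcongr; linarith
  have hBr : B * HighOrderSVD.rate p i ≤ (A + B + C + 1) * HighOrderSVD.rate p i := by
    gcongr; linarith
  have hCr : C * HighOrderSVD.rate p i ≤ (A + B + C + 1) * HighOrderSVD.rate p i := by
    gcongr; linarith
  refine max_le (max_le (hUi.trans (le_trans (le_of_eq ?_) hAr))
    (hVi.trans (le_trans (le_of_eq ?_) hBr))) (hσi.trans (le_trans (le_of_eq ?_) hCr))
  · rw [hA]; ring
  · rw [hB]; ring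
  · rw [hC]; ring
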